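/- Let $\omega\subset\mathbb R^2$ be a bounded open set of class $\mathcal C^2$, let $\Omega_1=\omega\times\mathbb R$, and write $x=(x',x_3)$ with $x'=(x_1,x_2)\in\mathbb R^2$, $x_3\in\mathbb R$. Let $\nu$ denote both the outward unit normal to $\partial\omega$ and the outward unit normal $(\nu(x'),0)$ to $\partial\Omega_1=\partial\omega\times\mathbb R$, and let $d\sigma(x)=d\sigma(x')\,dx_3$ be the surface measure on $\partial\Omega_1$ ($d\sigma(x')$ being arc length on $\partial\omega$). For $\theta\in\mathbb S^1=\{y\in\mathbb R^2:|y|=1\}$ put $\partial\omega_{\pm,\theta}=\{x'\in\partial\omega:\ \pm\theta\cdot\nu(x')\ge 0\}$. For real $\rho,s$ define $$\varphi_{\pm,s}(x)=\pm\rho\,\theta\cdot x'-\frac{s\,(x'\cdot\theta)^2}{2},\qquad P_{A,q,\pm,s}=e^{-\varphi_{\pm,s}}(\Delta+2iA\cdot\nabla+q)e^{\varphi_{\pm,s}} .$$ **Proposition.** For every $M\ge 0$ there is a constant $C>0$, depending only on $\Omega_1$ and $M$, such that the following holds. Let $A\in L^\infty(\Omega_1;\mathbb R^3)$ and $q\in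 L^\infty(\Omega_1;\mathbb C)$ satisfy $\|q\|_{L^\infty(\Omega_1)}+\|A\|_{L^\infty(\Omega_1)^3}\le M$. Then there exist $s_1>1$ and, for every $s>s_1$, a number $\rho_1(s)>s$ such that for every $\theta\in\mathbb S^1$, each choice of the sign $\pm$, every complex-valued $v\in\mathcal C^2_0(\mathbb R^3)\cap H^1_0(\Omega_1)$ (that is, $v$ is a $\mathcal C^2$ function with compact support on $\mathbb R^3$ whose restriction to $\Omega_1$ belongs to $H^1_0(\Omega_1)$, the closure of $\mathcal C_0^\infty(\Omega_1)$ in $H^1(\Omega_1)$), every $s>s_1$ and every $\rho\ge\rho_1(s)$, $$\begin{aligned}&\rho\int_{\partial\omega_{\pm,\theta}\times\mathbb R}|\partial_\nu v|^2\,|\theta\cdot\nu|\,d\sigma(x)+s\rho^{-2}\int_{\Omega_1}|\Delta v|^2dx+s\int_{\Omega_1}|\nabla v|^2dx+s\rho^2\int_{\Omega_1}|v|^2dx\\&\qquad\le C\left[\|P_{A,q,\pm,s}v\|^2_{L^2(\Omega_1)}+\rho\int_{\partial\omega_{\mp,\theta}\times\mathbb R}|\partial_\nu v|^2\,|\theta\cdot\nu|\,d\sigma(x)\right].\end{aligned}$$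 -/

import Mathlib

open MeasureTheory Filter Topology
open scoped RealInnerProductSpace ENNReal NNReal Laplacian

noncomputable section

namespace Waveguide

/-- The plane `ℝ²` with its Euclidean structure. -/
abbrev E2 : Type := EuclideanSpace ℝ (Fin 2)

/-- The space `ℝ³` with its Euclidean structure. -/
abbrev E3 : Type := EuclideanSpace ℝ (Fin 3)

/-- The transversal part `x' = (x₁, x₂)` of `x = (x', x₃)`. -/
def transversal (x : E3) : E2 := !₂[x 0, x 1]

/-- The point `(y, t)` of `ℝ³ = ℝ² × ℝ`. -/
def cylPoint (y : E2) (t : ℝ) : E3 := !₂[y 0, y 1, t]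

/-- The infinite cylinder `ω × ℝ`. -/
def cylinder (ω : Set E2) : Set E3 := {x | transversal x ∈ ω}

/-! ### Planar domains with `C²` boundary and their outward unit normal -/

/-- `g` is a `C²` function near `x`, with nonzero gradient at `x`, and near `x` the set `ω` is the
sublevel set `{g < 0}`. -/
structure IsC2DefiningFunctionAt (ω : Set E2) (x : E2) (g : E2 → ℝ) : Prop where
  contDiffAt : ContDiffAt ℝ 2 g x
  gradient_ne_zero : gradient g x ≠ 0
  mem_iff : ∀ᶠ y in 𝓝 x, (y ∈ ω ↔ g y < 0)

/-- Open sets of class `C²`: near every boundary point the set lies on one side of a `C²` curve,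
the zero set of a `C²` defining function. -/
structure IsC2Open (ω : Set E2) : Prop where
  isOpen : IsOpen ω
  exists_defining : ∀ x ∈ frontier ω, ∃ g : E2 → ℝ, IsC2DefiningFunctionAt ω x g

open Classical in
/-- The outward unit normal `∇g / |∇g|` of `ω` at `x`, where `g` is a defining function of `ω` near
`x` (the value does not depend on the choice of `g` when `x` is a boundary point);
it is `0` where there is no defining function. -/
def outwardNormal (ω : Set E2) (x : E2) : E2 :=
  if h : ∃ g : E2 → ℝ, IsC2DefiningFunctionAt ω x g then
    ‖gradient h.choose x‖⁻¹ • gradient h.choose x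
  else 0

/-! ### The lateral boundary `∂ω × ℝ` -/

/-- The surface measure `dσ(x) = dσ(x') dx₃` on `∂ω × ℝ`, as a measure on `ℝ³`: arc length
(one-dimensional Hausdorff measure) on `∂ω` times Lebesgue measure on `ℝ`. -/
def lateralMeasure (ω : Set E2) : Measure E3 :=
  (((Measure.hausdorffMeasure 1 : Measure E2).restrict (frontier ω)).prod
    (volume : Measure ℝ)).map (fun p => cylPoint p.1 p.2)

/-- The face `∂ω_{±,θ} × ℝ`, where `∂ω_{±,θ} = {x' ∈ ∂ω : ± θ · ν(x') ≥ 0}`; the sign is `ε`. -/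
def lateralFace (ω : Set E2) (ε : ℝ) (θ : E2) : Set E3 :=
  {x | transversal x ∈ frontier ω ∧ 0 ≤ ε * ⟪θ, outwardNormal ω (transversal x)⟫}

/-- The normal derivative `∂_ν v` at a point of `∂ω × ℝ`, with `ν = (ν', 0)`. -/
def normalDeriv (ω : Set E2) (v : E3 → ℂ) (x : E3) : ℂ :=
  fderiv ℝ v x (cylPoint (outwardNormal ω (transversal x)) 0)

/-- The boundary term `∫_{∂ω_{±,θ} × ℝ} |∂_ν v|² |θ · ν| dσ`; the sign is `ε`. -/
def boundaryTerm (ω : Set E2) (ε : ℝ) (θ : E2) (v : E3 → ℂ) : ℝ :=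
  ∫ x in lateralFace ω ε θ,
    ‖normalDeriv ω v x‖ ^ 2 * |⟪θ, outwardNormal ω (transversal x)⟫| ∂(lateralMeasure ω)

/-! ### Derivatives and the space `H¹₀` -/

/-- The partial derivative `∂_j v`. -/
def pderiv (j : Fin 3) (v : E3 → ℂ) (x : E3) : ℂ :=
  fderiv ℝ v x (EuclideanSpace.single j 1)

/-- Test functions: `φ ∈ C_c^∞(Ω)`. -/
structure IsTestFunction (Ω : Set E3) (φ : E3 → ℂ) : Prop where
  contDiff : ContDiff ℝ (⊤ : ℕ∞) φ
  hasCompactSupport : HasCompactSupport φ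
  tsupport_subset : tsupport φ ⊆ Ω

/-- `u` belongs to `H¹(Ω)` and `G` is its weak gradient on `Ω`. -/
structure IsH1With (Ω : Set E3) (u : E3 → ℂ) (G : Fin 3 → E3 → ℂ) : Prop where
  memLp : MemLp u 2 (volume.restrict Ω)
  memLp_grad : ∀ j, MemLp (G j) 2 (volume.restrict Ω)
  weak : ∀ j, ∀ φ : E3 → ℂ, IsTestFunction Ω φ →
    ∫ x in Ω, u x * pderiv j φ x = -∫ x in Ω, G j x * φ x

/-- `u ∈ H¹₀(Ω)`: `u ∈ H¹(Ω)` is a limit in `H¹(Ω)` of functions in `C_c^∞(Ω)`. -/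
def MemH10 (Ω : Set E3) (u : E3 → ℂ) : Prop :=
  ∃ G : Fin 3 → E3 → ℂ, IsH1With Ω u G ∧
    ∃ φ : ℕ → E3 → ℂ, (∀ n, IsTestFunction Ω (φ n)) ∧
      Tendsto (fun n => eLpNorm (fun x => φ n x - u x) 2 (volume.restrict Ω)) atTop (𝓝 0) ∧
      ∀ j, Tendsto (fun n => eLpNorm (fun x => pderiv j (φ n) x - G j x) 2 (volume.restrict Ω))
        atTop (𝓝 0)

/-! ### The weight and the conjugated operator -/

/-- The weight `φ_{±,s}(x) = ± ρ θ · x' - s (x' · θ)² / 2`; the sign is `ε`. -/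
def weight (ε ρ s : ℝ) (θ : E2) (x : E3) : ℝ :=
  ε * ρ * ⟪θ, transversal x⟫ - s * ⟪transversal x, θ⟫ ^ 2 / 2

/-- The operator `Δ + 2 i A · ∇ + q`. -/
def magneticOp (A : E3 → E3) (q : E3 → ℂ) (w : E3 → ℂ) (x : E3) : ℂ :=
  Δ w x + 2 * Complex.I * ∑ j : Fin 3, (A x j : ℂ) * pderiv j w x + q x * w x

/-- The conjugated operator `P_{A,q,±,s} = e^{-φ_{±,s}} (Δ + 2 i A · ∇ + q) e^{φ_{±,s}}`. -/
def carlemanOp (A : E3 → E3) (q : E3 → ℂ) (ε ρ s : ℝ) (θ : E2) (v : E3 → ℂ) (x : E3) : ℂ :=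
  (Real.exp (-weight ε ρ s θ x) : ℂ) *
    magneticOp A q (fun y => (Real.exp (weight ε ρ s θ y) : ℂ) * v y) x

end Waveguide

end

/-!
Put `a = ±ρ - s (x' · θ)`, so that the weight has gradient `a θ` and Laplacian `-s`. Conjugation by
its exponential turns `Δ` into `S + T` with the symmetric part `S = Δ + a²` and the antisymmetric
part `T = 2 a ∂_θ - s` (`carlemanOp_eq`), up to terms carrying the coefficients `A` and `q`. In
`‖S v + T v‖² = ‖S v‖² + ‖T v‖² + 2 ⟨S v, T v⟩` the cross term is the divergence of a vector field
`F` (`carlemanField`) plus `4 s |∂_θ v|² + 4 s a² |v|²` (`two_inner_symmPart_antisymmPart`): the quadratic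
correction of the linear weight is what makes these terms positive. For `v` vanishing on the
boundary, the flux of the vector field is the integral of `2 a (θ · ν) |∂_ν v|²`, whose sign on
each of the two faces is that of `±θ · ν` once `ρ` dominates `s (x' · θ)`. This yields
`carleman_inequality`.

The remaining quantities follow from `S`: multiplying `S v` by `v` controls `s ‖∇v‖²`
(`setIntegral_sum_pderiv_sq`), and `Δ v = S v - a² v` controls `s ρ⁻² ‖Δ v‖²`. The terms with `A`
and `q` are bounded by `‖∇v‖² + ρ² ‖v‖²` and are absorbed for `s` large (`carleman_absorption`).

Two facts about the cylinder support this. The first is the divergence theorem, which is proved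
below the graph of a `C¹` function, transported to `ω` by orthonormal frames and a partition of
unity, and multiplied by the line. The boundary measure `μ` obtained in this way is only shown to
be comparable with the surface measure (`IsLateralBoundaryMeasure`): its density in each chart is
`√(1 + h'²)`, which lies between two positive constants, and the graph is parametrized by a
bi-Lipschitz map. This is enough, because the two boundary terms enter the estimate with constants
depending on `ω` anyway. The second fact is that a `C¹` function in `H¹₀` vanishes on the boundary
(`MemH10.eq_zero_of_mem_frontier`). Approximation by test functions shows that `|v|²`, localized
near a boundary point, has zero flux in the direction of the normal at that point, while the flux
density is nonnegative there.
-/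

namespace Waveguide

/-! ### Defining functions and the outward normal -/

theorem IsC2DefiningFunctionAt.differentiableAt {ω : Set E2} {x : E2} {g : E2 → ℝ}
    (hg : IsC2DefiningFunctionAt ω x g) : DifferentiableAt ℝ g x :=
  hg.contDiffAt.differentiableAt two_ne_zero

theorem IsC2DefiningFunctionAt.continuousAt_gradient {ω : Set E2} {x : E2} {g : E2 → ℝ}
    (hg : IsC2DefiningFunctionAt ω x g) : ContinuousAt (gradient g) x := by
  have h : ContinuousAt (fderiv ℝ g) x :=
    (hg.contDiffAt.fderiv_right (m := 0) (by norm_num)).continuousAt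
  exact (InnerProductSpace.toDual ℝ E2).symm.continuous.continuousAt.comp h

/-- A defining function near `x` is a defining function near every point close to `x`. -/
theorem IsC2DefiningFunctionAt.eventually {ω : Set E2} {x : E2} {g : E2 → ℝ}
    (hg : IsC2DefiningFunctionAt ω x g) : ∀ᶠ y in 𝓝 x, IsC2DefiningFunctionAt ω y g := by
  filter_upwards [hg.contDiffAt.eventually (by simp), hg.mem_iff.eventually_nhds,
    hg.continuousAt_gradient.eventually_ne hg.gradient_ne_zero] with y h1 h2 h3
  exact ⟨h1, h3, h2⟩

theorem IsC2DefiningFunctionAt.eq_zero_of_mem_frontier {ω : Set E2} {x : E2} {g : E2 → ℝ}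
    (hg : IsC2DefiningFunctionAt ω x g) (hω : IsOpen ω) (hx : x ∈ frontier ω) : g x = 0 := by
  rw [hω.frontier_eq] at hx
  have h1 : 0 ≤ g x := by
    by_contra! h
    exact hx.2 (hg.mem_iff.self_of_nhds.2 h)
  have h2 : g x ≤ 0 := by
    by_contra! h
    obtain ⟨y, hy, hy'⟩ := mem_closure_iff_frequently.1 hx.1 |>.and_eventually
      (hg.mem_iff.and (hg.contDiffAt.continuousAt.eventually (lt_mem_nhds h))) |>.exists
    exact absurd (hy'.1.1 hy) (not_lt.2 (le_of_lt hy'.2))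
  linarith

/-- Along a direction in which one defining function decreases, no other one increases, since both
are negative exactly on the set. -/
theorem IsC2DefiningFunctionAt.inner_gradient_nonpos {ω : Set E2} {x : E2} {g₁ g₂ : E2 → ℝ}
    (h₁ : IsC2DefiningFunctionAt ω x g₁) (h₂ : IsC2DefiningFunctionAt ω x g₂)
    (z₁ : g₁ x = 0) (z₂ : g₂ x = 0) {w : E2} (hw : ⟪gradient g₁ x, w⟫ < 0) :
    ⟪gradient g₂ x, w⟫ ≤ 0 := by
  have hl : HasDerivAt (fun t : ℝ => x + t • w) w 0 := by
    simpa using ((hasDerivAt_id (0 : ℝ)).smul_const w).const_add x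
  have hd : ∀ g : E2 → ℝ, DifferentiableAt ℝ g x →
      HasDerivAt (fun t : ℝ => g (x + t • w)) ⟪gradient g x, w⟫ 0 := by
    intro g hg
    have h := hg.hasGradientAt.hasFDerivAt
    have h' : HasFDerivAt g (InnerProductSpace.toDual ℝ E2 (gradient g x)) (x + (0 : ℝ) • w) := by
      simpa using h
    exact h'.comp_hasDerivAt (0 : ℝ) hl
  by_contra! hpos
  have ev : ∀ g : E2 → ℝ, g x = 0 → DifferentiableAt ℝ g x → ∀ c : ℝ, 0 < c * ⟪gradient g x, w⟫ →
      ∀ᶠ t in 𝓝[>] (0 : ℝ), 0 < c * g (x + t • w) := by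
    intro g hz hg c hc
    have := ((hd g hg).const_mul c).hasDerivWithinAt (s := Set.Ioi 0)
    have := hasDerivWithinAt_iff_tendsto_slope' (Set.self_notMem_Ioi) |>.1 this
    filter_upwards [this.eventually (lt_mem_nhds hc), self_mem_nhdsWithin] with t ht ht0
    have ht0 : 0 < t := ht0
    simp only [slope_def_field, zero_smul, add_zero, hz, mul_zero, sub_zero] at ht
    exact (div_pos_iff_of_pos_right ht0).1 ht
  have e1 := ev g₁ z₁ h₁.differentiableAt (-1) (by linarith)
  have e2 := ev g₂ z₂ h₂.differentiableAt 1 (by linarith)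
  have hc : Tendsto (fun t : ℝ => x + t • w) (𝓝[>] 0) (𝓝 x) := by
    have := hl.continuousAt.tendsto
    simp only [zero_smul, add_zero] at this
    exact this.mono_left nhdsWithin_le_nhds
  obtain ⟨t, ht⟩ := (e1.and (e2.and ((hc.eventually h₁.mem_iff).and
    (hc.eventually h₂.mem_iff)))).exists
  obtain ⟨a, b, c, d⟩ := ht
  have := d.1 (c.2 (by linarith))
  linarith

/-- Two nonzero vectors are positively proportional if every vector at an obtuse angle to the first
makes no acute angle with the second. -/
theorem inv_norm_smul_eq_of_inner_nonpos {V : Type*} [NormedAddCommGroup V]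
    [InnerProductSpace ℝ V] {a b : V} (ha : a ≠ 0) (hb : b ≠ 0)
    (h : ∀ w, ⟪a, w⟫ < 0 → ⟪b, w⟫ ≤ 0) : ‖a‖⁻¹ • a = ‖b‖⁻¹ • b := by
  have ha' : 0 < ‖a‖ := norm_pos_iff.2 ha
  have hb' : 0 < ‖b‖ := norm_pos_iff.2 hb
  -- Testing `h` on `b / |b| - a / |a|`, perturbed by a multiple of `a`, bounds the inner product.
  have key : ∀ δ : ℝ, 0 < δ → ⟪b, ‖b‖⁻¹ • b - (‖a‖⁻¹ * (1 + δ)) • a⟫ ≤ 0 := by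
    intro δ hδ
    apply h
    rw [inner_sub_right, inner_smul_right, inner_smul_right, real_inner_self_eq_norm_sq]
    have h1 : ⟪a, b⟫ ≤ ‖a‖ * ‖b‖ := real_inner_le_norm a b
    have h2 : ‖b‖⁻¹ * ⟪a, b⟫ ≤ ‖a‖ := by
      rw [inv_mul_le_iff₀ hb']; linarith
    have h3 : ‖a‖⁻¹ * (1 + δ) * ‖a‖ ^ 2 = (1 + δ) * ‖a‖ := by field_simp
    rw [h3]; nlinarith
  have key2 : ‖b‖ - ‖a‖⁻¹ * ⟪b, a⟫ ≤ 0 := by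
    have ht : Tendsto (fun δ : ℝ => ⟪b, ‖b‖⁻¹ • b - (‖a‖⁻¹ * (1 + δ)) • a⟫) (𝓝[>] 0)
        (𝓝 ⟪b, ‖b‖⁻¹ • b - (‖a‖⁻¹ * (1 + 0)) • a⟫) := by
      have : Continuous (fun δ : ℝ => ⟪b, ‖b‖⁻¹ • b - (‖a‖⁻¹ * (1 + δ)) • a⟫) := by fun_prop
      exact this.continuousAt.tendsto.mono_left nhdsWithin_le_nhds
    have := le_of_tendsto ht (by filter_upwards [self_mem_nhdsWithin] with δ hδ using key δ hδ)
    rw [inner_sub_right, inner_smul_right, inner_smul_right, real_inner_self_eq_norm_sq] at this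
    have e : ‖b‖⁻¹ * ‖b‖ ^ 2 = ‖b‖ := by field_simp
    rw [e] at this
    simpa using this
  have heq : ⟪a, b⟫ = ‖a‖ * ‖b‖ := by
    refine le_antisymm (real_inner_le_norm a b) ?_
    rw [real_inner_comm] at key2
    have : ‖b‖ ≤ ‖a‖⁻¹ * ⟪a, b⟫ := by linarith
    rw [le_inv_mul_iff₀ ha'] at this
    exact this
  rw [inner_eq_norm_mul_iff_real] at heq
  have : ‖b‖⁻¹ • ‖a‖⁻¹ • (‖b‖ • a) = ‖b‖⁻¹ • ‖a‖⁻¹ • (‖a‖ • b) := by rw [heq]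
  simp only [smul_smul] at this
  have e1 : ‖b‖⁻¹ * (‖a‖⁻¹ * ‖b‖) = ‖a‖⁻¹ := by field_simp
  have e2 : ‖b‖⁻¹ * (‖a‖⁻¹ * ‖a‖) = ‖b‖⁻¹ := by field_simp
  rwa [e1, e2] at this

/-- The outward normal may be computed with any defining function. -/
theorem IsC2DefiningFunctionAt.outwardNormal_eq {ω : Set E2} {x : E2} {g : E2 → ℝ}
    (hg : IsC2DefiningFunctionAt ω x g) (hω : IsOpen ω) (hx : x ∈ frontier ω) :
    outwardNormal ω x = ‖gradient g x‖⁻¹ • gradient g x := by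
  have h : ∃ g : E2 → ℝ, IsC2DefiningFunctionAt ω x g := ⟨g, hg⟩
  rw [outwardNormal, dif_pos h]
  have hc := h.choose_spec
  refine inv_norm_smul_eq_of_inner_nonpos hc.gradient_ne_zero hg.gradient_ne_zero fun w hw =>
    hc.inner_gradient_nonpos hg (hc.eq_zero_of_mem_frontier hω hx)
      (hg.eq_zero_of_mem_frontier hω hx) hw

theorem norm_outwardNormal {ω : Set E2} (hω : IsC2Open ω) {x : E2} (hx : x ∈ frontier ω) :
    ‖outwardNormal ω x‖ = 1 := by
  obtain ⟨g, hg⟩ := hω.exists_defining x hx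
  rw [hg.outwardNormal_eq hω.isOpen hx, norm_smul, norm_inv, norm_norm,
    inv_mul_cancel₀ (norm_ne_zero_iff.2 hg.gradient_ne_zero)]

theorem continuousOn_outwardNormal {ω : Set E2} (hω : IsC2Open ω) :
    ContinuousOn (outwardNormal ω) (frontier ω) := by
  intro x hx
  obtain ⟨g, hg⟩ := hω.exists_defining x hx
  have hc : ContinuousAt (fun y => ‖gradient g y‖⁻¹ • gradient g y) x :=
    (hg.continuousAt_gradient.norm.inv₀ (norm_ne_zero_iff.2 hg.gradient_ne_zero)).smul
      hg.continuousAt_gradient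
  refine (hc.continuousWithinAt (s := frontier ω)).congr_of_eventuallyEq ?_
    (hg.outwardNormal_eq hω.isOpen hx)
  filter_upwards [self_mem_nhdsWithin, nhdsWithin_le_nhds hg.eventually] with y hy hgy
  exact hgy.outwardNormal_eq hω.isOpen hy

/-! ### The boundary as a graph in an orthonormal frame -/

/-- The point with coordinates `(x, y)` in the orthonormal frame `b`. -/
noncomputable def frame (b : OrthonormalBasis (Fin 2) ℝ E2) : ℝ × ℝ →L[ℝ] E2 :=
  (ContinuousLinearMap.fst ℝ ℝ ℝ).smulRight (b 0) + (ContinuousLinearMap.snd ℝ ℝ ℝ).smulRight (b 1)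

theorem frame_apply (b : OrthonormalBasis (Fin 2) ℝ E2) (p : ℝ × ℝ) :
    frame b p = p.1 • b 0 + p.2 • b 1 := rfl

theorem inner_frame_zero (b : OrthonormalBasis (Fin 2) ℝ E2) (p : ℝ × ℝ) :
    ⟪b 0, frame b p⟫ = p.1 := by
  have h := b.orthonormal.2 (i := 0) (j := 1) (by simp)
  simp [frame_apply, inner_add_right, inner_smul_right, b.orthonormal.1 0] at h ⊢

theorem inner_frame_one (b : OrthonormalBasis (Fin 2) ℝ E2) (p : ℝ × ℝ) :
    ⟪b 1, frame b p⟫ = p.2 := by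
  have h := b.orthonormal.2 (i := 1) (j := 0) (by simp)
  simp [frame_apply, inner_add_right, inner_smul_right, b.orthonormal.1 1] at h ⊢

theorem frame_inner (b : OrthonormalBasis (Fin 2) ℝ E2) (y : E2) :
    frame b (⟪b 0, y⟫, ⟪b 1, y⟫) = y := by
  conv_rhs => rw [← b.sum_repr' y]
  simp [frame_apply]

theorem norm_frame_sq (b : OrthonormalBasis (Fin 2) ℝ E2) (p : ℝ × ℝ) :
    ‖frame b p‖ ^ 2 = p.1 ^ 2 + p.2 ^ 2 := by
  rw [← real_inner_self_eq_norm_sq]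
  nth_rewrite 1 [frame_apply]
  rw [inner_add_left, inner_smul_left, inner_smul_left, inner_frame_zero, inner_frame_one]
  simp [sq]

/-- In the open set `U` and the frame `b`, the set `ω` is the region below the graph of the `C¹`
function `h`, and its outward normal points upwards. -/
structure IsLocalGraph (ω U : Set E2) (b : OrthonormalBasis (Fin 2) ℝ E2) (h : ℝ → ℝ) : Prop where
  isOpen : IsOpen U
  isBounded : Bornology.IsBounded U
  contDiff : ContDiff ℝ 1 h
  exists_lipschitz : ∃ K : ℝ≥0, LipschitzWith K h
  mem_iff : ∀ p, frame b p ∈ U → (frame b p ∈ ω ↔ p.2 < h p.1)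
  mem_frontier_iff : ∀ p, frame b p ∈ U → (frame b p ∈ frontier ω ↔ p.2 = h p.1)
  outwardNormal_eq : ∀ x, frame b (x, h x) ∈ U →
    outwardNormal ω (frame b (x, h x)) = (√(1 + deriv h x ^ 2))⁻¹ • frame b (-deriv h x, 1)

/-- A function that is `C^n` at a point coincides near it with a globally `C^n` function of compact
support. -/
theorem exists_contDiff_eventuallyEq {φ : ℝ → ℝ} {x₀ : ℝ} {n : ℕ} (hφ : ContDiffAt ℝ n φ x₀) :
    ∃ h : ℝ → ℝ, ContDiff ℝ n h ∧ HasCompactSupport h ∧ h =ᶠ[𝓝 x₀] φ := by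
  obtain ⟨u, hu, hφu⟩ := hφ.contDiffOn le_rfl (by simp)
  obtain ⟨r, hr, hru⟩ := Metric.nhds_basis_closedBall.mem_iff.1 hu
  let χ : ContDiffBump x₀ := ⟨r / 3, r / 2, by positivity, by linarith⟩
  refine ⟨fun x => χ x * φ x, ?_, χ.hasCompactSupport.mul_right, ?_⟩
  · rw [contDiff_iff_contDiffAt]
    intro x
    by_cases hx : x ∈ tsupport χ
    · rw [χ.tsupport_eq] at hx
      have hxr : u ∈ 𝓝 x := by
        refine mem_of_superset (Metric.isOpen_ball.mem_nhds (x := x) (s := Metric.ball x₀ r) ?_)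
          (Metric.ball_subset_closedBall.trans hru)
        exact Metric.closedBall_subset_ball (by change r / 2 < r; linarith) hx
      exact χ.contDiff.contDiffAt.mul (hφu.contDiffAt hxr)
    · have : (fun x => χ x * φ x) =ᶠ[𝓝 x] fun _ => 0 := by
        filter_upwards [(isClosed_tsupport χ).isOpen_compl.mem_nhds hx] with y hy
        rw [image_eq_zero_of_notMem_tsupport hy, zero_mul]
      exact contDiffAt_const.congr_of_eventuallyEq this
  · filter_upwards [χ.eventuallyEq_one] with x hx
    rw [hx]; simp

/-- Near a boundary point the implicit function theorem, applied in a frame whose second vector is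
the normal at that point, writes the boundary as a graph. -/
theorem exists_isLocalGraph {ω : Set E2} (hω : IsC2Open ω) {p : E2} (hp : p ∈ frontier ω) :
    ∃ U b h, p ∈ U ∧ IsLocalGraph ω U b h := by
  obtain ⟨g, hg⟩ := hω.exists_defining p hp
  set n : E2 := ‖gradient g p‖⁻¹ • gradient g p with hn
  have hgn : 0 < ‖gradient g p‖ := norm_pos_iff.2 hg.gradient_ne_zero
  obtain ⟨b, hb⟩ : ∃ b : OrthonormalBasis (Fin 2) ℝ E2, ∀ i ∈ ({1} : Set (Fin 2)), b i = n := by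
    refine Orthonormal.exists_orthonormalBasis_extension_of_card_eq (v := fun _ : Fin 2 => n)
      (by simp) ?_
    constructor
    · intro i
      simp only [Set.domRestrict_apply, hn, norm_smul, norm_inv, norm_norm]
      exact inv_mul_cancel₀ hgn.ne'
    · intro i j hij
      exact absurd (Subsingleton.elim i j) hij
  have hb1 : b 1 = n := hb 1 rfl
  set P : ℝ × ℝ := (⟪b 0, p⟫, ⟪b 1, p⟫) with hP
  have hPp : frame b P = p := frame_inner b p
  have hfc : Tendsto (frame b) (𝓝 P) (𝓝 p) := by
    have := (frame b).continuous.tendsto P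
    rwa [hPp] at this
  -- The derivative of the defining function in the frame.
  have hder : ∀ q, IsC2DefiningFunctionAt ω (frame b q) g → HasFDerivAt (fun q => g (frame b q))
      ((InnerProductSpace.toDual ℝ E2 (gradient g (frame b q))).comp (frame b)) q := fun q hq =>
    hq.differentiableAt.hasGradientAt.hasFDerivAt.comp q (frame b).hasFDerivAt
  have hgP : IsC2DefiningFunctionAt ω (frame b P) g := by rw [hPp]; exact hg
  have hG : ContDiffAt ℝ 2 (fun q => g (frame b q)) P :=
    ContDiffAt.comp P hgP.contDiffAt (frame b).contDiff.contDiffAt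
  have hg0 : g p = 0 := hg.eq_zero_of_mem_frontier hω.isOpen hp
  have hinv : (fderiv ℝ (fun q => g (frame b q)) P ∘L .inr ℝ ℝ ℝ).IsInvertible := by
    have e : fderiv ℝ (fun q => g (frame b q)) P ∘L .inr ℝ ℝ ℝ
        = ((ContinuousLinearEquiv.unitsEquivAut ℝ (Units.mk0 _ hgn.ne') : ℝ ≃L[ℝ] ℝ) :
          ℝ →L[ℝ] ℝ) := by
      rw [(hder P hgP).fderiv, hPp]
      ext
      simp [frame_apply, hb1, hn]
      field_simp
      rw [← real_inner_self_eq_norm_sq, inner_gradient_left]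
    rw [e]
    exact ContinuousLinearMap.isInvertible_equiv
  set φ := hG.implicitFunction two_ne_zero hinv with hφdef
  have hφ : ContDiffAt ℝ ((1 : ℕ) : WithTop ℕ∞) φ P.1 :=
    (hG.contDiffAt_implicitFunction two_ne_zero hinv).of_le (by norm_num)
  obtain ⟨h, hhc, hhs, hhφ⟩ := exists_contDiff_eventuallyEq hφ
  have hh0 : h P.1 = P.2 := by
    rw [hhφ.self_of_nhds]; exact hG.implicitFunction_apply_self two_ne_zero hinv
  have hev : ∀ᶠ q in 𝓝 P, IsC2DefiningFunctionAt ω (frame b q) g ∧ 0 < ⟪gradient g (frame b q), b 1⟫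
      ∧ (g (frame b q) = 0 ↔ q.2 = h q.1) := by
    have e1 : ∀ᶠ q in 𝓝 P, 0 < ⟪gradient g (frame b q), b 1⟫ := by
      have : ContinuousAt (fun y => ⟪gradient g y, b 1⟫) p :=
        hg.continuousAt_gradient.inner continuousAt_const
      refine hfc.eventually (this.eventually (lt_mem_nhds ?_))
      rw [hb1]
      change 0 < ⟪gradient g p, n⟫
      rw [hn, inner_smul_right, real_inner_self_eq_norm_sq]
      positivity
    have e2 : ∀ᶠ q in 𝓝 P, h q.1 = φ q.1 := continuousAt_fst.eventually hhφ
    filter_upwards [hfc.eventually hg.eventually, e1, e2,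
      hG.eventually_apply_eq_iff_implicitFunction two_ne_zero hinv] with q h1 h2 h3 h4
    refine ⟨h1, h2, ?_⟩
    rw [hPp, hg0] at h4
    rw [h3, h4]; exact eq_comm
  obtain ⟨r, hr, hball⟩ := Metric.eventually_nhds_iff_ball.1 hev
  obtain ⟨r₁, hr₁, hball₁⟩ := Metric.eventually_nhds_iff_ball.1
    (hhc.continuous.continuousAt.eventually
      (Metric.isOpen_ball.mem_nhds (by rw [hh0]; exact Metric.mem_ball_self hr) :
        Metric.ball P.2 r ∈ 𝓝 (h P.1)))
  set U : Set E2 := {y | ⟪b 0, y⟫ ∈ Metric.ball P.1 (min r r₁) ∧ ⟪b 1, y⟫ ∈ Metric.ball P.2 r}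
    with hU
  have hmemU : ∀ q, frame b q ∈ U ↔ q.1 ∈ Metric.ball P.1 (min r r₁) ∧ q.2 ∈ Metric.ball P.2 r := by
    intro q
    simp [hU, inner_frame_zero, inner_frame_one]
  have hq : ∀ x ∈ Metric.ball P.1 (min r r₁), ∀ y ∈ Metric.ball P.2 r,
      (x, y) ∈ Metric.ball P r := by
    intro x hx y hy
    rw [← ball_prod_same]
    exact ⟨Metric.ball_subset_ball (min_le_left _ _) hx, hy⟩
  have hhx : ∀ x ∈ Metric.ball P.1 (min r r₁), h x ∈ Metric.ball P.2 r := fun x hx =>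
    hball₁ x (Metric.ball_subset_ball (min_le_right _ _) hx)
  have hmono : ∀ x ∈ Metric.ball P.1 (min r r₁),
      StrictMonoOn (fun y => g (frame b (x, y))) (Metric.ball P.2 r) := by
    intro x hx
    have hd : ∀ y ∈ Metric.ball P.2 r, HasDerivAt (fun y => g (frame b (x, y)))
        ⟪gradient g (frame b (x, y)), b 1⟫ y := by
      intro y hy
      have h1 := hder (x, y) (hball _ (hq x hx y hy)).1
      have h2 : HasDerivAt (fun y : ℝ => (x, y)) ((0 : ℝ), (1 : ℝ)) y :=
        (hasDerivAt_const y x).prodMk (hasDerivAt_id y)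
      have h3 := h1.comp_hasDerivAt y h2
      simpa [frame_apply, Function.comp_def] using h3
    refine strictMonoOn_of_deriv_pos (convex_ball _ _)
      (fun y hy => (hd y hy).continuousAt.continuousWithinAt) fun y hy => ?_
    have hy := interior_subset hy
    rw [(hd y hy).deriv]
    exact (hball _ (hq x hx y hy)).2.1
  have hmem : ∀ q, frame b q ∈ U → (frame b q ∈ ω ↔ q.2 < h q.1) := by
    intro q hqU
    obtain ⟨hx, hy⟩ := (hmemU q).1 hqU
    have h1 := hball _ (hq _ hx _ hy)
    have h2 : g (frame b (q.1, h q.1)) = 0 := (hball _ (hq _ hx _ (hhx _ hx))).2.2.2 rfl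
    rw [h1.1.mem_iff.self_of_nhds, ← (hmono _ hx).lt_iff_lt hy (hhx _ hx), h2]
  have hfront : ∀ q, frame b q ∈ U → (frame b q ∈ frontier ω ↔ q.2 = h q.1) := by
    intro q hqU
    obtain ⟨hx, hy⟩ := (hmemU q).1 hqU
    have h1 := hball _ (hq _ hx _ hy)
    rw [← h1.2.2]
    refine ⟨fun hf => h1.1.eq_zero_of_mem_frontier hω.isOpen hf, fun h0 => ?_⟩
    have hqh : q.2 = h q.1 := h1.2.2.1 h0
    rw [hω.isOpen.frontier_eq]
    refine ⟨?_, fun hmω => ?_⟩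
    · have ht : Tendsto (fun t : ℝ => frame b (q.1, t)) (𝓝[<] q.2) (𝓝 (frame b q)) := by
        have : Continuous (fun t : ℝ => frame b (q.1, t)) := by fun_prop
        exact this.continuousAt.tendsto.mono_left nhdsWithin_le_nhds
      refine mem_closure_of_tendsto ht ?_
      filter_upwards [self_mem_nhdsWithin, nhdsWithin_le_nhds (Metric.isOpen_ball.mem_nhds hy)]
        with t ht htb
      refine (hmem (q.1, t) ((hmemU _).2 ⟨hx, htb⟩)).2 ?_
      rw [← hqh]; exact ht
    · exact absurd hqh ((hmem q hqU).1 hmω).ne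
  refine ⟨U, b, h, ?_, ?_, ?_, by exact_mod_cast hhc, ?_, hmem, hfront, ?_⟩
  · rw [← hPp, hmemU]
    exact ⟨Metric.mem_ball_self (lt_min hr hr₁), Metric.mem_ball_self hr⟩
  · exact (Metric.isOpen_ball.preimage (by fun_prop : Continuous fun y : E2 => ⟪b 0, y⟫)).inter
      (Metric.isOpen_ball.preimage (by fun_prop : Continuous fun y : E2 => ⟪b 1, y⟫))
  · have : U ⊆ frame b '' (Metric.closedBall P.1 (min r r₁) ×ˢ Metric.closedBall P.2 r) := by
      intro y hy
      refine ⟨(⟪b 0, y⟫, ⟪b 1, y⟫), ⟨Metric.ball_subset_closedBall hy.1,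
        Metric.ball_subset_closedBall hy.2⟩, frame_inner b y⟩
    exact (((isCompact_closedBall _ _).prod (isCompact_closedBall _ _)).image
      (frame b).continuous).isBounded.subset this
  · exact hhc.lipschitzWith_of_hasCompactSupport hhs (by simp)
  · intro x hxU
    obtain ⟨hx, hy⟩ := (hmemU _).1 hxU
    have h1 := hball _ (hq _ hx _ hy)
    have hfr : frame b (x, h x) ∈ frontier ω := (hfront _ hxU).2 rfl
    rw [h1.1.outwardNormal_eq hω.isOpen hfr]
    set N := gradient g (frame b (x, h x)) with hN
    -- The gradient is orthogonal to the tangent vector of the graph.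
    have horth : ⟪N, b 0⟫ + deriv h x * ⟪N, b 1⟫ = 0 := by
      have hcurve : HasDerivAt (fun x => (x, h x)) ((1 : ℝ), deriv h x) x :=
        (hasDerivAt_id x).prodMk ((hhc.differentiable (by simp)) x).hasDerivAt
      have hd := (hder (x, h x) h1.1).comp_hasDerivAt x hcurve
      have hz : (fun x => g (frame b (x, h x))) =ᶠ[𝓝 x] fun _ => 0 := by
        filter_upwards [Metric.isOpen_ball.mem_nhds hx] with z hz
        exact (hball _ (hq _ hz _ (hhx _ hz))).2.2.2 rfl
      have := hd.unique ((hasDerivAt_const x (0 : ℝ)).congr_of_eventuallyEq hz)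
      rw [hN, inner_gradient_left, inner_gradient_left]
      simpa [frame_apply] using this
    have hc : 0 < ⟪N, b 1⟫ := h1.2.1
    have hNeq : N = ⟪N, b 1⟫ • frame b (-deriv h x, 1) := by
      rw [← map_smul]
      conv_lhs => rw [← frame_inner b N]
      congr 1
      ext
      · rw [real_inner_comm]
        simp only [Prod.smul_mk, smul_eq_mul]
        linarith
      · simp [real_inner_comm]
    have hnorm : ‖frame b (-deriv h x, 1)‖ = √(1 + deriv h x ^ 2) := by
      rw [← Real.sqrt_sq (norm_nonneg _), norm_frame_sq]
      congr 1; ring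
    conv_lhs => rw [hNeq]
    rw [norm_smul, Real.norm_of_nonneg hc.le, hnorm, smul_smul]
    congr 1
    field_simp

/-! ### Gauss–Green below a graph -/

theorem integral_fderiv_eq_zero {V : Type*} [NormedAddCommGroup V] [NormedSpace ℝ V]
    [MeasurableSpace V] [BorelSpace V] [FiniteDimensional ℝ V] (μ : Measure V) [μ.IsAddHaarMeasure]
    {𝕜 : Type*} [RCLike 𝕜] {f : V → 𝕜}
    (hf : ContDiff ℝ 1 f) (hc : HasCompactSupport f) (w : V) : ∫ x, fderiv ℝ f x w ∂μ = 0 := by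
  have hi : Integrable f μ := hf.continuous.integrable_of_hasCompactSupport hc
  have hi' : Integrable (fun x => fderiv ℝ f x w) μ :=
    ((hf.continuous_fderiv (by simp)).clm_apply continuous_const).integrable_of_hasCompactSupport
      ((hc.fderiv ℝ).comp_left (g := fun L : V →L[ℝ] 𝕜 => L w) (by simp))
  have := integral_mul_fderiv_eq_neg_fderiv_mul_of_integrable (μ := μ) (f := fun _ : V => (1 : 𝕜))
    (g := f) (v := w) (by simp) (by simpa using hi') (by simpa using hi)
    (fun x _ => differentiableAt_const _) (fun x _ => hf.differentiable (by simp) x)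
  simpa using this

/-- The shear `(x, z) ↦ (x, h x + z)`. -/
def shear (h : ℝ → ℝ) (hh : Continuous h) : ℝ × ℝ ≃ₜ ℝ × ℝ where
  toFun p := (p.1, h p.1 + p.2)
  invFun p := (p.1, p.2 - h p.1)
  left_inv p := by simp
  right_inv p := by simp
  continuous_toFun := by fun_prop
  continuous_invFun := by fun_prop

theorem measurePreserving_shear (h : ℝ → ℝ) (hh : Continuous h) :
    MeasurePreserving (shear h hh) (volume : Measure (ℝ × ℝ)) volume := by
  refine MeasurePreserving.skew_product (μa := volume) (μb := volume) (μc := volume) (μd := volume)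
    (f := fun x : ℝ => x) (g := fun x z : ℝ => h x + z) (MeasurePreserving.id _) ?_ ?_
  · have : Continuous (Function.uncurry fun x z : ℝ => h x + z) := by
      unfold Function.uncurry; fun_prop
    exact this.measurable
  · exact Eventually.of_forall fun x => (measurePreserving_add_left volume (h x)).map_eq

section HalfPlane

variable {u : ℝ × ℝ → ℝ}

theorem hasCompactSupport_slice_fst (hc : HasCompactSupport u) (z : ℝ) :
    HasCompactSupport fun x => u (x, z) :=
  hc.comp_isClosedEmbedding (g := fun x : ℝ => (x, z))
    (Isometry.of_dist_eq fun x y => by simp [Prod.dist_eq]).isClosedEmbedding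

theorem hasCompactSupport_slice_snd (hc : HasCompactSupport u) (x : ℝ) :
    HasCompactSupport fun z => u (x, z) :=
  hc.comp_isClosedEmbedding (g := fun z : ℝ => (x, z))
    (Isometry.of_dist_eq fun x y => by simp [Prod.dist_eq]).isClosedEmbedding

theorem hasDerivAt_slice_fst (hu : ContDiff ℝ 1 u) (x z : ℝ) :
    HasDerivAt (fun x => u (x, z)) (fderiv ℝ u (x, z) (1, 0)) x :=
  ((hu.differentiable (by simp)) (x, z)).hasFDerivAt.comp_hasDerivAt x
    ((hasDerivAt_id x).prodMk (hasDerivAt_const x z))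

theorem hasDerivAt_slice_snd (hu : ContDiff ℝ 1 u) (x z : ℝ) :
    HasDerivAt (fun z => u (x, z)) (fderiv ℝ u (x, z) (0, 1)) z :=
  ((hu.differentiable (by simp)) (x, z)).hasFDerivAt.comp_hasDerivAt z
    ((hasDerivAt_const z x).prodMk (hasDerivAt_id z))

theorem integrable_fderiv_apply (hu : ContDiff ℝ 1 u) (hc : HasCompactSupport u) (w : ℝ × ℝ) :
    Integrable fun p => fderiv ℝ u p w :=
  ((hu.continuous_fderiv (by simp)).clm_apply continuous_const).integrable_of_hasCompactSupport
    ((hc.fderiv ℝ).comp_left (g := fun L : ℝ × ℝ →L[ℝ] ℝ => L w) (by simp))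

theorem setIntegral_halfPlane {F : ℝ × ℝ → ℝ} (hF : Integrable F) :
    ∫ p in {p : ℝ × ℝ | p.2 < 0}, F p = ∫ x, ∫ z in Set.Iio 0, F (x, z) := by
  have e : {p : ℝ × ℝ | p.2 < 0} = Set.univ ×ˢ Set.Iio 0 := by ext; simp
  rw [e, Measure.volume_eq_prod, setIntegral_prod _ (by
    rw [← Measure.volume_eq_prod]; exact hF.integrableOn), setIntegral_univ]

theorem setIntegral_halfPlane_mul_fderiv_snd (hu : ContDiff ℝ 1 u) (hc : HasCompactSupport u)
    {c : ℝ → ℝ} (hcc : Continuous c) :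
    ∫ p in {p : ℝ × ℝ | p.2 < 0}, c p.1 * fderiv ℝ u p (0, 1) = ∫ x, c x * u (x, 0) := by
  rw [setIntegral_halfPlane]
  · congr 1; ext x
    dsimp only
    rw [integral_const_mul, ← integral_Iic_eq_integral_Iio]
    have := HasCompactSupport.integral_Iic_deriv_eq (f := fun z => u (x, z)) (by fun_prop)
      (hasCompactSupport_slice_snd hc x) 0
    simp only [(hasDerivAt_slice_snd hu x _).deriv] at this
    rw [this]
  · have h1 : Continuous fun p : ℝ × ℝ => c p.1 * fderiv ℝ u p (0, 1) :=
      (hcc.comp continuous_fst).mul ((hu.continuous_fderiv (by simp)).clm_apply continuous_const)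
    exact h1.integrable_of_hasCompactSupport
      (((hc.fderiv ℝ).comp_left (g := fun L : ℝ × ℝ →L[ℝ] ℝ => L (0, 1)) (by simp)).mul_left)

theorem setIntegral_halfPlane_fderiv_fst (hu : ContDiff ℝ 1 u) (hc : HasCompactSupport u) :
    ∫ p in {p : ℝ × ℝ | p.2 < 0}, fderiv ℝ u p (1, 0) = 0 := by
  have e : {p : ℝ × ℝ | p.2 < 0} = Set.univ ×ˢ Set.Iio 0 := by ext; simp
  have hi := integrable_fderiv_apply hu hc (1, 0)
  rw [e, Measure.volume_eq_prod, ← setIntegral_prod_swap, setIntegral_prod]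
  · have : ∀ z : ℝ, ∫ x in Set.univ, fderiv ℝ u (Prod.swap (z, x)) (1, 0) = 0 := by
      intro z
      have h1 := integral_fderiv_eq_zero volume (f := fun x => u (x, z)) (by fun_prop)
        (hasCompactSupport_slice_fst hc z) (1 : ℝ)
      simp only [fderiv_apply_one_eq_deriv, (hasDerivAt_slice_fst hu _ z).deriv] at h1
      simpa using h1
    simp only [this, integral_zero]
  · exact (hi.swap).integrableOn

end HalfPlane

/-- The Gauss–Green formula below a graph: the vector `(-h', 1) dx` is the normal times the length
element. -/
theorem setIntegral_subgraph_fderiv {u : ℝ × ℝ → ℝ} (hu : ContDiff ℝ 1 u)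
    (hc : HasCompactSupport u) {h : ℝ → ℝ} (hh : ContDiff ℝ 1 h) (w : ℝ × ℝ) :
    ∫ p in {p : ℝ × ℝ | p.2 < h p.1}, fderiv ℝ u p w
      = ∫ x, u (x, h x) * (w.2 - deriv h x * w.1) := by
  set S := shear h hh.continuous with hS
  have hSa : ∀ p, S p = (p.1, h p.1 + p.2) := fun p => rfl
  have hpre : S ⁻¹' {p : ℝ × ℝ | p.2 < h p.1} = {p | p.2 < 0} := by
    ext p; simp [hSa]
  rw [← (measurePreserving_shear h hh.continuous).setIntegral_preimage_emb
    S.isClosedEmbedding.measurableEmbedding, hpre]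
  have hU : ContDiff ℝ 1 (u ∘ S) := by
    refine hu.comp ?_
    change ContDiff ℝ 1 fun p : ℝ × ℝ => (p.1, h p.1 + p.2)
    fun_prop
  have hUc : HasCompactSupport (u ∘ S) := hc.comp_homeomorph S
  have hdS : ∀ p, HasFDerivAt S ((ContinuousLinearMap.fst ℝ ℝ ℝ).prod
      (deriv h p.1 • ContinuousLinearMap.fst ℝ ℝ ℝ + ContinuousLinearMap.snd ℝ ℝ ℝ)) p := by
    intro p
    refine hasFDerivAt_fst.prodMk (HasFDerivAt.add ?_ hasFDerivAt_snd)
    exact ((hh.differentiable (by simp)) p.1).hasDerivAt.comp_hasFDerivAt p hasFDerivAt_fst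
  have hdU : ∀ p v, fderiv ℝ (u ∘ S) p v = fderiv ℝ u (S p) (v.1, deriv h p.1 * v.1 + v.2) := by
    intro p v
    rw [(((hu.differentiable (by simp)) (S p)).hasFDerivAt.comp p (hdS p)).fderiv]
    simp
  have hpt : ∀ p, fderiv ℝ u (S p) w
      = w.1 * fderiv ℝ (u ∘ S) p (1, 0)
        + (w.2 - deriv h p.1 * w.1) * fderiv ℝ (u ∘ S) p (0, 1) := by
    intro p
    have hw : w = w.1 • ((1 : ℝ), deriv h p.1)
        + (w.2 - deriv h p.1 * w.1) • ((0 : ℝ), (1 : ℝ)) := by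
      ext
      · simp
      · simp; ring
    rw [hdU, hdU]
    conv_lhs => rw [hw, map_add, map_smul, map_smul]
    simp
  have hdc : Continuous (deriv h) := hh.continuous_deriv le_rfl
  have hcont : Continuous fun p : ℝ × ℝ => (w.2 - deriv h p.1 * w.1) * fderiv ℝ (u ∘ S) p (0, 1) :=
    (by fun_prop : Continuous fun p : ℝ × ℝ => (w.2 - deriv h p.1 * w.1)).mul
      ((hU.continuous_fderiv (by simp)).clm_apply continuous_const)
  rw [setIntegral_congr_fun (measurableSet_lt measurable_snd measurable_const) fun p _ => hpt p]
  rw [integral_add, integral_const_mul, setIntegral_halfPlane_fderiv_fst hU hUc,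
    setIntegral_halfPlane_mul_fderiv_snd hU hUc (c := fun x => w.2 - deriv h x * w.1) (by fun_prop)]
  · rw [mul_zero, zero_add]
    refine integral_congr_ae (Eventually.of_forall fun x => ?_)
    simp [hSa, mul_comm]
  · exact ((integrable_fderiv_apply hU hUc (1, 0)).const_mul _).integrableOn
  · exact (hcont.integrable_of_hasCompactSupport (((hUc.fderiv ℝ).comp_left
      (g := fun L : ℝ × ℝ →L[ℝ] ℝ => L (0, 1)) (by simp)).mul_left)).integrableOn

/-! ### Boundary measures -/

/-- A finite measure `m` that is bounded by the arc length of `∂ω` up to the factor `K`, bounds the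
arc length of `∂ω` in `U` up to the same factor, and for which the Gauss–Green formula on `ω` holds
for functions supported in `U`.

Working up to a factor makes it unnecessary to identify the Hausdorff measure of a graph exactly. -/
structure IsBoundaryMeasureOn (ω U : Set E2) (K : ℝ≥0) (m : Measure E2) : Prop where
  finite : IsFiniteMeasure m
  le : m ≤ K • (Measure.hausdorffMeasure 1 : Measure E2).restrict (frontier ω)
  ge : (Measure.hausdorffMeasure 1 : Measure E2).restrict (frontier ω ∩ U) ≤ K • m
  gaussGreen : ∀ f : E2 → ℝ, ContDiff ℝ 1 f → HasCompactSupport f → tsupport f ⊆ U →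
    ∀ w, ∫ y in ω, fderiv ℝ f y w = ∫ y, f y * ⟪w, outwardNormal ω y⟫ ∂m

/-- Away from the boundary the zero measure will do. -/
theorem isBoundaryMeasureOn_self {ω : Set E2} (hω : IsOpen ω) (K : ℝ≥0) :
    IsBoundaryMeasureOn ω ω K 0 where
  finite := inferInstance
  le := Measure.zero_le _
  ge := by
    rw [hω.frontier_eq, Set.sdiff_inter_self, Measure.restrict_empty]
    exact Measure.zero_le _
  gaussGreen f hf hc hs w := by
    rw [integral_zero_measure, setIntegral_eq_integral_of_forall_compl_eq_zero,
      integral_fderiv_eq_zero volume hf hc w]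
    intro x hx
    rw [fderiv_of_notMem_tsupport ℝ (fun h => hx (hs h))]
    rfl

theorem norm_frame (b : OrthonormalBasis (Fin 2) ℝ E2) (p : ℝ × ℝ) :
    ‖frame b p‖ = √(p.1 ^ 2 + p.2 ^ 2) := by
  rw [← norm_frame_sq, Real.sqrt_sq (norm_nonneg _)]

theorem measurePreserving_frame (b : OrthonormalBasis (Fin 2) ℝ E2) :
    MeasurePreserving (frame b) volume volume := by
  have h := (b.measurePreserving_repr_symm.comp (PiLp.volume_preserving_toLp (Fin 2))).comp
    (volume_preserving_finTwoArrow ℝ).symm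
  convert h using 1
  ext p : 1
  simp only [Function.comp_apply]
  rw [LinearIsometryEquiv.eq_symm_apply]
  ext i
  rw [b.repr_apply_apply]
  fin_cases i
  · exact inner_frame_zero b p
  · exact inner_frame_one b p

theorem isClosedEmbedding_frame (b : OrthonormalBasis (Fin 2) ℝ E2) :
    Topology.IsClosedEmbedding (frame b) := by
  refine AntilipschitzWith.isClosedEmbedding (K := 1) ?_ (frame b).uniformContinuous
  refine AntilipschitzWith.of_le_mul_dist fun p q => ?_
  rw [dist_eq_norm, dist_eq_norm, ← map_sub, NNReal.coe_one, one_mul, norm_frame,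
    Prod.norm_def]
  refine max_le ?_ ?_
  · exact Real.abs_le_sqrt (by nlinarith [sq_nonneg (p - q).2])
  · exact Real.abs_le_sqrt (by nlinarith [sq_nonneg (p - q).1])

/-- The point of the graph of `h` above `x`, in the frame `b`. -/
noncomputable def graphLift (b : OrthonormalBasis (Fin 2) ℝ E2) (h : ℝ → ℝ) (x : ℝ) : E2 :=
  frame b (x, h x)

theorem antilipschitzWith_graphLift (b : OrthonormalBasis (Fin 2) ℝ E2) (h : ℝ → ℝ) :
    AntilipschitzWith 1 (graphLift b h) := by
  refine AntilipschitzWith.of_le_mul_dist fun x y => ?_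
  rw [dist_eq_norm, dist_eq_norm, graphLift, graphLift, ← map_sub, NNReal.coe_one, one_mul,
    norm_frame]
  exact Real.abs_le_sqrt (by simp only [Prod.mk_sub_mk]; nlinarith [sq_nonneg (h x - h y)])

theorem lipschitzWith_graphLift (b : OrthonormalBasis (Fin 2) ℝ E2) {h : ℝ → ℝ} {K : ℝ≥0}
    (hK : LipschitzWith K h) : LipschitzWith (1 + K) (graphLift b h) := by
  refine LipschitzWith.of_dist_le_mul fun x y => ?_
  rw [dist_eq_norm, graphLift, graphLift, ← map_sub, norm_frame]
  have h1 := hK.dist_le_mul x y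
  rw [Real.dist_eq] at h1 ⊢
  refine Real.sqrt_le_iff.2 ⟨by positivity, ?_⟩
  simp only [Prod.mk_sub_mk, NNReal.coe_add, NNReal.coe_one]
  have h2 : (h x - h y) ^ 2 ≤ (K * |x - y|) ^ 2 := by
    rw [← sq_abs (h x - h y), ← Real.dist_eq x y]; gcongr
  have h3 : 0 ≤ (K : ℝ) * |x - y| ^ 2 := by positivity
  rw [← sq_abs (x - y)]
  nlinarith

/-- The boundary measure of a graph is the image of `√(1 + h'²) dx`. It is comparable to arc length
because the parametrization of the graph by the abscissa is bi-Lipschitz. -/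
theorem IsLocalGraph.exists_isBoundaryMeasureOn {ω U : Set E2}
    {b : OrthonormalBasis (Fin 2) ℝ E2} {h : ℝ → ℝ} (hω : IsOpen ω) (H : IsLocalGraph ω U b h) :
    ∃ K m, IsBoundaryMeasureOn ω U K m := by
  obtain ⟨K₀, hK₀⟩ := H.exists_lipschitz
  set K : ℝ≥0 := 1 + K₀ with hK
  have hanti := antilipschitzWith_graphLift b h
  have hlip : LipschitzWith K (graphLift b h) := lipschitzWith_graphLift b hK₀
  have hemb : MeasurableEmbedding (graphLift b h) :=
    (hanti.isClosedEmbedding hlip.uniformContinuous).measurableEmbedding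
  set S : Set ℝ := graphLift b h ⁻¹' U with hS
  have hSm : MeasurableSet S := hlip.continuous.measurable H.isOpen.measurableSet
  have hdc : Continuous (deriv h) := H.contDiff.continuous_deriv le_rfl
  set d : ℝ → ℝ≥0 := fun x => Real.toNNReal √(1 + deriv h x ^ 2) with hd
  have hdm : Measurable d := by
    have : Continuous d := by fun_prop
    exact this.measurable
  have hd1 : ∀ x, 1 ≤ d x := fun x => by
    rw [hd, Real.one_le_toNNReal, Real.one_le_sqrt]
    nlinarith [sq_nonneg (deriv h x)]
  have hdK : ∀ x, d x ≤ K := fun x => by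
    rw [hd, Real.toNNReal_le_iff_le_coe, Real.sqrt_le_iff]
    refine ⟨K.2, ?_⟩
    have h1 : ‖deriv h x‖ ≤ K₀ := norm_deriv_le_of_lipschitz hK₀
    rw [Real.norm_eq_abs] at h1
    have h2 : deriv h x ^ 2 ≤ (K₀ : ℝ) ^ 2 := by rw [← sq_abs]; gcongr
    have h3 : (0 : ℝ) ≤ K₀ := K₀.2
    rw [hK, NNReal.coe_add, NNReal.coe_one]
    nlinarith
  set m₀ : Measure ℝ := (volume.restrict S).withDensity fun x => (d x : ℝ≥0∞) with hm₀
  have hle₀ : m₀ ≤ K • volume.restrict S := by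
    have : m₀ ≤ (volume.restrict S).withDensity fun _ => (K : ℝ≥0∞) :=
      withDensity_mono (Eventually.of_forall fun x => ENNReal.coe_le_coe.2 (hdK x))
    rwa [withDensity_const] at this
  have hge₀ : volume.restrict S ≤ m₀ := by
    have : (volume.restrict S).withDensity (fun _ => (1 : ℝ≥0∞)) ≤ m₀ :=
      withDensity_mono (Eventually.of_forall fun x => ENNReal.one_le_coe_iff.2 (hd1 x))
    rwa [withDensity_const, one_smul] at this
  have hSfin : volume S ≠ ∞ := by
    obtain ⟨R, hR⟩ := H.isBounded.exists_norm_le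
    have : S ⊆ Set.Icc (-R) R := by
      intro x hx
      rw [Set.mem_Icc, ← abs_le]
      refine le_trans ?_ (hR _ hx)
      rw [graphLift, norm_frame]
      exact Real.abs_le_sqrt (by simp only; nlinarith [sq_nonneg (h x)])
    exact ne_top_of_le_ne_top (by simp) (measure_mono this)
  have hSfin' : IsFiniteMeasure (volume.restrict S) := ⟨by
    rw [Measure.restrict_apply_univ]; exact hSfin.lt_top⟩
  -- The points of the graph in `U` are exactly the points of the boundary in `U`.
  have himg : graphLift b h '' S = frontier ω ∩ U := by
    ext y
    constructor
    · rintro ⟨x, hx, rfl⟩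
      exact ⟨(H.mem_frontier_iff (x, h x) hx).2 rfl, hx⟩
    · rintro ⟨hy, hyU⟩
      have e := frame_inner b y
      have h2 := (H.mem_frontier_iff _ (by rw [e]; exact hyU)).1 (by rw [e]; exact hy)
      have e2 : graphLift b h ⟪b 0, y⟫ = y := by
        rw [graphLift]
        conv_rhs => rw [← e]
        rw [← h2]
      exact ⟨⟪b 0, y⟫, by rw [hS, Set.mem_preimage, e2]; exact hyU, e2⟩
  refine ⟨K, m₀.map (graphLift b h), ?_, ?_, ?_, ?_⟩
  · have : IsFiniteMeasure m₀ := ⟨(hle₀ _).trans_lt (measure_lt_top _ _)⟩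
    infer_instance
  · refine Measure.le_iff.2 fun E hE => ?_
    rw [hemb.map_apply]
    refine (hle₀ _).trans ?_
    rw [Measure.smul_apply, Measure.smul_apply, Measure.restrict_apply hE,
      Measure.restrict_apply (hemb.measurable hE)]
    gcongr
    have h1 := hanti.le_hausdorffMeasure_image zero_le_one (graphLift b h ⁻¹' E ∩ S)
    rw [hausdorffMeasure_real, ENNReal.coe_one, ENNReal.one_rpow, one_mul] at h1
    refine h1.trans (measure_mono ?_)
    rw [Set.image_preimage_inter, himg]
    exact Set.inter_subset_inter_right _ Set.inter_subset_left
  · refine Measure.le_iff.2 fun E hE => ?_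
    rw [Measure.restrict_apply hE, Measure.smul_apply, hemb.map_apply, ← himg,
      ← Set.image_preimage_inter]
    have h1 := hlip.hausdorffMeasure_image_le zero_le_one (graphLift b h ⁻¹' E ∩ S)
    rw [hausdorffMeasure_real, ENNReal.rpow_one] at h1
    refine h1.trans ?_
    rw [← Measure.restrict_apply (hemb.measurable hE), ENNReal.smul_def, smul_eq_mul]
    gcongr
  · intro f hf hc hs w
    set w' : ℝ × ℝ := (⟪b 0, w⟫, ⟪b 1, w⟫) with hw'
    have hww : frame b w' = w := frame_inner b w
    have hu : ContDiff ℝ 1 (f ∘ frame b) := hf.comp (frame b).contDiff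
    have huc : HasCompactSupport (f ∘ frame b) :=
      hc.comp_isClosedEmbedding (isClosedEmbedding_frame b)
    have hder : ∀ p, fderiv ℝ (f ∘ frame b) p w' = fderiv ℝ f (frame b p) w := by
      intro p
      rw [(((hf.differentiable (by simp)) (frame b p)).hasFDerivAt.comp p
        (frame b).hasFDerivAt).fderiv, ContinuousLinearMap.comp_apply, hww]
    have hωm : MeasurableSet {p : ℝ × ℝ | p.2 < h p.1} :=
      measurableSet_lt measurable_snd (H.contDiff.continuous.measurable.comp measurable_fst)
    have hlhs : ∫ y in ω, fderiv ℝ f y w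
        = ∫ p in {p : ℝ × ℝ | p.2 < h p.1}, fderiv ℝ (f ∘ frame b) p w' := by
      rw [← (measurePreserving_frame b).setIntegral_preimage_emb
        (isClosedEmbedding_frame b).measurableEmbedding,
        ← integral_indicator ((frame b).continuous.measurable hω.measurableSet),
        ← integral_indicator hωm]
      congr 1
      ext p
      by_cases hp : frame b p ∈ U
      · have := H.mem_iff p hp
        classical
        simp only [Set.indicator_apply, Set.mem_preimage, Set.mem_ofPred_eq, this, hder]
      · have h0 : fderiv ℝ f (frame b p) = 0 :=
          fderiv_of_notMem_tsupport ℝ (fun h3 => hp (hs h3))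
        simp [Set.indicator_apply, hder, h0]
    rw [hlhs, setIntegral_subgraph_fderiv hu huc H.contDiff, hemb.integral_map,
      integral_withDensity_eq_integral_smul hdm,
      ← setIntegral_eq_integral_of_forall_compl_eq_zero (s := S)]
    · refine setIntegral_congr_fun hSm fun x hx => ?_
      have hpos : 0 < √(1 + deriv h x ^ 2) := by positivity
      have e1 : outwardNormal ω (graphLift b h x) = _ := H.outwardNormal_eq x hx
      have e2 : ⟪w, frame b (-deriv h x, 1)⟫ = w'.2 - deriv h x * w'.1 := by
        rw [frame_apply, inner_add_right, inner_smul_right, inner_smul_right, hw',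
          real_inner_comm, real_inner_comm (b 1)]
        ring
      simp only [Function.comp_apply]
      rw [e1, inner_smul_right, e2, NNReal.smul_def, Real.coe_toNNReal _ hpos.le, smul_eq_mul]
      change f (graphLift b h x) * _ = _
      field_simp
    · intro x hx
      have : f (frame b (x, h x)) = 0 := image_eq_zero_of_notMem_tsupport fun h3 => hx (hs h3)
      simp [this]

theorem exists_isBoundaryMeasureOn {ω : Set E2} (hω : IsC2Open ω) {p : E2}
    (hp : p ∈ closure ω) : ∃ U K m, IsOpen U ∧ p ∈ U ∧ IsBoundaryMeasureOn ω U K m := by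
  by_cases h : p ∈ ω
  · exact ⟨ω, 1, 0, hω.isOpen, h, isBoundaryMeasureOn_self hω.isOpen 1⟩
  · obtain ⟨U, b, g, hpU, H⟩ := exists_isLocalGraph hω (p := p)
      (by rw [hω.isOpen.frontier_eq]; exact ⟨hp, h⟩)
    obtain ⟨K, m, hm⟩ := H.exists_isBoundaryMeasureOn hω.isOpen
    exact ⟨U, K, m, H.isOpen, hpU, hm⟩

/-! ### Globalization by a partition of unity -/

theorem aestronglyMeasurable_outwardNormal_of_le {ω : Set E2} (hω : IsC2Open ω)
    {m : Measure E2} {K : ℝ≥0}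
    (hm : m ≤ K • (Measure.hausdorffMeasure 1 : Measure E2).restrict (frontier ω)) :
    AEStronglyMeasurable (outwardNormal ω) m :=
  ((continuousOn_outwardNormal hω).aestronglyMeasurable isClosed_frontier.measurableSet).mono_ac
    (Measure.absolutelyContinuous_of_le_smul (c := (K : ℝ≥0∞)) hm)

theorem ae_mem_frontier_of_le {ω : Set E2} {m : Measure E2} {K : ℝ≥0}
    (hm : m ≤ K • (Measure.hausdorffMeasure 1 : Measure E2).restrict (frontier ω)) :
    ∀ᵐ y ∂m, y ∈ frontier ω :=
  (Measure.absolutelyContinuous_of_le_smul (c := (K : ℝ≥0∞)) hm).ae_le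
    (ae_restrict_mem isClosed_frontier.measurableSet)

theorem integrable_mul_inner_outwardNormal {ω : Set E2} (hω : IsC2Open ω)
    {m : Measure E2} [IsFiniteMeasure m] {K : ℝ≥0}
    (hm : m ≤ K • (Measure.hausdorffMeasure 1 : Measure E2).restrict (frontier ω))
    {f : E2 → ℝ} (hf : Continuous f) (hc : HasCompactSupport f) (w : E2) :
    Integrable (fun y => f y * ⟪w, outwardNormal ω y⟫) m := by
  obtain ⟨C, hC⟩ := hc.exists_bound_of_continuous hf
  refine Integrable.of_bound (hf.aestronglyMeasurable.mul (aestronglyMeasurable_const.inner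
    (aestronglyMeasurable_outwardNormal_of_le hω hm))) (C * ‖w‖) ?_
  filter_upwards [ae_mem_frontier_of_le hm] with y hy
  rw [norm_mul]
  have h1 : ‖⟪w, outwardNormal ω y⟫‖ ≤ ‖w‖ := by
    refine (norm_inner_le_norm w _).trans ?_
    rw [norm_outwardNormal hω hy, mul_one]
  have := norm_nonneg (f y)
  have hC0 : 0 ≤ C := this.trans (hC y)
  gcongr
  exact hC y

/-- A bounded `C²` open set carries a boundary measure, comparable to arc length, for which the
Gauss–Green formula holds. -/
theorem exists_isBoundaryMeasureOn_univ {ω : Set E2} (hω : IsC2Open ω)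
    (hb : Bornology.IsBounded ω) : ∃ K m, IsBoundaryMeasureOn ω Set.univ K m := by
  choose! U K m hU hpU hm using fun p (hp : p ∈ closure ω) => exists_isBoundaryMeasureOn hω hp
  obtain ⟨t, ht, hcov⟩ := hb.isCompact_closure.elim_nhds_subcover U
    fun x hx => (hU x hx).mem_nhds (hpU x hx)
  have hcov' : closure ω ⊆ ⋃ i : t, U i := fun x hx => by
    simpa using hcov hx
  obtain ⟨χ, hχ⟩ := SmoothPartitionOfUnity.exists_isSubordinate (modelWithCornersSelf ℝ E2)
    isClosed_closure (fun i : t => U i) (fun i => hU i (ht i i.2)) hcov'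
  have hm' : ∀ i : t, IsBoundaryMeasureOn ω (U i) (K i) (m i) := fun i => hm i (ht i i.2)
  have hχc : ∀ i, ContDiff ℝ 1 (χ i) := fun i =>
    (χ i).contMDiff.contDiff.of_le (by exact_mod_cast le_top)
  have hsum : ∀ y ∈ closure ω, ∑ i, χ i y = 1 := fun y hy => by
    rw [← finsum_eq_sum_of_fintype]; exact χ.sum_eq_one hy
  set d : t → E2 → ℝ≥0 := fun i y => Real.toNNReal (χ i y) with hd
  have hdm : ∀ i, Measurable (d i) := fun i => by
    have : Continuous (d i) := continuous_real_toNNReal.comp (hχc i).continuous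
    exact this.measurable
  have hd1 : ∀ i y, d i y ≤ 1 := fun i y => by
    rw [hd, Real.toNNReal_le_one]; exact χ.le_one i y
  set σ : Measure E2 := (Measure.hausdorffMeasure 1 : Measure E2).restrict (frontier ω) with hσ
  set μ' : t → Measure E2 := fun i => (m i).withDensity fun y => (d i y : ℝ≥0∞) with hμ'
  have hμm : ∀ i, μ' i ≤ m i := fun i => by
    have : μ' i ≤ (m i).withDensity fun _ => 1 :=
      withDensity_mono (Eventually.of_forall fun y => by
        exact ENNReal.coe_le_one_iff.2 (hd1 i y))
    rwa [withDensity_const, one_smul] at this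
  have hμσ : ∀ i, μ' i ≤ K i • σ := fun i => (hμm i).trans (hm' i).le
  have hfin : ∀ i, IsFiniteMeasure (μ' i) := fun i => by
    have := (hm' i).finite
    exact ⟨(hμm i _).trans_lt (measure_lt_top _ _)⟩
  refine ⟨∑ i : t, K i, ∑ i, μ' i, ?_, ?_, ?_, ?_⟩
  · infer_instance
  · rw [Finset.sum_smul]
    exact Finset.sum_le_sum fun i _ => hμσ i
  · rw [Set.inter_univ]
    refine Measure.le_iff.2 fun E hE => ?_
    calc σ E = ∫⁻ y in E, ∑ i, (d i y : ℝ≥0∞) ∂σ := by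
          rw [← setLIntegral_one]
          refine setLIntegral_congr_fun_ae hE ?_
          filter_upwards [ae_restrict_mem isClosed_frontier.measurableSet] with y hy _
          have h1 := hsum y (frontier_subset_closure hy)
          have h2 : ∑ i, d i y = 1 := by
            rw [hd, ← Real.toNNReal_sum_of_nonneg fun i _ => χ.nonneg i y, h1, Real.toNNReal_one]
          exact_mod_cast h2.symm
      _ = ∑ i, ∫⁻ y in E, (d i y : ℝ≥0∞) ∂σ :=
          lintegral_finsetSum _ fun i _ => (hdm i).coe_nnreal_ennreal
      _ ≤ ∑ i : t, (∑ j : t, K j : ℝ≥0) * μ' i E := by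
          refine Finset.sum_le_sum fun i _ => ?_
          have hsupp : Function.support (fun y => (d i y : ℝ≥0∞)) ⊆ U i := by
            intro y hy
            refine hχ i (subset_tsupport _ fun h0 => hy ?_)
            simp [hd, h0]
          have hUm : MeasurableSet (U i) := (hU i (ht i i.2)).measurableSet
          have hle : σ.restrict (U i) ≤ K i • m i := by
            rw [hσ, Measure.restrict_restrict hUm, Set.inter_comm]
            exact (hm' i).ge
          rw [← setLIntegral_eq_of_support_subset hsupp, Measure.restrict_comm hUm]
          refine (lintegral_mono' (Measure.restrict_mono subset_rfl hle) le_rfl).trans ?_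
          rw [Measure.restrict_smul, lintegral_smul_measure, hμ', withDensity_apply _ hE,
            ENNReal.smul_def, smul_eq_mul]
          gcongr
          exact Finset.single_le_sum (f := fun j : t => K j) (fun j _ => zero_le)
            (Finset.mem_univ i)
      _ = _ := by
          rw [Measure.smul_apply, Measure.finsetSum_apply, ← Finset.mul_sum]
          rfl
  · intro f hf hc _ w
    have hχf : ∀ i, ContDiff ℝ 1 fun y => χ i y * f y := fun i => (hχc i).mul hf
    have hχfc : ∀ i, HasCompactSupport fun y => χ i y * f y := fun i => hc.mul_left
    have hderiv : ∀ y ∈ ω, fderiv ℝ f y w = ∑ i, fderiv ℝ (fun y => χ i y * f y) y w := by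
      intro y hy
      have e : f =ᶠ[𝓝 y] fun y => ∑ i, χ i y * f y := by
        filter_upwards [hω.isOpen.mem_nhds hy] with z hz
        rw [← Finset.sum_mul, hsum z (subset_closure hz), one_mul]
      rw [e.fderiv_eq, fderiv_fun_sum fun i _ => (hχf i).differentiable (by simp) y]
      simp
    rw [setIntegral_congr_fun hω.isOpen.measurableSet hderiv, integral_finsetSum,
      integral_finsetSum_measure]
    · refine Finset.sum_congr rfl fun i _ => ?_
      rw [(hm' i).gaussGreen _ (hχf i) (hχfc i) ((tsupport_mul_subset_left).trans (hχ i)),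
        hμ', integral_withDensity_eq_integral_smul (hdm i)]
      refine integral_congr_ae (Eventually.of_forall fun y => ?_)
      simp only [hd, NNReal.smul_def, Real.coe_toNNReal _ (χ.nonneg i y), smul_eq_mul, mul_assoc]
    · exact fun i _ => integrable_mul_inner_outwardNormal hω (hμσ i) hf.continuous hc w
    · intro i _
      exact ((((hχf i).continuous_fderiv (by simp)).clm_apply
        continuous_const).integrable_of_hasCompactSupport (((hχfc i).fderiv ℝ).comp_left
        (g := fun L : E2 →L[ℝ] ℝ => L w) (by simp))).integrableOn

/-! ### Gauss–Green on the cylinder -/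

/-- The identification of `ℝ² × ℝ` with `ℝ³`. -/
noncomputable def cylEquiv : (E2 × ℝ) ≃L[ℝ] E3 :=
  LinearEquiv.toContinuousLinearEquiv
    { toFun := fun p => cylPoint p.1 p.2
      invFun := fun x => (transversal x, x 2)
      map_add' := fun p q => by ext i; fin_cases i <;> simp [cylPoint]
      map_smul' := fun c p => by ext i; fin_cases i <;> simp [cylPoint]
      left_inv := fun p => by
        refine Prod.ext ?_ (by simp [cylPoint])
        ext i; fin_cases i <;> simp [cylPoint, transversal]
      right_inv := fun x => by ext i; fin_cases i <;> simp [cylPoint, transversal] }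

theorem cylEquiv_symm_apply (x : E3) : cylEquiv.symm x = (transversal x, x 2) := rfl

theorem transversal_cylEquiv (p : E2 × ℝ) : transversal (cylEquiv p) = p.1 :=
  congrArg Prod.fst (cylEquiv.symm_apply_apply p)

theorem continuous_transversal : Continuous transversal :=
  continuous_fst.comp cylEquiv.symm.continuous

theorem isOpen_cylinder {ω : Set E2} (hω : IsOpen ω) : IsOpen (cylinder ω) :=
  hω.preimage continuous_transversal

theorem measurableEmbedding_cylEquiv : MeasurableEmbedding cylEquiv :=
  cylEquiv.toHomeomorph.measurableEmbedding

theorem measurePreserving_cylEquiv : MeasurePreserving cylEquiv volume volume := by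
  have h1 : MeasurePreserving (Prod.swap : E2 × ℝ → ℝ × E2) volume volume :=
    Measure.measurePreserving_swap
  have h2 : MeasurePreserving (Prod.map id (WithLp.ofLp : E2 → Fin 2 → ℝ))
      (volume : Measure (ℝ × E2)) volume :=
    (MeasurePreserving.id volume).prod (PiLp.volume_preserving_ofLp (Fin 2))
  have h3 := (volume_preserving_piFinSuccAbove (fun _ : Fin 3 => ℝ) 2).symm
  have h4 := PiLp.volume_preserving_toLp (Fin 3)
  have h5 := h4.comp (h3.comp (h2.comp h1))
  have e : (cylEquiv : E2 × ℝ → E3) = WithLp.toLp 2 ∘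
      (MeasurableEquiv.piFinSuccAbove (fun _ : Fin 3 => ℝ) 2).symm ∘
        Prod.map id (WithLp.ofLp : E2 → Fin 2 → ℝ) ∘ Prod.swap := by
    funext p
    ext i
    fin_cases i <;> rfl
  rw [e]
  exact h5

theorem lateralMeasure_eq (ω : Set E2) :
    lateralMeasure ω = (((Measure.hausdorffMeasure 1 : Measure E2).restrict (frontier ω)).prod
      (volume : Measure ℝ)).map cylEquiv := rfl

/-- A measure on `∂ω × ℝ` comparable to the surface measure, for which the Gauss–Green formula on
the cylinder `ω × ℝ` holds. -/
structure IsLateralBoundaryMeasure (ω : Set E2) (K : ℝ≥0) (μ : Measure E3) : Prop where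
  finiteOnCompacts : IsFiniteMeasureOnCompacts μ
  finiteOnCompacts_lateral : IsFiniteMeasureOnCompacts (lateralMeasure ω)
  le : μ ≤ K • lateralMeasure ω
  ge : lateralMeasure ω ≤ K • μ
  gaussGreen : ∀ f : E3 → ℝ, ContDiff ℝ 1 f → HasCompactSupport f → ∀ w,
    ∫ x in cylinder ω, fderiv ℝ f x w
      = ∫ x, f x * ⟪transversal w, outwardNormal ω (transversal x)⟫ ∂μ

theorem integrable_of_bound_of_isCompact {X : Type*} [TopologicalSpace X] [MeasurableSpace X]
    {μ : Measure X} [IsFiniteMeasureOnCompacts μ] {E : Type*} [NormedAddCommGroup E] {F : X → E}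
    (hF : AEStronglyMeasurable F μ) {k : Set X} (hk : IsCompact k)
    (h0 : ∀ x, x ∉ k → F x = 0) {C : ℝ} (hC : ∀ᵐ x ∂μ, ‖F x‖ ≤ C) : Integrable F μ := by
  have : IsFiniteMeasure (μ.restrict k) :=
    ⟨by rw [Measure.restrict_apply_univ]; exact hk.measure_lt_top⟩
  exact IntegrableOn.integrable_of_forall_notMem_eq_zero
    (Integrable.of_bound hF.restrict C (ae_restrict_of_ae hC)) h0

theorem ae_transversal_mem_frontier (ω : Set E2) :
    ∀ᵐ x ∂(lateralMeasure ω), transversal x ∈ frontier ω := by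
  rw [lateralMeasure_eq, measurableEmbedding_cylEquiv.ae_map_iff]
  have h : ∀ᵐ y ∂((Measure.hausdorffMeasure 1 : Measure E2).restrict (frontier ω)),
      y ∈ frontier ω := ae_restrict_mem isClosed_frontier.measurableSet
  filter_upwards [Measure.quasiMeasurePreserving_fst.ae h] with p hp
  rw [transversal_cylEquiv]; exact hp

theorem aestronglyMeasurable_outwardNormal_transversal {ω : Set E2} (hω : IsC2Open ω) :
    AEStronglyMeasurable (fun x => outwardNormal ω (transversal x)) (lateralMeasure ω) := by
  rw [lateralMeasure_eq, measurableEmbedding_cylEquiv.aestronglyMeasurable_map_iff]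
  have h : AEStronglyMeasurable (outwardNormal ω)
      ((Measure.hausdorffMeasure 1 : Measure E2).restrict (frontier ω)) :=
    (continuousOn_outwardNormal hω).aestronglyMeasurable isClosed_frontier.measurableSet
  refine (h.comp_fst (ν := (volume : Measure ℝ))).congr (Eventually.of_forall fun p => ?_)
  simp [transversal_cylEquiv]

theorem absolutelyContinuous_of_le_nnreal_smul {X : Type*} [MeasurableSpace X] {μ ν : Measure X}
    {K : ℝ≥0} (h : μ ≤ K • ν) : μ ≪ ν :=
  Measure.absolutelyContinuous_of_le_smul (c := (K : ℝ≥0∞)) h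

theorem integrable_mul_inner_lateral {ω : Set E2} (hω : IsC2Open ω) {μ : Measure E3}
    [IsFiniteMeasureOnCompacts μ] (hμ : μ ≪ lateralMeasure ω) {f : E3 → ℝ} (hf : Continuous f)
    (hc : HasCompactSupport f) (w : E2) :
    Integrable (fun x => f x * ⟪w, outwardNormal ω (transversal x)⟫) μ := by
  obtain ⟨C, hC⟩ := hc.exists_bound_of_continuous hf
  refine integrable_of_bound_of_isCompact (hf.aestronglyMeasurable.mul
    (aestronglyMeasurable_const.inner
      ((aestronglyMeasurable_outwardNormal_transversal hω).mono_ac hμ))) hc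
    (fun x hx => by rw [image_eq_zero_of_notMem_tsupport hx, zero_mul]) (C := C * ‖w‖) ?_
  filter_upwards [hμ.ae_le (ae_transversal_mem_frontier ω)] with x hx
  rw [norm_mul]
  have h1 : ‖⟪w, outwardNormal ω (transversal x)⟫‖ ≤ ‖w‖ := by
    refine (norm_inner_le_norm w _).trans ?_
    rw [norm_outwardNormal hω hx, mul_one]
  have := norm_nonneg (f x)
  have hC0 : 0 ≤ C := this.trans (hC x)
  gcongr
  exact hC x

/-- The product of a boundary measure of `ω` with Lebesgue measure on the line: the Gauss–Green
formula holds for horizontal directions by slicing, and vertical derivatives integrate to zero. -/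
theorem exists_isLateralBoundaryMeasure {ω : Set E2} (hω : IsC2Open ω)
    (hb : Bornology.IsBounded ω) : ∃ K μ, IsLateralBoundaryMeasure ω K μ := by
  obtain ⟨K, m, hm⟩ := exists_isBoundaryMeasureOn_univ hω hb
  have hmfin := hm.finite
  have hge := hm.ge
  rw [Set.inter_univ] at hge
  set σ : Measure E2 := (Measure.hausdorffMeasure 1 : Measure E2).restrict (frontier ω) with hσ
  have hσfin : IsFiniteMeasure σ := ⟨(hge _).trans_lt (by
    rw [Measure.smul_apply, ENNReal.smul_def, smul_eq_mul]
    exact ENNReal.mul_lt_top ENNReal.coe_lt_top (measure_lt_top _ _))⟩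
  have hmap : ∀ μ₁ μ₂ : Measure E2, [SFinite μ₁] → [SFinite μ₂] → μ₁ ≤ K • μ₂ →
      (μ₁.prod (volume : Measure ℝ)).map cylEquiv
        ≤ K • (μ₂.prod (volume : Measure ℝ)).map cylEquiv := by
    intro μ₁ μ₂ _ _ h
    refine (Measure.map_mono ((Measure.prod_mono h le_rfl).trans
      (le_of_eq (Measure.prod_smul_left (K : ℝ≥0∞)))) cylEquiv.continuous.measurable).trans
      (le_of_eq (Measure.map_smul (K : ℝ≥0∞) _ _))
  have hle3 := hmap m σ hm.le
  have hfc : ∀ μ₁ : Measure E2, [IsFiniteMeasure μ₁] →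
      IsFiniteMeasureOnCompacts ((μ₁.prod (volume : Measure ℝ)).map cylEquiv) := fun μ₁ _ =>
    Measure.IsFiniteMeasureOnCompacts.map _ cylEquiv.toHomeomorph
  have hfcm := hfc m
  refine ⟨K, (m.prod volume).map cylEquiv, hfcm, hfc σ, hle3, hmap σ m hge, ?_⟩
  intro f hf hc w
  have hac : (m.prod (volume : Measure ℝ)).map cylEquiv ≪ lateralMeasure ω :=
    absolutelyContinuous_of_le_nnreal_smul hle3
  have hu : ContDiff ℝ 1 (f ∘ cylEquiv) := hf.comp cylEquiv.contDiff
  have huc : HasCompactSupport (f ∘ cylEquiv) := hc.comp_homeomorph cylEquiv.toHomeomorph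
  set u := f ∘ cylEquiv with hudef
  have hder : ∀ p q, fderiv ℝ f (cylEquiv p) (cylEquiv q) = fderiv ℝ u p q := by
    intro p q
    rw [(((hf.differentiable (by simp)) (cylEquiv p)).hasFDerivAt.comp p
      cylEquiv.hasFDerivAt).fderiv]
    rfl
  have hint : ∀ q, Integrable fun p => fderiv ℝ u p q := fun q =>
    ((hu.continuous_fderiv (by simp)).clm_apply continuous_const).integrable_of_hasCompactSupport
      ((huc.fderiv ℝ).comp_left (g := fun L : E2 × ℝ →L[ℝ] ℝ => L q) (by simp))
  have hslice₁ : ∀ t, ∀ y v, fderiv ℝ (fun y => u (y, t)) y v = fderiv ℝ u (y, t) (v, 0) := by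
    intro t y v
    have h : HasFDerivAt (fun y : E2 => (y, t)) (ContinuousLinearMap.inl ℝ E2 ℝ) y :=
      hasFDerivAt_prodMk_left y t
    exact congrArg (fun L : E2 →L[ℝ] ℝ => L v)
      (((hu.differentiable (by simp)) (y, t)).hasFDerivAt.comp y h).fderiv
  have hslice₂ : ∀ y, ∀ t, fderiv ℝ (fun t => u (y, t)) t 1 = fderiv ℝ u (y, t) (0, 1) := by
    intro y t
    have h : HasFDerivAt (fun t : ℝ => (y, t)) (ContinuousLinearMap.inr ℝ E2 ℝ) t :=
      hasFDerivAt_prodMk_right y t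
    exact congrArg (fun L : ℝ →L[ℝ] ℝ => L 1)
      (((hu.differentiable (by simp)) (y, t)).hasFDerivAt.comp t h).fderiv
  have hc₁ : ∀ t, HasCompactSupport fun y => u (y, t) := fun t =>
    huc.comp_isClosedEmbedding (g := fun y : E2 => (y, t))
      (Isometry.of_dist_eq fun x y => by simp [Prod.dist_eq]).isClosedEmbedding
  have hc₂ : ∀ y, HasCompactSupport fun t => u (y, t) := fun y =>
    huc.comp_isClosedEmbedding (g := fun t : ℝ => (y, t))
      (Isometry.of_dist_eq fun s t => by simp [Prod.dist_eq]).isClosedEmbedding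
  set w' : E2 × ℝ := cylEquiv.symm w with hw'
  have hww : cylEquiv w' = w := cylEquiv.apply_symm_apply w
  have hpre : cylEquiv ⁻¹' cylinder ω = ω ×ˢ Set.univ := by
    ext p
    simp only [Set.mem_preimage, cylinder, Set.mem_ofPred_eq, transversal_cylEquiv, Set.mem_prod,
      Set.mem_univ, and_true]
  have hsplit : ∀ p, fderiv ℝ u p w' = fderiv ℝ u p (w'.1, 0) + w'.2 * fderiv ℝ u p (0, 1) := by
    intro p
    rw [← smul_eq_mul, ← map_smul, ← map_add]
    simp
  have hhor : ∫ p in ω ×ˢ Set.univ, fderiv ℝ u p (w'.1, 0)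
      = ∫ t, ∫ y, u (y, t) * ⟪w'.1, outwardNormal ω y⟫ ∂m := by
    rw [Measure.volume_eq_prod, ← setIntegral_prod_swap, setIntegral_prod, setIntegral_univ]
    · refine integral_congr_ae (Eventually.of_forall fun t => ?_)
      have := hm.gaussGreen (fun y => u (y, t)) (by fun_prop) (hc₁ t) (Set.subset_univ _) w'.1
      simpa only [hslice₁ t, Prod.swap_prod_mk] using this
    · exact (hint (w'.1, 0)).swap.integrableOn
  have hver : ∫ p in ω ×ˢ Set.univ, fderiv ℝ u p (0, 1) = 0 := by
    rw [Measure.volume_eq_prod, setIntegral_prod _ (hint (0, 1)).integrableOn]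
    have : ∀ y : E2, ∫ t in Set.univ, fderiv ℝ u (y, t) (0, 1) = 0 := by
      intro y
      have h1 := integral_fderiv_eq_zero volume (f := fun t => u (y, t)) (by fun_prop) (hc₂ y)
        (1 : ℝ)
      simpa only [hslice₂ y, setIntegral_univ] using h1
    simp only [this, integral_zero]
  have hlhs : ∫ x in cylinder ω, fderiv ℝ f x w
      = ∫ t, ∫ y, u (y, t) * ⟪w'.1, outwardNormal ω y⟫ ∂m := by
    rw [← measurePreserving_cylEquiv.setIntegral_preimage_emb measurableEmbedding_cylEquiv, hpre]
    have e : ∀ p, fderiv ℝ f (cylEquiv p) w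
        = fderiv ℝ u p (w'.1, 0) + w'.2 * fderiv ℝ u p (0, 1) := fun p => by
      rw [← hsplit, ← hder, hww]
    simp only [e]
    rw [integral_add (hint _).integrableOn ((hint _).const_mul _).integrableOn, integral_const_mul,
      hver, hhor, mul_zero, add_zero]
  have hi := integrable_mul_inner_lateral hω hac hf.continuous hc (transversal w)
  rw [measurableEmbedding_cylEquiv.integrable_map_iff] at hi
  rw [hlhs, measurableEmbedding_cylEquiv.integral_map,
    ← integral_prod_symm (fun p : E2 × ℝ => u p * ⟪w'.1, outwardNormal ω p.1⟫) (by
    refine hi.congr (Eventually.of_forall fun p => ?_)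
    simp only [Function.comp_apply, transversal_cylEquiv]
    rfl)]
  simp only [transversal_cylEquiv]
  rfl

/-! ### Boundary values of functions in `H¹₀` -/

theorem hausdorffMeasure_frontier_inter_pos {ω : Set E2} (hω : IsC2Open ω) {p : E2}
    (hp : p ∈ frontier ω) {B : Set E2} (hB : IsOpen B) (hpB : p ∈ B) :
    0 < (Measure.hausdorffMeasure 1 : Measure E2) (frontier ω ∩ B) := by
  obtain ⟨U, b, h, hpU, H⟩ := exists_isLocalGraph hω hp
  set S : Set ℝ := graphLift b h ⁻¹' (U ∩ B) with hS
  have hcont : Continuous (graphLift b h) := by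
    have := H.contDiff.continuous
    unfold graphLift; fun_prop
  have hSo : IsOpen S := (H.isOpen.inter hB).preimage hcont
  have hpS : S.Nonempty := by
    refine ⟨⟪b 0, p⟫, ?_⟩
    have e := frame_inner b p
    have h2 := (H.mem_frontier_iff _ (by rw [e]; exact hpU)).1 (by rw [e]; exact hp)
    have e2 : graphLift b h ⟪b 0, p⟫ = p := by
      rw [graphLift]
      conv_rhs => rw [← e]
      rw [← h2]
    rw [hS, Set.mem_preimage, e2]
    exact ⟨hpU, hpB⟩
  have h1 := (antilipschitzWith_graphLift b h).le_hausdorffMeasure_image zero_le_one S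
  rw [hausdorffMeasure_real, ENNReal.coe_one, ENNReal.one_rpow, one_mul] at h1
  refine (hSo.measure_pos volume hpS).trans_le (h1.trans (measure_mono ?_))
  rintro _ ⟨x, hx, rfl⟩
  exact ⟨(H.mem_frontier_iff (x, h x) hx.1).2 rfl, hx.2⟩

theorem lateralMeasure_pos {ω : Set E2} (hω : IsC2Open ω) {x : E3}
    (hx : transversal x ∈ frontier ω) {W : Set E3} (hW : IsOpen W) (hxW : x ∈ W) :
    0 < lateralMeasure ω W := by
  have hW' : IsOpen (cylEquiv ⁻¹' W) := hW.preimage cylEquiv.continuous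
  have hxp : cylEquiv (transversal x, x 2) = x := cylEquiv.apply_symm_apply x
  obtain ⟨B, I, hB, hI, hxB, hxI, hBI⟩ := isOpen_prod_iff.1 hW' (transversal x) (x 2)
    (by rw [Set.mem_preimage, hxp]; exact hxW)
  rw [lateralMeasure_eq, measurableEmbedding_cylEquiv.map_apply]
  refine lt_of_lt_of_le ?_ (measure_mono hBI)
  rw [Measure.prod_prod, Measure.restrict_apply hB.measurableSet, Set.inter_comm]
  exact ENNReal.mul_pos (hausdorffMeasure_frontier_inter_pos hω hx hB hxB).ne'
    (hI.measure_pos volume ⟨_, hxI⟩).ne'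

theorem continuous_pderiv {v : E3 → ℂ} (hv : ContDiff ℝ 1 v) (j : Fin 3) :
    Continuous (pderiv j v) :=
  (hv.continuous_fderiv (by simp)).clm_apply continuous_const

theorem hasCompactSupport_pderiv {v : E3 → ℂ} (hc : HasCompactSupport v) (j : Fin 3) :
    HasCompactSupport (pderiv j v) :=
  (hc.fderiv ℝ).comp_left (g := fun L : E3 →L[ℝ] ℂ => L (EuclideanSpace.single j 1)) (by simp)

theorem pderiv_mul {u v : E3 → ℂ} {x : E3} (hu : DifferentiableAt ℝ u x)
    (hv : DifferentiableAt ℝ v x) (j : Fin 3) :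
    pderiv j (fun y => u y * v y) x = pderiv j u x * v x + u x * pderiv j v x := by
  rw [pderiv, fderiv_fun_mul hu hv]
  simp only [pderiv, add_apply, smul_apply, smul_eq_mul]
  ring

theorem pderiv_eq_zero_of_notMem_tsupport {v : E3 → ℂ} {x : E3} (hx : x ∉ tsupport v) (j : Fin 3) :
    pderiv j v x = 0 := by
  rw [pderiv, fderiv_of_notMem_tsupport ℝ hx]; rfl

/-- The product rule integrates to zero over `Ω` when one factor is supported in `Ω`. -/
theorem setIntegral_pderiv_mul_eq_zero {Ω : Set E3} {φ ψ : E3 → ℂ} (hφ : ContDiff ℝ 1 φ)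
    (hφc : HasCompactSupport φ) (hφΩ : tsupport φ ⊆ Ω) (hψ : ContDiff ℝ 1 ψ) (j : Fin 3) :
    ∫ x in Ω, (pderiv j φ x * ψ x + φ x * pderiv j ψ x) = 0 := by
  rw [setIntegral_eq_integral_of_forall_compl_eq_zero]
  · have h := integral_fderiv_eq_zero volume (hφ.mul hψ) hφc.mul_right (EuclideanSpace.single j 1)
    rw [← h]
    refine integral_congr_ae (Eventually.of_forall fun x => ?_)
    exact (pderiv_mul ((hφ.differentiable (by simp)) x) ((hψ.differentiable (by simp)) x) j).symm
  · intro x hx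
    have hx' : x ∉ tsupport φ := fun h => hx (hφΩ h)
    rw [pderiv_eq_zero_of_notMem_tsupport hx', image_eq_zero_of_notMem_tsupport hx']
    simp

/-- For a `C¹` function the weak gradient is the classical one. -/
theorem IsH1With.ae_eq_pderiv {Ω : Set E3} (hΩ : IsOpen Ω) {v : E3 → ℂ} (hv : ContDiff ℝ 1 v)
    (hc : HasCompactSupport v) {G : Fin 3 → E3 → ℂ} (hG : IsH1With Ω v G) (j : Fin 3) :
    ∀ᵐ x ∂(volume.restrict Ω), G j x = pderiv j v x := by
  have hcont := continuous_pderiv hv j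
  have hmem : MemLp (fun x => G j x - pderiv j v x) 2 (volume.restrict Ω) :=
    (hG.memLp_grad j).sub ((hcont.memLp_of_hasCompactSupport
      (hasCompactSupport_pderiv hc j)).restrict Ω)
  have h := hΩ.ae_eq_zero_of_integral_contDiff_smul_eq_zero (μ := volume.restrict Ω)
    (f := fun x => G j x - pderiv j v x)
    ((hmem.locallyIntegrable (by norm_num)).locallyIntegrableOn Ω) ?_
  · filter_upwards [h, ae_restrict_mem hΩ.measurableSet] with x hx hxΩ
    exact sub_eq_zero.1 (hx hxΩ)
  intro g hg hgc hgΩ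
  set φ : E3 → ℂ := fun x => (g x : ℂ) with hφ
  have hφd : ContDiff ℝ (⊤ : ℕ∞) φ := Complex.ofRealCLM.contDiff.comp hg
  have hφc : HasCompactSupport φ := hgc.comp_left (g := Complex.ofReal) (by simp)
  have hφΩ : tsupport φ ⊆ Ω :=
    (closure_mono (Function.support_comp_subset (g := Complex.ofReal) (by simp) g)).trans hgΩ
  have hφ1 : ContDiff ℝ 1 φ := hφd.of_le (by exact_mod_cast le_top)
  have hw := hG.weak j φ ⟨hφd, hφc, hφΩ⟩
  have hz := setIntegral_pderiv_mul_eq_zero hφ1 hφc hφΩ hv j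
  have hi1 : Integrable (fun x => pderiv j φ x * v x) (volume.restrict Ω) :=
    (((continuous_pderiv hφ1 j).mul hv.continuous).integrable_of_hasCompactSupport
      hc.mul_left).integrableOn
  have hi2 : Integrable (fun x => φ x * pderiv j v x) (volume.restrict Ω) :=
    ((hφ1.continuous.mul hcont).integrable_of_hasCompactSupport hφc.mul_right).integrableOn
  have hi3 : Integrable (fun x => φ x * G j x) (volume.restrict Ω) :=
    ((hφ1.continuous.memLp_of_hasCompactSupport hφc).restrict Ω).integrable_mul (p := 2) (q := 2)
      (hG.memLp_grad j)
  rw [integral_add hi1 hi2] at hz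
  have e1 : ∫ x in Ω, v x * pderiv j φ x = ∫ x in Ω, pderiv j φ x * v x := by
    simp only [mul_comm]
  have e2 : ∫ x in Ω, G j x * φ x = ∫ x in Ω, φ x * G j x := by
    simp only [mul_comm]
  rw [e1, e2] at hw
  have e3 : ∀ x, g x • (G j x - pderiv j v x) = φ x * G j x - φ x * pderiv j v x := by
    intro x; rw [Complex.real_smul]; ring
  simp only [e3]
  rw [integral_sub hi3 hi2]
  linear_combination hw - hz

/-- Functions in `H¹₀` satisfy the product rule integrated against arbitrary test functions. -/
theorem MemH10.setIntegral_pderiv_mul_eq_zero {Ω : Set E3} (hΩ : IsOpen Ω) {v : E3 → ℂ}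
    (hv : ContDiff ℝ 1 v) (hc : HasCompactSupport v) (h0 : MemH10 Ω v) {ψ : E3 → ℂ}
    (hψ : ContDiff ℝ 1 ψ) (hψc : HasCompactSupport ψ) (j : Fin 3) :
    ∫ x in Ω, (pderiv j v x * ψ x + v x * pderiv j ψ x) = 0 := by
  obtain ⟨G, hG, φ, hφ, hφv, hφG⟩ := h0
  have hφ1 : ∀ n, ContDiff ℝ 1 (φ n) := fun n => (hφ n).contDiff.of_le (by exact_mod_cast le_top)
  have hlim : ∀ (u : ℕ → E3 → ℂ) (u₀ χ : E3 → ℂ), (∀ n, MemLp (u n) 2 (volume.restrict Ω)) →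
      MemLp u₀ 2 (volume.restrict Ω) → MemLp χ 2 (volume.restrict Ω) →
      Tendsto (fun n => eLpNorm (fun x => u n x - u₀ x) 2 (volume.restrict Ω)) atTop (𝓝 0) →
      Tendsto (fun n => ∫ x in Ω, u n x * χ x) atTop (𝓝 (∫ x in Ω, u₀ x * χ x)) := by
    intro u u₀ χ hu hu₀ hχ ht
    refine tendsto_integral_of_L1' _ (hu₀.integrable_mul hχ).aestronglyMeasurable
      (Eventually.of_forall fun n => (hu n).integrable_mul hχ) ?_
    have hb : Tendsto (fun n => eLpNorm χ 2 (volume.restrict Ω)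
        * eLpNorm (fun x => u n x - u₀ x) 2 (volume.restrict Ω)) atTop (𝓝 0) := by
      have := ENNReal.Tendsto.const_mul ht (Or.inr hχ.eLpNorm_lt_top.ne)
      rwa [mul_zero] at this
    refine tendsto_of_tendsto_of_tendsto_of_le_of_le tendsto_const_nhds hb (fun _ => zero_le)
      fun n => ?_
    have e : (fun x => u n x * χ x) - u₀ * χ
        = χ • (fun x => u n x - u₀ x) := by
      ext x; simp only [Pi.sub_apply, Pi.mul_apply, Pi.smul_apply', smul_eq_mul]; ring
    rw [e]
    exact eLpNorm_smul_le_mul_eLpNorm ((hu n).sub hu₀).aestronglyMeasurable hχ.aestronglyMeasurable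
  have hψm : MemLp ψ 2 (volume.restrict Ω) :=
    (hψ.continuous.memLp_of_hasCompactSupport hψc).restrict Ω
  have hψm' : MemLp (pderiv j ψ) 2 (volume.restrict Ω) :=
    ((continuous_pderiv hψ j).memLp_of_hasCompactSupport
      (hasCompactSupport_pderiv hψc j)).restrict Ω
  have hφm : ∀ n, MemLp (φ n) 2 (volume.restrict Ω) := fun n =>
    ((hφ1 n).continuous.memLp_of_hasCompactSupport (hφ n).hasCompactSupport).restrict Ω
  have hφm' : ∀ n, MemLp (pderiv j (φ n)) 2 (volume.restrict Ω) := fun n =>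
    ((continuous_pderiv (hφ1 n) j).memLp_of_hasCompactSupport
      (hasCompactSupport_pderiv (hφ n).hasCompactSupport j)).restrict Ω
  have t1 := hlim _ _ ψ hφm' (hG.memLp_grad j) hψm (hφG j)
  have t2 := hlim _ _ (pderiv j ψ) hφm hG.memLp hψm' hφv
  have t3 := t1.add t2
  have hz : ∀ n, (∫ x in Ω, pderiv j (φ n) x * ψ x) + ∫ x in Ω, φ n x * pderiv j ψ x = 0 := by
    intro n
    have hadd := integral_add ((hφm' n).integrable_mul hψm) ((hφm n).integrable_mul hψm')
    simp only [Pi.mul_apply] at hadd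
    rw [← hadd]
    exact Waveguide.setIntegral_pderiv_mul_eq_zero (hφ1 n) (hφ n).hasCompactSupport
      (hφ n).tsupport_subset hψ j
  simp only [hz] at t3
  have h1 := tendsto_nhds_unique tendsto_const_nhds t3
  have hadd := integral_add ((hG.memLp_grad j).integrable_mul hψm) (hG.memLp.integrable_mul hψm')
  simp only [Pi.mul_apply] at hadd
  rw [h1, ← hadd]
  refine integral_congr_ae ?_
  filter_upwards [hG.ae_eq_pderiv hΩ hv hc j] with x hx
  rw [hx]

/-- A `C¹` function in `H¹₀(ω × ℝ)` vanishes on the boundary: its square, localized near a boundary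
point, has vanishing flux in the direction of the normal at that point. -/
theorem MemH10.eq_zero_of_mem_frontier {ω : Set E2} (hω : IsC2Open ω) {K : ℝ≥0} {μ : Measure E3}
    (hμ : IsLateralBoundaryMeasure ω K μ) {v : E3 → ℂ} (hv : ContDiff ℝ 1 v)
    (hc : HasCompactSupport v) (h0 : MemH10 (cylinder ω) v) {x₀ : E3}
    (hx₀ : transversal x₀ ∈ frontier ω) : v x₀ = 0 := by
  have hfin := hμ.finiteOnCompacts
  have hac : μ ≪ lateralMeasure ω := absolutelyContinuous_of_le_nnreal_smul hμ.le
  set n₀ : E2 := outwardNormal ω (transversal x₀) with hn₀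
  obtain ⟨V, hV, hx₀V, hVn⟩ : ∃ V : Set E2, IsOpen V ∧ transversal x₀ ∈ V ∧
      ∀ y ∈ V ∩ frontier ω, 0 < ⟪n₀, outwardNormal ω y⟫ := by
    have h1 : ContinuousWithinAt (fun y => ⟪n₀, outwardNormal ω y⟫) (frontier ω) (transversal x₀) :=
      continuousWithinAt_const.inner (continuousOn_outwardNormal hω _ hx₀)
    have h2 : 0 < ⟪n₀, outwardNormal ω (transversal x₀)⟫ := by
      rw [← hn₀, real_inner_self_eq_norm_sq, hn₀, norm_outwardNormal hω hx₀]; norm_num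
    obtain ⟨V, hV, hxV, hVs⟩ := mem_nhdsWithin.1 (h1.eventually (lt_mem_nhds h2))
    exact ⟨V, hV, hxV, fun y hy => hVs hy⟩
  obtain ⟨χ, hχ1, hχc, hχd, hχr, hχx⟩ := exists_contDiff_tsupport_subset (n := 1)
    ((hV.preimage continuous_transversal).mem_nhds hx₀V : transversal ⁻¹' V ∈ 𝓝 x₀)
  have hχ0 : ∀ x, 0 ≤ χ x := fun x => (hχr ⟨x, rfl⟩).1
  set f : E3 → ℝ := fun x => χ x * ‖v x‖ ^ 2 with hf
  have hfd : ContDiff ℝ 1 f := by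
    have h1 : ContDiff ℝ 1 χ := by exact_mod_cast hχd
    exact h1.mul (hv.norm_sq ℝ)
  have hfc : HasCompactSupport f := hχc.mul_right
  set ψ : E3 → ℂ := fun x => (χ x : ℂ) * (starRingEnd ℂ) (v x) with hψ
  have hψd : ContDiff ℝ 1 ψ := by
    have h1 : ContDiff ℝ 1 χ := by exact_mod_cast hχd
    exact (Complex.ofRealCLM.contDiff.comp h1).mul (Complex.conjCLE.contDiff.comp hv)
  have hψc : HasCompactSupport ψ :=
    (hχc.comp_left (g := Complex.ofReal) (by simp)).mul_right
  have hfψ : ∀ x, v x * ψ x = (f x : ℂ) := by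
    intro x
    rw [hψ, hf]
    push_cast
    rw [← Complex.mul_conj']
    ring
  -- Since `f = v ψ` with `v ∈ H¹₀`, every partial derivative of `f` has integral zero.
  have hpd : ∀ j, ∫ x in cylinder ω, fderiv ℝ f x (EuclideanSpace.single j 1) = 0 := by
    intro j
    have h1 := h0.setIntegral_pderiv_mul_eq_zero (isOpen_cylinder hω.isOpen) hv hc hψd hψc j
    have h2 : ∀ x, pderiv j v x * ψ x + v x * pderiv j ψ x
        = ((fderiv ℝ f x (EuclideanSpace.single j 1) : ℝ) : ℂ) := by
      intro x
      rw [← pderiv_mul ((hv.differentiable (by simp)) x) ((hψd.differentiable (by simp)) x), pderiv]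
      simp only [hfψ]
      exact congrArg (fun L : E3 →L[ℝ] ℂ => L (EuclideanSpace.single j 1))
        (Complex.ofRealCLM.hasFDerivAt.comp x
          ((hfd.differentiable (by simp)) x).hasFDerivAt).fderiv
    simp only [h2] at h1
    rw [integral_complex_ofReal] at h1
    exact_mod_cast h1
  have hflux : ∫ x, f x * ⟪n₀, outwardNormal ω (transversal x)⟫ ∂μ = 0 := by
    have h1 := hμ.gaussGreen f hfd hfc (cylEquiv (n₀, 0))
    rw [transversal_cylEquiv] at h1
    rw [← h1]
    have h2 : cylEquiv (n₀, 0) = ∑ j, (cylEquiv (n₀, 0)) j • EuclideanSpace.single j (1 : ℝ) := by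
      ext i; fin_cases i <;> simp [Fin.sum_univ_three]
    rw [h2]
    simp only [map_sum, map_smul]
    rw [integral_finsetSum]
    · simp only [smul_eq_mul]
      refine Finset.sum_eq_zero fun j _ => ?_
      rw [integral_const_mul, hpd, mul_zero]
    · intro j _
      have hi : Integrable fun x => fderiv ℝ f x (EuclideanSpace.single j 1) :=
        ((hfd.continuous_fderiv (by simp)).clm_apply
          continuous_const).integrable_of_hasCompactSupport ((hfc.fderiv ℝ).comp_left
          (g := fun L : E3 →L[ℝ] ℝ => L (EuclideanSpace.single j 1)) (by simp))
      exact (hi.const_mul _).integrableOn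
  have hfr : ∀ᵐ x ∂μ, transversal x ∈ frontier ω := hac.ae_le (ae_transversal_mem_frontier ω)
  have hfV : ∀ x, transversal x ∉ V → f x = 0 := by
    intro x hx
    rw [hf]
    simp only
    rw [image_eq_zero_of_notMem_tsupport (fun h => hx (hχ1 h)), zero_mul]
  have hf0 : ∀ x, 0 ≤ f x := fun x => mul_nonneg (hχ0 x) (by positivity)
  have hnn : 0 ≤ᵐ[μ] fun x => f x * ⟪n₀, outwardNormal ω (transversal x)⟫ := by
    filter_upwards [hfr] with x hx
    by_cases hxV : transversal x ∈ V
    · exact mul_nonneg (hf0 x) (hVn _ ⟨hxV, hx⟩).le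
    · simp [hfV x hxV]
  have hae := (integral_eq_zero_iff_of_nonneg_ae hnn
    (integrable_mul_inner_lateral hω hac hfd.continuous hfc n₀)).1 hflux
  have hf_ae : ∀ᵐ x ∂μ, f x = 0 := by
    filter_upwards [hae, hfr] with x hx hxf
    by_cases hxV : transversal x ∈ V
    · exact (mul_eq_zero.1 hx).resolve_right (hVn _ ⟨hxV, hxf⟩).ne'
    · exact hfV x hxV
  by_contra hvx
  have hpos := lateralMeasure_pos hω hx₀ (W := {x | f x ≠ 0})
    (isOpen_ne.preimage hfd.continuous) (by
      simp only [Set.mem_ofPred_eq, hf, hχx]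
      simpa using hvx)
  have : lateralMeasure ω {x | f x ≠ 0} = 0 :=
    (absolutelyContinuous_of_le_nnreal_smul hμ.ge) (ae_iff.1 hf_ae)
  exact hpos.ne' this

/-- On the boundary the gradient of a function vanishing there is normal. -/
theorem fderiv_eq_inner_smul_normalDeriv {ω : Set E2} (hω : IsC2Open ω) {v : E3 → ℂ}
    (hv : ContDiff ℝ 1 v) (h0 : ∀ x, transversal x ∈ frontier ω → v x = 0) {x : E3}
    (hx : transversal x ∈ frontier ω) (w : E3) :
    fderiv ℝ v x w
      = ((⟪transversal w, outwardNormal ω (transversal x)⟫ : ℝ) : ℂ) * normalDeriv ω v x := by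
  obtain ⟨U, b, h, hpU, H⟩ := exists_isLocalGraph hω hx
  set x₀ : ℝ := ⟪b 0, transversal x⟫ with hx₀
  have e := frame_inner b (transversal x)
  have hp : frame b (x₀, h x₀) = transversal x := by
    have h2 := (H.mem_frontier_iff _ (by rw [e]; exact hpU)).1 (by rw [e]; exact hx)
    conv_rhs => rw [← e]
    rw [← h2]
  have hxeq : cylEquiv (frame b (x₀, h x₀), x 2) = x := by
    rw [hp]; exact cylEquiv.apply_symm_apply x
  have hvd : HasFDerivAt v (fderiv ℝ v x) (cylEquiv (frame b (x₀, h x₀), x 2)) := by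
    rw [hxeq]; exact (hv.differentiable (by simp) x).hasFDerivAt
  have htan : fderiv ℝ v x (cylEquiv (frame b (1, deriv h x₀), 0)) = 0 := by
    have h1 : HasDerivAt (fun s => (s, h s)) ((1 : ℝ), deriv h x₀) x₀ :=
      (hasDerivAt_id x₀).prodMk ((H.contDiff.differentiable (by simp)) x₀).hasDerivAt
    have h2 := ((frame b).hasFDerivAt.comp_hasDerivAt x₀ h1).prodMk (hasDerivAt_const x₀ (x 2))
    have h3 := hvd.comp_hasDerivAt x₀ (cylEquiv.hasFDerivAt.comp_hasDerivAt x₀ h2)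
    refine h3.unique ((hasDerivAt_const x₀ (0 : ℂ)).congr_of_eventuallyEq ?_)
    have hcont : Continuous fun s => frame b (s, h s) := by
      have := H.contDiff.continuous
      fun_prop
    filter_upwards [hcont.continuousAt.preimage_mem_nhds
      (H.isOpen.mem_nhds (by rw [hp]; exact hpU))] with s hs
    refine h0 _ ?_
    change transversal (cylEquiv (frame b (s, h s), x 2)) ∈ frontier ω
    rw [transversal_cylEquiv]
    exact (H.mem_frontier_iff (s, h s) hs).2 rfl
  have hver : fderiv ℝ v x (cylEquiv (0, 1)) = 0 := by
    have h2 := (hasDerivAt_const (x 2) (frame b (x₀, h x₀))).prodMk (hasDerivAt_id (x 2))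
    have h3 := hvd.comp_hasDerivAt (x 2) (cylEquiv.hasFDerivAt.comp_hasDerivAt (x 2) h2)
    refine h3.unique ((hasDerivAt_const (x 2) (0 : ℂ)).congr_of_eventuallyEq
      (Eventually.of_forall fun s => h0 _ ?_))
    change transversal (cylEquiv (frame b (x₀, h x₀), s)) ∈ frontier ω
    rw [transversal_cylEquiv, hp]
    exact hx
  have hν : outwardNormal ω (transversal x)
      = (√(1 + deriv h x₀ ^ 2))⁻¹ • frame b (-deriv h x₀, 1) := by
    rw [← hp]; exact H.outwardNormal_eq x₀ (by rw [hp]; exact hpU)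
  set r := √(1 + deriv h x₀ ^ 2) with hr
  have hr0 : 0 < r := by positivity
  have hr2 : r ^ 2 = 1 + deriv h x₀ ^ 2 := Real.sq_sqrt (by positivity)
  obtain ⟨c, hc⟩ : ∃ c : ℝ, w = ⟪transversal w, outwardNormal ω (transversal x)⟫ •
      cylEquiv (outwardNormal ω (transversal x), 0) + c • cylEquiv (frame b (1, deriv h x₀), 0)
        + (w 2) • cylEquiv (0, 1) := by
    set w₀ := ⟪b 0, transversal w⟫ with hw₀
    set w₁ := ⟪b 1, transversal w⟫ with hw₁
    refine ⟨(w₀ + deriv h x₀ * w₁) / r ^ 2, ?_⟩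
    have hin : ⟪transversal w, outwardNormal ω (transversal x)⟫ = (w₁ - deriv h x₀ * w₀) / r := by
      rw [hν, inner_smul_right, frame_apply, inner_add_right, inner_smul_right, inner_smul_right,
        real_inner_comm, ← hw₀, real_inner_comm, ← hw₁]
      field_simp; ring
    rw [hin, ← map_smul cylEquiv, ← map_smul cylEquiv, ← map_smul cylEquiv, ← map_add cylEquiv,
      ← map_add cylEquiv, hν]
    conv_lhs => rw [← cylEquiv.apply_symm_apply w, cylEquiv_symm_apply]
    congr 1
    refine Prod.ext ?_ (by simp)
    simp only [Prod.smul_mk, Prod.mk_add_mk, smul_zero, add_zero]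
    rw [← map_smul, ← map_smul, ← map_smul, ← map_add]
    conv_lhs => rw [← frame_inner b (transversal w)]
    congr 1
    ext
    · simp only [Prod.smul_mk, Prod.mk_add_mk, smul_eq_mul]
      field_simp
      rw [← hw₀, hr2]; ring
    · simp only [Prod.smul_mk, Prod.mk_add_mk, smul_eq_mul]
      field_simp
      rw [← hw₁, hr2]; ring
  conv_lhs => rw [hc]
  rw [map_add, map_add, map_smul, map_smul, map_smul, htan, hver, smul_zero, smul_zero, add_zero,
    add_zero, Complex.real_smul]
  rfl

/-! ### The conjugated operator -/

/-- The component `a = ±ρ - s (x' · θ)` of the gradient `a θ` of the weight; the sign is `ε`. -/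
noncomputable def slope (ε ρ s : ℝ) (θ : E2) (x : E3) : ℝ := ε * ρ - s * ⟪θ, transversal x⟫

theorem inner_transversal (θ : E2) (x : E3) : ⟪θ, transversal x⟫ = ⟪cylPoint θ 0, x⟫ := by
  simp [transversal, cylPoint, PiLp.inner_apply, Fin.sum_univ_three]

theorem inner_single (y : E3) (j : Fin 3) : ⟪y, EuclideanSpace.single j (1 : ℝ)⟫ = y j := by
  simp [EuclideanSpace.inner_single_right]

theorem hasFDerivAt_inner_transversal (θ : E2) (x : E3) :
    HasFDerivAt (fun x => ⟪θ, transversal x⟫) (innerSL ℝ (cylPoint θ 0)) x := by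
  simp only [inner_transversal]
  exact (innerSL ℝ (cylPoint θ 0)).hasFDerivAt

theorem hasFDerivAt_slope (ε ρ s : ℝ) (θ : E2) (x : E3) :
    HasFDerivAt (slope ε ρ s θ) (-(s • innerSL ℝ (cylPoint θ 0))) x :=
  ((hasFDerivAt_inner_transversal θ x).const_mul s).const_sub (ε * ρ)

theorem contDiff_inner_transversal (θ : E2) {n : WithTop ℕ∞} :
    ContDiff ℝ n fun x => ⟪θ, transversal x⟫ := by
  simp only [inner_transversal]
  exact (innerSL ℝ (cylPoint θ 0)).contDiff

theorem contDiff_slope (ε ρ s : ℝ) (θ : E2) {n : WithTop ℕ∞} : ContDiff ℝ n (slope ε ρ s θ) :=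
  contDiff_const.sub (contDiff_const.mul (contDiff_inner_transversal θ))

theorem hasFDerivAt_weight (ε ρ s : ℝ) (θ : E2) (x : E3) :
    HasFDerivAt (weight ε ρ s θ) (slope ε ρ s θ x • innerSL ℝ (cylPoint θ 0)) x := by
  have h := hasFDerivAt_inner_transversal θ x
  have h2 := (h.const_mul (ε * ρ)).sub ((h.pow 2).const_mul (s / 2))
  have e : weight ε ρ s θ
      = fun x => ε * ρ * ⟪θ, transversal x⟫ - s / 2 * ⟪θ, transversal x⟫ ^ 2 := by
    ext y; rw [weight, real_inner_comm]; ring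
  rw [e]
  refine h2.congr_fderiv ?_
  ext v
  simp [slope]
  ring

theorem contDiff_weight (ε ρ s : ℝ) (θ : E2) {n : WithTop ℕ∞} : ContDiff ℝ n (weight ε ρ s θ) := by
  have h := contDiff_inner_transversal θ (n := n)
  have e : weight ε ρ s θ
      = fun x => ε * ρ * ⟪θ, transversal x⟫ - s / 2 * ⟪θ, transversal x⟫ ^ 2 := by
    ext y; rw [weight, real_inner_comm]; ring
  rw [e]
  exact (contDiff_const.mul h).sub (contDiff_const.mul (h.pow 2))

theorem contDiff_pderiv {v : E3 → ℂ} {m n : WithTop ℕ∞} (hv : ContDiff ℝ n v) (hmn : m + 1 ≤ n)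
    (j : Fin 3) : ContDiff ℝ m (pderiv j v) :=
  (hv.fderiv_right hmn).clm_apply contDiff_const

theorem laplacian_eq_sum {v : E3 → ℂ} (hv : ContDiff ℝ 2 v) (x : E3) :
    Δ v x = ∑ j, pderiv j (pderiv j v) x := by
  rw [congrFun (InnerProductSpace.laplacian_eq_iteratedFDeriv_orthonormalBasis v
    (EuclideanSpace.basisFun (Fin 3) ℝ)) x]
  refine Finset.sum_congr rfl fun j _ => ?_
  rw [iteratedFDeriv_two_apply, pderiv]
  have hd : DifferentiableAt ℝ (fderiv ℝ v) x :=
    (hv.fderiv_right (m := 1) (by norm_num)).differentiable (by simp) x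
  have := fderiv_clm_apply hd (differentiableAt_const (EuclideanSpace.single j (1 : ℝ)))
  change _ = fderiv ℝ (fun y => fderiv ℝ v y (EuclideanSpace.single j 1)) x _
  rw [this]
  simp

theorem pderiv_comm {v : E3 → ℂ} (hv : ContDiff ℝ 2 v) (j k : Fin 3) (x : E3) :
    pderiv j (pderiv k v) x = pderiv k (pderiv j v) x := by
  have hd : DifferentiableAt ℝ (fderiv ℝ v) x :=
    (hv.fderiv_right (m := 1) (by norm_num)).differentiable (by simp) x
  have h : ∀ i l : Fin 3, pderiv i (pderiv l v) x
      = fderiv ℝ (fderiv ℝ v) x (EuclideanSpace.single i 1) (EuclideanSpace.single l 1) := by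
    intro i l
    have := fderiv_clm_apply hd (differentiableAt_const (EuclideanSpace.single l (1 : ℝ)))
    change fderiv ℝ (fun y => fderiv ℝ v y (EuclideanSpace.single l 1)) x _ = _
    rw [this]
    simp
  rw [h, h]
  exact (hv.contDiffAt.isSymmSndFDerivAt (by simp)) _ _

/-- Conjugation by the exponential of the weight turns `∂_j` into `∂_j + a θ_j`. -/
theorem pderiv_exp_weight_mul (ε ρ s : ℝ) (θ : E2) {u : E3 → ℂ} (hu : Differentiable ℝ u)
    (j : Fin 3) (x : E3) :
    pderiv j (fun y => (Real.exp (weight ε ρ s θ y) : ℂ) * u y) x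
      = (Real.exp (weight ε ρ s θ x) : ℂ)
        * ((slope ε ρ s θ x : ℂ) * (cylPoint θ 0 j : ℝ) * u x + pderiv j u x) := by
  have he : HasFDerivAt (fun y => (Real.exp (weight ε ρ s θ y) : ℂ))
      (Complex.ofRealCLM.comp (Real.exp (weight ε ρ s θ x) •
        (slope ε ρ s θ x • innerSL ℝ (cylPoint θ 0)))) x :=
    Complex.ofRealCLM.hasFDerivAt.comp x (hasFDerivAt_weight ε ρ s θ x).exp
  rw [pderiv_mul he.differentiableAt (hu x)]
  have : pderiv j (fun y => (Real.exp (weight ε ρ s θ y) : ℂ)) x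
      = (Real.exp (weight ε ρ s θ x) : ℂ) * ((slope ε ρ s θ x : ℂ) * (cylPoint θ 0 j : ℝ)) := by
    rw [pderiv, he.fderiv]
    simp only [ContinuousLinearMap.comp_apply, smul_apply, innerSL_apply_apply, inner_single,
      smul_eq_mul, Complex.ofRealCLM_apply]
    push_cast; ring
  rw [this]
  ring

theorem pderiv_slope_mul (ε ρ s : ℝ) (θ : E2) {u : E3 → ℂ} (hu : Differentiable ℝ u)
    (j : Fin 3) (x : E3) :
    pderiv j (fun y => (slope ε ρ s θ y : ℂ) * (cylPoint θ 0 j : ℝ) * u y) x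
      = -(s : ℂ) * (cylPoint θ 0 j : ℝ) ^ 2 * u x
        + (slope ε ρ s θ x : ℂ) * (cylPoint θ 0 j : ℝ) * pderiv j u x := by
  have ha : HasFDerivAt (fun y => (slope ε ρ s θ y : ℂ) * (cylPoint θ 0 j : ℝ))
      (Complex.ofRealCLM.comp (cylPoint θ 0 j • (-(s • innerSL ℝ (cylPoint θ 0))))) x := by
    have := Complex.ofRealCLM.hasFDerivAt.comp x
      ((hasFDerivAt_slope ε ρ s θ x).mul_const (cylPoint θ 0 j))
    refine this.congr_of_eventuallyEq (Eventually.of_forall fun y => ?_)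
    simp
  rw [pderiv_mul ha.differentiableAt (hu x)]
  congr 2
  rw [pderiv, ha.fderiv]
  simp only [ContinuousLinearMap.comp_apply, smul_apply, innerSL_apply_apply, inner_single,
    smul_eq_mul, Complex.ofRealCLM_apply, neg_apply]
  push_cast; ring

/-- The derivative of `v` in the direction `(θ, 0)`. -/
noncomputable def dirDeriv (θ : E2) (v : E3 → ℂ) (x : E3) : ℂ :=
  ∑ j, ((cylPoint θ 0 j : ℝ) : ℂ) * pderiv j v x

/-- The symmetric part `Δ + a²` of the conjugated Laplacian. -/
noncomputable def symmPart (ε ρ s : ℝ) (θ : E2) (v : E3 → ℂ) (x : E3) : ℂ :=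
  Δ v x + ((slope ε ρ s θ x ^ 2 : ℝ) : ℂ) * v x

/-- The antisymmetric part `2 a ∂_θ - s` of the conjugated Laplacian. -/
noncomputable def antisymmPart (ε ρ s : ℝ) (θ : E2) (v : E3 → ℂ) (x : E3) : ℂ :=
  ((2 * slope ε ρ s θ x : ℝ) : ℂ) * dirDeriv θ v x - (s : ℂ) * v x

theorem sum_cylPoint_sq {θ : E2} (hθ : ‖θ‖ = 1) :
    cylPoint θ 0 0 ^ 2 + cylPoint θ 0 1 ^ 2 + cylPoint θ 0 2 ^ 2 = 1 := by
  have := EuclideanSpace.norm_sq_eq θ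
  rw [hθ, Fin.sum_univ_two, Real.norm_eq_abs, Real.norm_eq_abs, sq_abs, sq_abs] at this
  simp [cylPoint]
  linarith

/-- The conjugated operator is the sum of the symmetric part, the antisymmetric part and the terms
involving the coefficients. -/
theorem carlemanOp_eq {A : E3 → E3} {q : E3 → ℂ} {ε ρ s : ℝ} {θ : E2} (hθ : ‖θ‖ = 1) {v : E3 → ℂ}
    (hv : ContDiff ℝ 2 v) (x : E3) :
    carlemanOp A q ε ρ s θ v x
      = symmPart ε ρ s θ v x + antisymmPart ε ρ s θ v x
        + (2 * Complex.I * ∑ j, (A x j : ℂ) *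
            ((slope ε ρ s θ x : ℂ) * (cylPoint θ 0 j : ℝ) * v x + pderiv j v x) + q x * v x) := by
  have hE : (Real.exp (-weight ε ρ s θ x) : ℂ) * (Real.exp (weight ε ρ s θ x) : ℂ) = 1 := by
    rw [← Complex.ofReal_mul, ← Real.exp_add]; simp
  have hw2 : ContDiff ℝ 2 fun y => (Real.exp (weight ε ρ s θ y) : ℂ) * v y :=
    (Complex.ofRealCLM.contDiff.comp (contDiff_weight ε ρ s θ).exp).mul hv
  have hvd : Differentiable ℝ v := hv.differentiable (by simp)
  have hp : ∀ j, pderiv j (fun y => (Real.exp (weight ε ρ s θ y) : ℂ) * v y)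
      = fun y => (Real.exp (weight ε ρ s θ y) : ℂ)
        * ((slope ε ρ s θ y : ℂ) * (cylPoint θ 0 j : ℝ) * v y + pderiv j v y) :=
    fun j => funext fun y => pderiv_exp_weight_mul ε ρ s θ hvd j y
  have hpd : ∀ j, Differentiable ℝ (pderiv j v) := fun j =>
    (contDiff_pderiv hv (m := 1) (by norm_num) j).differentiable (by simp)
  have hsd : ∀ j, Differentiable ℝ
      fun y => (slope ε ρ s θ y : ℂ) * (cylPoint θ 0 j : ℝ) * v y := fun j =>
    ((Complex.ofRealCLM.contDiff.comp (contDiff_slope ε ρ s θ (n := 1))).differentiable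
      (by simp)).mul_const _ |>.mul hvd
  have hpp : ∀ j, pderiv j (pderiv j fun y => (Real.exp (weight ε ρ s θ y) : ℂ) * v y) x
      = (Real.exp (weight ε ρ s θ x) : ℂ)
        * ((slope ε ρ s θ x : ℂ) * (cylPoint θ 0 j : ℝ)
            * ((slope ε ρ s θ x : ℂ) * (cylPoint θ 0 j : ℝ) * v x + pderiv j v x)
          + (-(s : ℂ) * (cylPoint θ 0 j : ℝ) ^ 2 * v x
            + (slope ε ρ s θ x : ℂ) * (cylPoint θ 0 j : ℝ) * pderiv j v x
            + pderiv j (pderiv j v) x)) := by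
    intro j
    rw [hp j, pderiv_exp_weight_mul ε ρ s θ ((hsd j).fun_add (hpd j)) j x]
    congr 2
    rw [← pderiv_slope_mul ε ρ s θ hvd j x, pderiv, fderiv_fun_add (hsd j x) (hpd j x)]
    rfl
  have hθ' : ((cylPoint θ 0 0 : ℝ) : ℂ) ^ 2 + ((cylPoint θ 0 1 : ℝ) : ℂ) ^ 2
      + ((cylPoint θ 0 2 : ℝ) : ℂ) ^ 2 = 1 := by
    simpa only [Complex.ofReal_add, Complex.ofReal_pow, Complex.ofReal_one] using
      congrArg Complex.ofReal (sum_cylPoint_sq hθ)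
  rw [carlemanOp, magneticOp, laplacian_eq_sum hw2, symmPart, antisymmPart, dirDeriv,
    laplacian_eq_sum hv]
  simp only [hpp]
  simp only [hp, Fin.sum_univ_three]
  simp only [Complex.ofReal_pow, Complex.ofReal_mul, Complex.ofReal_ofNat]
  set E := (Real.exp (weight ε ρ s θ x) : ℂ)
  set E' := (Real.exp (-weight ε ρ s θ x) : ℂ)
  set a := (slope ε ρ s θ x : ℂ)
  linear_combination (exp := 1)
    (pderiv 0 (pderiv 0 v) x + pderiv 1 (pderiv 1 v) x + pderiv 2 (pderiv 2 v) x
      + a ^ 2 * v x + 2 * a * (((cylPoint θ 0 0 : ℝ) : ℂ) * pderiv 0 v x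
        + ((cylPoint θ 0 1 : ℝ) : ℂ) * pderiv 1 v x + ((cylPoint θ 0 2 : ℝ) : ℂ) * pderiv 2 v x)
      - s * v x
      + 2 * Complex.I * ((A x 0 : ℂ) * (a * (cylPoint θ 0 0 : ℝ) * v x + pderiv 0 v x)
        + (A x 1 : ℂ) * (a * (cylPoint θ 0 1 : ℝ) * v x + pderiv 1 v x)
        + (A x 2 : ℂ) * (a * (cylPoint θ 0 2 : ℝ) * v x + pderiv 2 v x)) + q x * v x) * hE
      + E' * E * (a ^ 2 * v x - s * v x) * hθ'

/-! ### The integrated identities -/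

theorem inner_eq_sum_cylPoint (y z : E2) :
    ⟪y, z⟫ = cylPoint y 0 0 * cylPoint z 0 0 + cylPoint y 0 1 * cylPoint z 0 1
      + cylPoint y 0 2 * cylPoint z 0 2 := by
  simp [cylPoint, PiLp.inner_apply]
  ring

/-- The divergence theorem on the cylinder. -/
theorem IsLateralBoundaryMeasure.setIntegral_divergence {ω : Set E2} (hω : IsC2Open ω) {K : ℝ≥0}
    {μ : Measure E3} (hμ : IsLateralBoundaryMeasure ω K μ) {F : Fin 3 → E3 → ℝ}
    (hF : ∀ j, ContDiff ℝ 1 (F j)) (hc : ∀ j, HasCompactSupport (F j)) :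
    ∫ x in cylinder ω, ∑ j, fderiv ℝ (F j) x (EuclideanSpace.single j 1)
      = ∫ x, ∑ j, F j x * cylPoint (outwardNormal ω (transversal x)) 0 j ∂μ := by
  have hfin := hμ.finiteOnCompacts
  have e : ∀ j x, cylPoint (outwardNormal ω (transversal x)) 0 j
      = ⟪transversal (EuclideanSpace.single j 1), outwardNormal ω (transversal x)⟫ := by
    intro j x
    rw [real_inner_comm, inner_transversal, inner_single]
  simp only [e]
  rw [integral_finsetSum, integral_finsetSum]
  · exact Finset.sum_congr rfl fun j _ => hμ.gaussGreen _ (hF j) (hc j) _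
  · exact fun j _ => integrable_mul_inner_lateral hω
      (absolutelyContinuous_of_le_nnreal_smul hμ.le) (hF j).continuous (hc j) _
  · intro j _
    exact ((((hF j).continuous_fderiv (by simp)).clm_apply
      continuous_const).integrable_of_hasCompactSupport (((hc j).fderiv ℝ).comp_left
      (g := fun L : E3 →L[ℝ] ℝ => L (EuclideanSpace.single j 1)) (by simp))).integrableOn

/-- The vector field whose divergence is the cross term of the two parts of the conjugated
Laplacian, up to terms of a definite sign. -/
noncomputable def carlemanField (ε ρ s : ℝ) (θ : E2) (v : E3 → ℂ) (j : Fin 3) (x : E3) : ℝ :=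
  4 * slope ε ρ s θ x * ⟪dirDeriv θ v x, pderiv j v x⟫
    - 2 * cylPoint θ 0 j * slope ε ρ s θ x * ∑ k, ⟪pderiv k v x, pderiv k v x⟫
    - 2 * s * ⟪v x, pderiv j v x⟫
    + 2 * cylPoint θ 0 j * slope ε ρ s θ x ^ 3 * ⟪v x, v x⟫

theorem contDiff_dirDeriv {v : E3 → ℂ} (hv : ContDiff ℝ 2 v) (θ : E2) :
    ContDiff ℝ 1 (dirDeriv θ v) :=
  ContDiff.sum fun j _ => contDiff_const.mul (contDiff_pderiv hv (m := 1) (by norm_num) j)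

theorem contDiff_carlemanField {v : E3 → ℂ} (hv : ContDiff ℝ 2 v) (ε ρ s : ℝ) (θ : E2)
    (j : Fin 3) : ContDiff ℝ 1 (carlemanField ε ρ s θ v j) := by
  have h1 := contDiff_slope ε ρ s θ (n := 1)
  have h2 := contDiff_dirDeriv hv θ
  have h3 := fun k => contDiff_pderiv hv (m := 1) (by norm_num) k
  have h4 : ContDiff ℝ 1 v := hv.of_le (by norm_num)
  exact ((((contDiff_const.mul h1).mul (h2.inner ℝ (h3 j))).sub ((contDiff_const.mul h1).mul
    (ContDiff.sum fun k _ => (h3 k).inner ℝ (h3 k)))).sub (contDiff_const.mul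
    (h4.inner ℝ (h3 j)))).add ((contDiff_const.mul (h1.pow 3)).mul (h4.inner ℝ h4))

theorem fderiv_single_eq {F : E3 → ℝ} {x : E3} {j : Fin 3} {F' : ℝ}
    (hF : DifferentiableAt ℝ F x)
    (h : HasDerivAt (fun t : ℝ => F (x + t • EuclideanSpace.single j (1 : ℝ))) F' 0) :
    fderiv ℝ F x (EuclideanSpace.single j 1) = F' :=
  (hF.hasFDerivAt.hasLineDerivAt _).unique h

theorem hasDerivAt_line {V : Type*} [NormedAddCommGroup V] [NormedSpace ℝ V] {f : E3 → V} {x : E3}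
    (hf : DifferentiableAt ℝ f x) (j : Fin 3) :
    HasDerivAt (fun t : ℝ => f (x + t • EuclideanSpace.single j (1 : ℝ)))
      (fderiv ℝ f x (EuclideanSpace.single j 1)) 0 :=
  hf.hasFDerivAt.hasLineDerivAt _

theorem fderiv_carlemanField {v : E3 → ℂ} (hv : ContDiff ℝ 2 v) (ε ρ s : ℝ) (θ : E2) (j : Fin 3)
    (x : E3) :
    fderiv ℝ (carlemanField ε ρ s θ v j) x (EuclideanSpace.single j 1)
      = -4 * s * cylPoint θ 0 j * ⟪dirDeriv θ v x, pderiv j v x⟫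
        + 4 * slope ε ρ s θ x * (⟪dirDeriv θ v x, pderiv j (pderiv j v) x⟫
            + ⟪∑ k, ((cylPoint θ 0 k : ℝ) : ℂ) * pderiv j (pderiv k v) x, pderiv j v x⟫)
        + 2 * s * cylPoint θ 0 j ^ 2 * ∑ k, ⟪pderiv k v x, pderiv k v x⟫
        - 4 * cylPoint θ 0 j * slope ε ρ s θ x
            * ∑ k, ⟪pderiv k v x, pderiv j (pderiv k v) x⟫
        - 2 * s * (⟪v x, pderiv j (pderiv j v) x⟫ + ⟪pderiv j v x, pderiv j v x⟫)
        - 6 * s * cylPoint θ 0 j ^ 2 * slope ε ρ s θ x ^ 2 * ⟪v x, v x⟫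
        + 4 * cylPoint θ 0 j * slope ε ρ s θ x ^ 3 * ⟪v x, pderiv j v x⟫ := by
  have hD : ∀ k, HasDerivAt (fun t : ℝ => pderiv k v (x + t • EuclideanSpace.single j (1 : ℝ)))
      (pderiv j (pderiv k v) x) 0 := fun k =>
    hasDerivAt_line ((contDiff_pderiv hv (m := 1) (by norm_num) k).differentiable (by simp) x) j
  have hv1 : HasDerivAt (fun t : ℝ => v (x + t • EuclideanSpace.single j (1 : ℝ)))
      (pderiv j v x) 0 := hasDerivAt_line (hv.differentiable (by simp) x) j
  have ha : HasDerivAt (fun t : ℝ => slope ε ρ s θ (x + t • EuclideanSpace.single j (1 : ℝ)))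
      (-(s * cylPoint θ 0 j)) 0 := by
    have := hasDerivAt_line (hasFDerivAt_slope ε ρ s θ x).differentiableAt j
    rw [(hasFDerivAt_slope ε ρ s θ x).fderiv] at this
    simpa [inner_single] using this
  have hT : HasDerivAt (fun t : ℝ => dirDeriv θ v (x + t • EuclideanSpace.single j (1 : ℝ)))
      (∑ k, ((cylPoint θ 0 k : ℝ) : ℂ) * pderiv j (pderiv k v) x) 0 :=
    HasDerivAt.fun_sum fun k _ => (hD k).const_mul _
  refine fderiv_single_eq ((contDiff_carlemanField hv ε ρ s θ j).differentiable (by simp) x) ?_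
  have hN := HasDerivAt.fun_sum (u := Finset.univ) fun k _ => (hD k).inner ℝ (hD k)
  have h := (((((ha.const_mul 4).mul (hT.inner ℝ (hD j))).sub
    ((ha.const_mul (2 * cylPoint θ 0 j)).mul hN)).sub
    ((hv1.inner ℝ (hD j)).const_mul (2 * s)))).add
    (((ha.pow 3).const_mul (2 * cylPoint θ 0 j)).mul (hv1.inner ℝ hv1))
  refine h.congr_deriv ?_
  simp only [zero_smul, add_zero, Finset.sum_add_distrib, Pi.pow_apply]
  simp only [fun k => real_inner_comm (pderiv k v x) (pderiv j (pderiv k v) x),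
    real_inner_comm (v x) (pderiv j v x)]
  push_cast
  ring

/-- The algebraic core of the Carleman estimate: the cross term of the symmetric and the
antisymmetric part is a divergence plus nonnegative terms. -/
theorem two_inner_symmPart_antisymmPart {v : E3 → ℂ} (hv : ContDiff ℝ 2 v) (ε ρ s : ℝ) {θ : E2}
    (hθ : ‖θ‖ = 1) (x : E3) :
    2 * ⟪symmPart ε ρ s θ v x, antisymmPart ε ρ s θ v x⟫
      = ∑ j, fderiv ℝ (carlemanField ε ρ s θ v j) x (EuclideanSpace.single j 1)
        + 4 * s * ‖dirDeriv θ v x‖ ^ 2 + 4 * s * (slope ε ρ s θ x ^ 2 * ‖v x‖ ^ 2) := by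
  have hsum := sum_cylPoint_sq hθ
  simp only [fderiv_carlemanField hv, ← real_inner_self_eq_norm_sq, symmPart, antisymmPart,
    laplacian_eq_sum hv, dirDeriv, Fin.sum_univ_three, Complex.inner]
  rw [pderiv_comm hv 1 0, pderiv_comm hv 2 0, pderiv_comm hv 2 1]
  simp only [Complex.mul_re, Complex.mul_im, Complex.add_re, Complex.add_im, Complex.sub_re,
    Complex.sub_im, Complex.conj_re, Complex.conj_im, Complex.ofReal_re, Complex.ofReal_im]
  set a := slope ε ρ s θ x
  -- Beyond polynomial algebra the identity only uses `|θ| = 1`.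
  linear_combination (-(2 * s * ((pderiv 0 v x).re ^ 2 + (pderiv 0 v x).im ^ 2
    + (pderiv 1 v x).re ^ 2 + (pderiv 1 v x).im ^ 2 + (pderiv 2 v x).re ^ 2
    + (pderiv 2 v x).im ^ 2)) + 6 * s * a ^ 2 * ((v x).re ^ 2 + (v x).im ^ 2)) * hsum

/-! ### Integral inequalities -/

theorem pderiv_pderiv_eq_zero_of_notMem_tsupport {v : E3 → ℂ} {x : E3} (hx : x ∉ tsupport v)
    (j k : Fin 3) : pderiv j (pderiv k v) x = 0 := by
  refine pderiv_eq_zero_of_notMem_tsupport (fun h => hx ?_) j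
  exact closure_minimal (fun y hy => by
    by_contra hy'
    exact hy (pderiv_eq_zero_of_notMem_tsupport hy' k)) (isClosed_tsupport v) h

theorem integrable_of_tsupport {v : E3 → ℂ} (hc : HasCompactSupport v) {E : Type*}
    [NormedAddCommGroup E] {f : E3 → E} (hf : Continuous f) (h0 : ∀ x, x ∉ tsupport v → f x = 0) :
    Integrable f :=
  hf.integrable_of_hasCompactSupport (HasCompactSupport.intro hc h0)

theorem continuous_laplacian {v : E3 → ℂ} (hv : ContDiff ℝ 2 v) : Continuous fun x => Δ v x := by
  simp only [laplacian_eq_sum hv]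
  exact continuous_finsetSum _ fun j _ =>
    continuous_pderiv (contDiff_pderiv hv (m := 1) (by norm_num) j) j

theorem laplacian_eq_zero_of_notMem_tsupport {v : E3 → ℂ} (hv : ContDiff ℝ 2 v) {x : E3}
    (hx : x ∉ tsupport v) : Δ v x = 0 := by
  rw [laplacian_eq_sum hv]
  exact Finset.sum_eq_zero fun j _ => pderiv_pderiv_eq_zero_of_notMem_tsupport hx j j

theorem continuous_symmPart {v : E3 → ℂ} (hv : ContDiff ℝ 2 v) (ε ρ s : ℝ) (θ : E2) :
    Continuous (symmPart ε ρ s θ v) :=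
  (continuous_laplacian hv).add ((Complex.continuous_ofReal.comp
    ((contDiff_slope ε ρ s θ (n := 0)).continuous.pow 2)).mul hv.continuous)

theorem continuous_antisymmPart {v : E3 → ℂ} (hv : ContDiff ℝ 2 v) (ε ρ s : ℝ) (θ : E2) :
    Continuous (antisymmPart ε ρ s θ v) :=
  ((Complex.continuous_ofReal.comp (continuous_const.mul
    (contDiff_slope ε ρ s θ (n := 0)).continuous)).mul (contDiff_dirDeriv hv θ).continuous).sub
    (continuous_const.mul hv.continuous)

theorem dirDeriv_eq_zero_of_notMem_tsupport {v : E3 → ℂ} {x : E3} (hx : x ∉ tsupport v) (θ : E2) :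
    dirDeriv θ v x = 0 := by
  simp [dirDeriv, pderiv_eq_zero_of_notMem_tsupport hx]

theorem symmPart_eq_zero_of_notMem_tsupport {v : E3 → ℂ} (hv : ContDiff ℝ 2 v) {x : E3}
    (hx : x ∉ tsupport v) (ε ρ s : ℝ) (θ : E2) : symmPart ε ρ s θ v x = 0 := by
  simp [symmPart, laplacian_eq_zero_of_notMem_tsupport hv hx, image_eq_zero_of_notMem_tsupport hx]

theorem antisymmPart_eq_zero_of_notMem_tsupport {v : E3 → ℂ} {x : E3}
    (hx : x ∉ tsupport v) (ε ρ s : ℝ) (θ : E2) : antisymmPart ε ρ s θ v x = 0 := by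
  simp [antisymmPart, dirDeriv_eq_zero_of_notMem_tsupport hx, image_eq_zero_of_notMem_tsupport hx]

theorem integrable_fderiv_single {F : E3 → ℝ} (hF : ContDiff ℝ 1 F) (hc : HasCompactSupport F)
    (j : Fin 3) : Integrable fun x => fderiv ℝ F x (EuclideanSpace.single j 1) :=
  ((hF.continuous_fderiv (by simp)).clm_apply continuous_const).integrable_of_hasCompactSupport
    ((hc.fderiv ℝ).comp_left (g := fun L : E3 →L[ℝ] ℝ => L (EuclideanSpace.single j 1)) (by simp))

section Boundary

variable {ω : Set E2} {v : E3 → ℂ}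

theorem pderiv_eq_mul_normalDeriv (hω : IsC2Open ω) (hv : ContDiff ℝ 1 v)
    (h0 : ∀ x, transversal x ∈ frontier ω → v x = 0) {x : E3} (hx : transversal x ∈ frontier ω)
    (j : Fin 3) : pderiv j v x
      = ((cylPoint (outwardNormal ω (transversal x)) 0 j : ℝ) : ℂ) * normalDeriv ω v x := by
  rw [pderiv, fderiv_eq_inner_smul_normalDeriv hω hv h0 hx, real_inner_comm, inner_transversal,
    inner_single]

/-- The normal component of the Carleman field on the boundary. -/
theorem sum_carlemanField_mul_normal (hω : IsC2Open ω) (hv : ContDiff ℝ 1 v)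
    (h0 : ∀ x, transversal x ∈ frontier ω → v x = 0) {x : E3} (hx : transversal x ∈ frontier ω)
    (ε ρ s : ℝ) (θ : E2) :
    ∑ j, carlemanField ε ρ s θ v j x * cylPoint (outwardNormal ω (transversal x)) 0 j
      = 2 * slope ε ρ s θ x * ⟪θ, outwardNormal ω (transversal x)⟫ * ‖normalDeriv ω v x‖ ^ 2 := by
  have hν := sum_cylPoint_sq (norm_outwardNormal hω hx)
  have hin := inner_eq_sum_cylPoint θ (outwardNormal ω (transversal x))
  simp only [carlemanField, dirDeriv, pderiv_eq_mul_normalDeriv hω hv h0 hx, h0 x hx,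
    Fin.sum_univ_three, ← real_inner_self_eq_norm_sq, Complex.inner]
  rw [hin]
  simp only [Complex.mul_re, Complex.mul_im, Complex.add_re, Complex.add_im,
    Complex.conj_re, Complex.conj_im, Complex.ofReal_re, Complex.ofReal_im, Complex.zero_re,
    Complex.zero_im]
  set n := normalDeriv ω v x
  set ν := outwardNormal ω (transversal x)
  set a := slope ε ρ s θ x
  linear_combination (2 * a * (n.re ^ 2 + n.im ^ 2) * (cylPoint θ 0 0 * cylPoint ν 0 0
    + cylPoint θ 0 1 * cylPoint ν 0 1 + cylPoint θ 0 2 * cylPoint ν 0 2)) * hν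

/-- The Carleman inequality for the conjugated Laplacian, with the boundary integral taken with
respect to the comparison measure `μ`. -/
theorem carleman_inequality (hω : IsC2Open ω) {K : ℝ≥0} {μ : Measure E3}
    (hμ : IsLateralBoundaryMeasure ω K μ) (hv : ContDiff ℝ 2 v) (hc : HasCompactSupport v)
    (h0 : ∀ x, transversal x ∈ frontier ω → v x = 0) (ε ρ : ℝ) {s : ℝ} (hs : 0 ≤ s) {θ : E2}
    (hθ : ‖θ‖ = 1) :
    (∫ x in cylinder ω, ‖symmPart ε ρ s θ v x‖ ^ 2)
      + 4 * s * (∫ x in cylinder ω, slope ε ρ s θ x ^ 2 * ‖v x‖ ^ 2)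
      + ∫ x, 2 * slope ε ρ s θ x * ⟪θ, outwardNormal ω (transversal x)⟫
          * ‖normalDeriv ω v x‖ ^ 2 ∂μ
      ≤ ∫ x in cylinder ω, ‖symmPart ε ρ s θ v x + antisymmPart ε ρ s θ v x‖ ^ 2 := by
  have hF := contDiff_carlemanField hv ε ρ s θ
  have hFc : ∀ j, HasCompactSupport (carlemanField ε ρ s θ v j) := fun j =>
    HasCompactSupport.intro hc fun x hx => by
      simp [carlemanField, pderiv_eq_zero_of_notMem_tsupport hx,
        image_eq_zero_of_notMem_tsupport hx]
  have hdiv := hμ.setIntegral_divergence hω hF hFc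
  have hbd : ∫ x, ∑ j, carlemanField ε ρ s θ v j x
        * cylPoint (outwardNormal ω (transversal x)) 0 j ∂μ
      = ∫ x, 2 * slope ε ρ s θ x * ⟪θ, outwardNormal ω (transversal x)⟫
          * ‖normalDeriv ω v x‖ ^ 2 ∂μ := by
    refine integral_congr_ae ?_
    filter_upwards [(absolutelyContinuous_of_le_nnreal_smul hμ.le).ae_le
      (ae_transversal_mem_frontier ω)] with x hx
    exact sum_carlemanField_mul_normal hω (hv.of_le (by norm_num)) h0 hx ε ρ s θ
  rw [hbd] at hdiv
  have hi1 : IntegrableOn (fun x => ‖symmPart ε ρ s θ v x‖ ^ 2) (cylinder ω) :=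
    (integrable_of_tsupport hc ((continuous_symmPart hv ε ρ s θ).norm.pow 2) fun x hx => by
      simp [symmPart_eq_zero_of_notMem_tsupport hv hx]).integrableOn
  have hi2 : IntegrableOn (fun x => slope ε ρ s θ x ^ 2 * ‖v x‖ ^ 2) (cylinder ω) :=
    (integrable_of_tsupport hc (((contDiff_slope ε ρ s θ (n := 0)).continuous.pow 2).mul
      (hv.continuous.norm.pow 2)) fun x hx => by
      simp [image_eq_zero_of_notMem_tsupport hx]).integrableOn
  have hi3 : IntegrableOn (fun x => ∑ j, fderiv ℝ (carlemanField ε ρ s θ v j) x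
      (EuclideanSpace.single j 1)) (cylinder ω) :=
    (integrable_finsetSum _ fun j _ => integrable_fderiv_single (hF j) (hFc j) j).integrableOn
  have hi4 : IntegrableOn (fun x => ‖symmPart ε ρ s θ v x + antisymmPart ε ρ s θ v x‖ ^ 2)
      (cylinder ω) :=
    (integrable_of_tsupport hc (((continuous_symmPart hv ε ρ s θ).add
      (continuous_antisymmPart hv ε ρ s θ)).norm.pow 2) fun x hx => by
      simp [symmPart_eq_zero_of_notMem_tsupport hv hx,
        antisymmPart_eq_zero_of_notMem_tsupport hx]).integrableOn
  have hi12 : IntegrableOn (fun x => ‖symmPart ε ρ s θ v x‖ ^ 2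
      + 4 * s * (slope ε ρ s θ x ^ 2 * ‖v x‖ ^ 2)) (cylinder ω) := hi1.add (hi2.const_mul _)
  rw [← hdiv, ← integral_const_mul, ← integral_add hi1 (hi2.const_mul _), ← integral_add hi12 hi3]
  refine integral_mono (hi12.add hi3) hi4 fun x => ?_
  have hcross := two_inner_symmPart_antisymmPart hv ε ρ s hθ x
  rw [norm_add_sq_real]
  have h1 : 0 ≤ 4 * s * ‖dirDeriv θ v x‖ ^ 2 := by positivity
  have h2 : 0 ≤ ‖antisymmPart ε ρ s θ v x‖ ^ 2 := by positivity
  linarith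

/-- Multiplication of the symmetric part by `v` and integration by parts. -/
theorem setIntegral_sum_pderiv_sq (hω : IsC2Open ω) {K : ℝ≥0} {μ : Measure E3}
    (hμ : IsLateralBoundaryMeasure ω K μ) (hv : ContDiff ℝ 2 v) (hc : HasCompactSupport v)
    (h0 : ∀ x, transversal x ∈ frontier ω → v x = 0) (ε ρ s : ℝ) (θ : E2) :
    ∫ x in cylinder ω, ∑ j, ‖pderiv j v x‖ ^ 2
      = ∫ x in cylinder ω, (slope ε ρ s θ x ^ 2 * ‖v x‖ ^ 2 - ⟪symmPart ε ρ s θ v x, v x⟫) := by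
  have hv1 : ContDiff ℝ 1 v := hv.of_le (by norm_num)
  have hD : ∀ j, ContDiff ℝ 1 (pderiv j v) := contDiff_pderiv hv (by norm_num)
  have hF : ∀ j, ContDiff ℝ 1 fun x => ⟪v x, pderiv j v x⟫ := fun j => hv1.inner ℝ (hD j)
  have hFc : ∀ j, HasCompactSupport fun x => ⟪v x, pderiv j v x⟫ := fun j =>
    HasCompactSupport.intro hc fun x hx => by simp [image_eq_zero_of_notMem_tsupport hx]
  have hdiv := hμ.setIntegral_divergence hω hF hFc
  have hbd : ∫ x, ∑ j, ⟪v x, pderiv j v x⟫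
        * cylPoint (outwardNormal ω (transversal x)) 0 j ∂μ = 0 := by
    refine integral_eq_zero_of_ae ?_
    filter_upwards [(absolutelyContinuous_of_le_nnreal_smul hμ.le).ae_le
      (ae_transversal_mem_frontier ω)] with x hx
    simp [h0 x hx]
  rw [hbd] at hdiv
  have hi1 : IntegrableOn (fun x => ∑ j, ‖pderiv j v x‖ ^ 2) (cylinder ω) :=
    (integrable_of_tsupport hc (continuous_finsetSum _ fun j _ => (hD j).continuous.norm.pow 2)
      fun x hx => by simp [pderiv_eq_zero_of_notMem_tsupport hx]).integrableOn
  have hi3 : IntegrableOn (fun x => ∑ j, fderiv ℝ (fun x => ⟪v x, pderiv j v x⟫) x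
      (EuclideanSpace.single j 1)) (cylinder ω) :=
    (integrable_finsetSum _ fun j _ => integrable_fderiv_single (hF j) (hFc j) j).integrableOn
  rw [← sub_zero (∫ x in cylinder ω, ∑ j, ‖pderiv j v x‖ ^ 2), ← hdiv, ← integral_sub hi1 hi3]
  congr 1
  ext x
  have hd : ∀ j, fderiv ℝ (fun x => ⟪v x, pderiv j v x⟫) x (EuclideanSpace.single j 1)
      = ⟪v x, pderiv j (pderiv j v) x⟫ + ‖pderiv j v x‖ ^ 2 := by
    intro j
    rw [fderiv_inner_apply ℝ (hv1.differentiable (by simp) x) ((hD j).differentiable (by simp) x),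
      ← real_inner_self_eq_norm_sq]
    rfl
  simp only [hd, Finset.sum_add_distrib]
  rw [symmPart, laplacian_eq_sum hv, inner_add_left, sum_inner,
    ← real_inner_self_eq_norm_sq (v x)]
  have e : ⟪((slope ε ρ s θ x ^ 2 : ℝ) : ℂ) * v x, v x⟫ = slope ε ρ s θ x ^ 2 * ⟪v x, v x⟫ := by
    rw [← Complex.real_smul, real_inner_smul_left]
  rw [e]
  simp only [real_inner_comm (v x)]
  ring

end Boundary

/-! ### The boundary terms -/

section BoundaryTerms

variable {ω : Set E2} {v : E3 → ℂ}

theorem isClosed_lateralFace (hω : IsC2Open ω) (ε : ℝ) (θ : E2) :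
    IsClosed (lateralFace ω ε θ) := by
  have h : IsClosed (frontier ω ∩ (fun y => ε * ⟪θ, outwardNormal ω y⟫) ⁻¹' Set.Ici 0) :=
    (continuousOn_const.mul (continuousOn_const.inner
      (continuousOn_outwardNormal hω))).preimage_isClosed_of_isClosed isClosed_frontier isClosed_Ici
  exact h.preimage continuous_transversal

theorem aestronglyMeasurable_normalDeriv (hω : IsC2Open ω) (hv : ContDiff ℝ 1 v) :
    AEStronglyMeasurable (normalDeriv ω v) (lateralMeasure ω) := by
  have hcont : Continuous fun y : E2 => cylPoint y 0 :=
    cylEquiv.continuous.comp (continuous_id.prodMk continuous_const)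
  exact (isBoundedBilinearMap_apply (𝕜 := ℝ) (E := E3)
    (F := ℂ)).continuous.comp_aestronglyMeasurable
      ((hv.continuous_fderiv (by simp)).aestronglyMeasurable.prodMk
        (hcont.comp_aestronglyMeasurable (aestronglyMeasurable_outwardNormal_transversal hω)))

theorem integrable_normalDeriv_sq_mul_abs_inner (hω : IsC2Open ω) {μ : Measure E3}
    [IsFiniteMeasureOnCompacts μ] (hac : μ ≪ lateralMeasure ω) (hv : ContDiff ℝ 1 v)
    (hc : HasCompactSupport v) (θ : E2) :
    Integrable (fun x => ‖normalDeriv ω v x‖ ^ 2 * |⟪θ, outwardNormal ω (transversal x)⟫|) μ := by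
  have hν := (aestronglyMeasurable_outwardNormal_transversal hω).mono_ac hac
  have hdv : Continuous (fderiv ℝ v) := hv.continuous_fderiv (by simp)
  have hm := (aestronglyMeasurable_normalDeriv hω hv).mono_ac hac
  obtain ⟨C, hC⟩ := (hc.fderiv ℝ).exists_bound_of_continuous hdv
  refine integrable_of_bound_of_isCompact
    ((hm.norm.pow 2).mul
      (continuous_abs.comp_aestronglyMeasurable (aestronglyMeasurable_const.inner hν))) hc
    (fun x hx => ?_) (C := C ^ 2 * ‖θ‖) ?_
  · have : fderiv ℝ v x = 0 := image_eq_zero_of_notMem_tsupport fun h =>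
      hx (tsupport_fderiv_subset ℝ h)
    simp [normalDeriv, this]
  · filter_upwards [hac.ae_le (ae_transversal_mem_frontier ω)] with x hx
    have hn := norm_outwardNormal hω hx
    have h1 : ‖cylPoint (outwardNormal ω (transversal x)) 0‖ = 1 := by
      rw [EuclideanSpace.norm_eq, Real.sqrt_eq_one]
      simpa [Fin.sum_univ_three] using sum_cylPoint_sq hn
    have h2 : ‖normalDeriv ω v x‖ ≤ C := by
      refine ((fderiv ℝ v x).le_opNorm _).trans ?_
      rw [h1, mul_one]; exact hC x
    have h3 : |⟪θ, outwardNormal ω (transversal x)⟫| ≤ ‖θ‖ := by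
      simpa [hn] using abs_real_inner_le_norm θ (outwardNormal ω (transversal x))
    rw [Real.norm_eq_abs, abs_mul, abs_abs, abs_of_nonneg (by positivity)]
    gcongr

theorem boundaryTerm_nonneg (ε : ℝ) (θ : E2) : 0 ≤ boundaryTerm ω ε θ v :=
  integral_nonneg fun _ => by positivity

/-- If the slope has sign `ε` and size between `ρ / 2` and `3 ρ / 2`, the boundary integral of the
Carleman identity controls the term on the face of sign `ε` up to the one on the opposite face. -/
theorem IsLateralBoundaryMeasure.mul_boundaryTerm_le (hω : IsC2Open ω) {K : ℝ≥0} {μ : Measure E3}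
    (hμ : IsLateralBoundaryMeasure ω K μ) (hv : ContDiff ℝ 1 v) (hc : HasCompactSupport v)
    {ε ρ s : ℝ} {θ : E2} (hε : ε = 1 ∨ ε = -1) (hρ : 0 ≤ ρ)
    (hslope : ∀ x, transversal x ∈ frontier ω →
      ρ / 2 ≤ ε * slope ε ρ s θ x ∧ ε * slope ε ρ s θ x ≤ 3 * ρ / 2) :
    0 ≤ (∫ x, 2 * slope ε ρ s θ x * ⟪θ, outwardNormal ω (transversal x)⟫
          * ‖normalDeriv ω v x‖ ^ 2 ∂μ) + 3 * ρ * K * boundaryTerm ω (-ε) θ v ∧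
    ρ * boundaryTerm ω ε θ v ≤
      K * ((∫ x, 2 * slope ε ρ s θ x * ⟪θ, outwardNormal ω (transversal x)⟫
          * ‖normalDeriv ω v x‖ ^ 2 ∂μ) + 3 * ρ * K * boundaryTerm ω (-ε) θ v) := by
  have hfin := hμ.finiteOnCompacts
  have hfin' := hμ.finiteOnCompacts_lateral
  have hac : μ ≪ lateralMeasure ω := absolutelyContinuous_of_le_nnreal_smul hμ.le
  set G : E3 → ℝ := fun x => ‖normalDeriv ω v x‖ ^ 2 * |⟪θ, outwardNormal ω (transversal x)⟫|
    with hG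
  have hG0 : ∀ x, 0 ≤ G x := fun x => by positivity
  have hi := integrable_normalDeriv_sq_mul_abs_inner hω hac hv hc θ
  have hi' := integrable_normalDeriv_sq_mul_abs_inner hω
    (Measure.AbsolutelyContinuous.refl (lateralMeasure ω)) hv hc θ
  have hm : ∀ ε, MeasurableSet (lateralFace ω ε θ) := fun ε =>
    (isClosed_lateralFace hω ε θ).measurableSet
  have hp : boundaryTerm ω ε θ v ≤ K * ∫ x in lateralFace ω ε θ, G x ∂μ := by
    have := integral_mono_measure (Measure.restrict_mono (le_refl (lateralFace ω ε θ)) hμ.ge)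
      (Eventually.of_forall hG0)
      (by rw [Measure.restrict_smul]; exact hi.restrict.smul_measure_nnreal)
    rwa [Measure.restrict_smul, integral_smul_nnreal_measure, NNReal.smul_def, smul_eq_mul] at this
  have hq : ∫ x in lateralFace ω (-ε) θ, G x ∂μ ≤ K * boundaryTerm ω (-ε) θ v := by
    have := integral_mono_measure (Measure.restrict_mono (le_refl (lateralFace ω (-ε) θ)) hμ.le)
      (Eventually.of_forall hG0)
      (by rw [Measure.restrict_smul]; exact hi'.restrict.smul_measure_nnreal)
    rwa [Measure.restrict_smul, integral_smul_nnreal_measure, NNReal.smul_def, smul_eq_mul] at this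
  have hpw : ∀ x, transversal x ∈ frontier ω →
      ρ * (lateralFace ω ε θ).indicator G x - 3 * ρ * (lateralFace ω (-ε) θ).indicator G x
        ≤ 2 * slope ε ρ s θ x * ⟪θ, outwardNormal ω (transversal x)⟫
          * ‖normalDeriv ω v x‖ ^ 2 := by
    intro x hx
    obtain ⟨h1, h2⟩ := hslope x hx
    set t := ⟪θ, outwardNormal ω (transversal x)⟫ with ht
    set n := ‖normalDeriv ω v x‖ ^ 2 with hn
    have hn0 : 0 ≤ n := by positivity
    have hε2 : ε * ε = 1 := by rcases hε with rfl | rfl <;> norm_num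
    have habs : |t| = |ε * t| := by rcases hε with rfl | rfl <;> simp
    have e : 2 * slope ε ρ s θ x * t * n = 2 * (ε * slope ε ρ s θ x) * (ε * t) * n := by
      linear_combination (-2 * slope ε ρ s θ x * t * n) * hε2
    have hGx : G x = n * |ε * t| := by rw [← habs]
    rw [e]
    rcases le_total 0 (ε * t) with h | h
    · have hmem : x ∈ lateralFace ω ε θ := ⟨hx, h⟩
      rw [Set.indicator_of_mem hmem]
      have h3 : 0 ≤ 3 * ρ * (lateralFace ω (-ε) θ).indicator G x :=
        mul_nonneg (by positivity) (Set.indicator_nonneg (fun _ _ => hG0 _) _)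
      have h4 : 0 ≤ (ε * t) * n := mul_nonneg h hn0
      rw [hGx, abs_of_nonneg h]
      nlinarith [mul_le_mul_of_nonneg_right h1 h4]
    · have hmem : x ∈ lateralFace ω (-ε) θ := ⟨hx, by rw [neg_mul]; linarith⟩
      rw [Set.indicator_of_mem hmem]
      have h4 : 0 ≤ -(ε * t) * n := mul_nonneg (by linarith) hn0
      have h5 : ρ * (lateralFace ω ε θ).indicator G x ≤ 0 := by
        by_cases hx' : x ∈ lateralFace ω ε θ
        · have : ε * t = 0 := le_antisymm h hx'.2
          rw [Set.indicator_of_mem hx', hGx, this]; simp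
        · rw [Set.indicator_of_notMem hx', mul_zero]
      rw [hGx, abs_of_nonpos h]
      nlinarith [mul_le_mul_of_nonneg_right h2 h4]
  have hB : ρ * (∫ x in lateralFace ω ε θ, G x ∂μ) - 3 * ρ * ∫ x in lateralFace ω (-ε) θ, G x ∂μ
      ≤ ∫ x, 2 * slope ε ρ s θ x * ⟪θ, outwardNormal ω (transversal x)⟫
          * ‖normalDeriv ω v x‖ ^ 2 ∂μ := by
    rw [← integral_indicator (hm _), ← integral_indicator (hm _), ← integral_const_mul,
      ← integral_const_mul, ← integral_sub ((hi.indicator (hm _)).const_mul _)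
        ((hi.indicator (hm _)).const_mul _)]
    refine integral_mono_ae (((hi.indicator (hm _)).const_mul _).sub
      ((hi.indicator (hm _)).const_mul _)) ?_ ?_
    · -- The integrand is the density `|∂_ν v|² |θ · ν|` times a bounded factor.
      have hν := (aestronglyMeasurable_outwardNormal_transversal hω).mono_ac hac
      have hmn := (aestronglyMeasurable_normalDeriv hω hv).mono_ac hac
      refine (hi.const_mul (3 * ρ)).mono' (((aestronglyMeasurable_const.mul
        (contDiff_slope ε ρ s θ (n := 0)).continuous.aestronglyMeasurable).mul
        (aestronglyMeasurable_const.inner hν)).mul (hmn.norm.pow 2)) ?_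
      filter_upwards [hac.ae_le (ae_transversal_mem_frontier ω)] with x hx
      obtain ⟨h1, h2⟩ := hslope x hx
      have h3 : |slope ε ρ s θ x| ≤ 3 * ρ / 2 := by
        have : |slope ε ρ s θ x| = |ε * slope ε ρ s θ x| := by
          rcases hε with rfl | rfl <;> simp
        rw [this, abs_of_nonneg (by linarith)]; exact h2
      rw [Real.norm_eq_abs, abs_mul, abs_mul, abs_mul, abs_two,
        abs_of_nonneg (sq_nonneg ‖normalDeriv ω v x‖)]
      have h4 : 0 ≤ |⟪θ, outwardNormal ω (transversal x)⟫| * ‖normalDeriv ω v x‖ ^ 2 := by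
        positivity
      nlinarith [mul_le_mul_of_nonneg_right h3 h4]
    · filter_upwards [hac.ae_le (ae_transversal_mem_frontier ω)] with x hx
      exact hpw x hx
  have hP0 : 0 ≤ ∫ x in lateralFace ω ε θ, G x ∂μ := integral_nonneg hG0
  have hlow : ρ * (∫ x in lateralFace ω ε θ, G x ∂μ)
      ≤ (∫ x, 2 * slope ε ρ s θ x * ⟪θ, outwardNormal ω (transversal x)⟫
          * ‖normalDeriv ω v x‖ ^ 2 ∂μ) + 3 * ρ * K * boundaryTerm ω (-ε) θ v := by
    nlinarith [mul_le_mul_of_nonneg_left hq (by positivity : 0 ≤ 3 * ρ)]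
  refine ⟨(mul_nonneg hρ hP0).trans hlow, ?_⟩
  calc ρ * boundaryTerm ω ε θ v ≤ ρ * (K * ∫ x in lateralFace ω ε θ, G x ∂μ) := by gcongr
    _ = K * (ρ * ∫ x in lateralFace ω ε θ, G x ∂μ) := by ring
    _ ≤ _ := by gcongr

end BoundaryTerms

/-! ### Lower-order terms and absorption -/

section LowerOrder

variable {ω : Set E2} {v : E3 → ℂ}

theorem abs_cylPoint_le {θ : E2} (hθ : ‖θ‖ = 1) (j : Fin 3) : |cylPoint θ 0 j| ≤ 1 := by
  have h := sum_cylPoint_sq hθ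
  rw [← sq_le_one_iff_abs_le_one]
  fin_cases j <;> simp only [Fin.zero_eta, Fin.mk_one, Fin.reduceFinMk] <;> nlinarith [
    sq_nonneg (cylPoint θ 0 0), sq_nonneg (cylPoint θ 0 1), sq_nonneg (cylPoint θ 0 2)]

/-- Pointwise bound for the terms of the conjugated operator that involve the coefficients. -/
theorem norm_sq_lowerOrder_le {M ρ a : ℝ} (hM : 0 ≤ M) (hρ : 1 ≤ ρ) (ha : |a| ≤ 3 * ρ / 2)
    {b : E3} (hb : ‖b‖ ≤ M) {c z : ℂ} (hc : ‖c‖ ≤ M) {n : Fin 3 → ℝ} (hn : ∀ j, |n j| ≤ 1)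
    (D : Fin 3 → ℂ) :
    ‖2 * Complex.I * ∑ j, (b j : ℂ) * ((a : ℂ) * (n j : ℝ) * z + D j) + c * z‖ ^ 2
      ≤ 200 * M ^ 2 * (ρ ^ 2 * ‖z‖ ^ 2 + ∑ j, ‖D j‖ ^ 2) := by
  have hz := norm_nonneg z
  have h1 : ∀ j, ‖(b j : ℂ) * ((a : ℂ) * (n j : ℝ) * z + D j)‖
      ≤ M * (3 * ρ / 2 * ‖z‖ + ‖D j‖) := by
    intro j
    have hbj : ‖(b j : ℂ)‖ ≤ M := by
      rw [Complex.norm_real]; exact (PiLp.norm_apply_le b j).trans hb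
    rw [norm_mul]
    refine mul_le_mul hbj ?_ (norm_nonneg _) hM
    refine (norm_add_le _ _).trans (add_le_add_left ?_ _)
    rw [norm_mul, norm_mul, Complex.norm_real, Complex.norm_real, Real.norm_eq_abs,
      Real.norm_eq_abs]
    refine mul_le_mul_of_nonneg_right ?_ hz
    calc |a| * |n j| ≤ |a| * 1 := by gcongr; exact hn j
      _ ≤ _ := by rwa [mul_one]
  have h2 : ‖2 * Complex.I * ∑ j, (b j : ℂ) * ((a : ℂ) * (n j : ℝ) * z + D j) + c * z‖
      ≤ M * (10 * (ρ * ‖z‖) + 2 * (‖D 0‖ + ‖D 1‖ + ‖D 2‖)) := by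
    have h3 : ‖∑ j, (b j : ℂ) * ((a : ℂ) * (n j : ℝ) * z + D j)‖
        ≤ M * (3 * ρ / 2 * ‖z‖ + ‖D 0‖) + M * (3 * ρ / 2 * ‖z‖ + ‖D 1‖)
          + M * (3 * ρ / 2 * ‖z‖ + ‖D 2‖) := by
      refine (norm_sum_le _ _).trans ?_
      rw [Fin.sum_univ_three]
      exact add_le_add (add_le_add (h1 0) (h1 1)) (h1 2)
    have h4 : ‖c * z‖ ≤ M * ‖z‖ := by rw [norm_mul]; gcongr
    refine (norm_add_le _ _).trans ?_
    have h5 : ‖2 * Complex.I * ∑ j, (b j : ℂ) * ((a : ℂ) * (n j : ℝ) * z + D j)‖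
        = 2 * ‖∑ j, (b j : ℂ) * ((a : ℂ) * (n j : ℝ) * z + D j)‖ := by
      rw [norm_mul, norm_mul]; simp
    rw [h5]
    have h6 : M * ‖z‖ ≤ M * (ρ * ‖z‖) := by
      refine mul_le_mul_of_nonneg_left ?_ hM
      nlinarith
    nlinarith
  rw [Fin.sum_univ_three (f := fun j => ‖D j‖ ^ 2)]
  refine (pow_le_pow_left₀ (norm_nonneg _) h2 2).trans ?_
  rw [mul_pow, mul_comm (200 : ℝ), mul_assoc]
  refine mul_le_mul_of_nonneg_left ?_ (sq_nonneg M)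
  nlinarith [sq_nonneg (10 * (ρ * ‖z‖) - 2 * (‖D 0‖ + ‖D 1‖ + ‖D 2‖)), sq_nonneg (‖D 0‖ - ‖D 1‖),
    sq_nonneg (‖D 0‖ - ‖D 2‖), sq_nonneg (‖D 1‖ - ‖D 2‖), sq_nonneg ‖D 0‖, sq_nonneg ‖D 1‖,
    sq_nonneg ‖D 2‖]

/-- The first- and zeroth-order coefficients change the square norm of the conjugated Laplacian by
terms controlled by `‖∇v‖² + ρ² ‖v‖²`. -/
theorem setIntegral_symmPart_add_antisymmPart_le (hω : IsOpen ω) {A : E3 → E3} {q : E3 → ℂ}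
    {M : ℝ≥0} (hA : MemLp A ∞ (volume.restrict (cylinder ω)))
    (hq : MemLp q ∞ (volume.restrict (cylinder ω)))
    (hM : eLpNorm q ∞ (volume.restrict (cylinder ω))
      + eLpNorm A ∞ (volume.restrict (cylinder ω)) ≤ M)
    (hv : ContDiff ℝ 2 v) (hc : HasCompactSupport v) {ε ρ s : ℝ} {θ : E2} (hθ : ‖θ‖ = 1)
    (hρ : 1 ≤ ρ) (hslope : ∀ x ∈ cylinder ω, |slope ε ρ s θ x| ≤ 3 * ρ / 2) :
    ∫ x in cylinder ω, ‖symmPart ε ρ s θ v x + antisymmPart ε ρ s θ v x‖ ^ 2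
      ≤ 2 * (∫ x in cylinder ω, ‖carlemanOp A q ε ρ s θ v x‖ ^ 2)
        + 400 * M ^ 2 * ((∫ x in cylinder ω, ∑ j, ‖pderiv j v x‖ ^ 2)
          + ρ ^ 2 * ∫ x in cylinder ω, ‖v x‖ ^ 2) := by
  have hD : ∀ j, ContDiff ℝ 1 (pderiv j v) := contDiff_pderiv hv (by norm_num)
  have hi1 : IntegrableOn (fun x => ∑ j, ‖pderiv j v x‖ ^ 2) (cylinder ω) :=
    (integrable_of_tsupport hc (continuous_finsetSum _ fun j _ => (hD j).continuous.norm.pow 2)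
      fun x hx => by simp [pderiv_eq_zero_of_notMem_tsupport hx]).integrableOn
  have hi2 : IntegrableOn (fun x => ‖v x‖ ^ 2) (cylinder ω) :=
    (integrable_of_tsupport hc (hv.continuous.norm.pow 2) fun x hx => by
      simp [image_eq_zero_of_notMem_tsupport hx]).integrableOn
  have hi3 : IntegrableOn (fun x => ‖symmPart ε ρ s θ v x + antisymmPart ε ρ s θ v x‖ ^ 2)
      (cylinder ω) :=
    (integrable_of_tsupport hc (((continuous_symmPart hv ε ρ s θ).add
      (continuous_antisymmPart hv ε ρ s θ)).norm.pow 2) fun x hx => by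
      simp [symmPart_eq_zero_of_notMem_tsupport hv hx,
        antisymmPart_eq_zero_of_notMem_tsupport hx]).integrableOn
  have hi12 : IntegrableOn (fun x => ∑ j, ‖pderiv j v x‖ ^ 2 + ρ ^ 2 * ‖v x‖ ^ 2) (cylinder ω) :=
    hi1.add (hi2.const_mul _)
  have hAae : ∀ᵐ x ∂(volume.restrict (cylinder ω)), ‖A x‖ ≤ M := by
    have h := (le_add_self.trans hM :
      eLpNorm A ∞ (volume.restrict (cylinder ω)) ≤ M)
    rw [eLpNorm_exponent_top] at h
    filter_upwards [ae_le_eLpNormEssSup (f := A) (μ := volume.restrict (cylinder ω))] with x hx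
    exact_mod_cast (enorm_le_coe.1 (hx.trans h) : ‖A x‖₊ ≤ M)
  have hqae : ∀ᵐ x ∂(volume.restrict (cylinder ω)), ‖q x‖ ≤ M := by
    have h := (le_self_add.trans hM :
      eLpNorm q ∞ (volume.restrict (cylinder ω)) ≤ M)
    rw [eLpNorm_exponent_top] at h
    filter_upwards [ae_le_eLpNormEssSup (f := q) (μ := volume.restrict (cylinder ω))] with x hx
    exact_mod_cast (enorm_le_coe.1 (hx.trans h) : ‖q x‖₊ ≤ M)
  set r : E3 → ℂ := fun x => 2 * Complex.I * ∑ j, (A x j : ℂ) *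
    ((slope ε ρ s θ x : ℂ) * (cylPoint θ 0 j : ℝ) * v x + pderiv j v x) + q x * v x with hr
  have heq : ∀ x, carlemanOp A q ε ρ s θ v x
      = symmPart ε ρ s θ v x + antisymmPart ε ρ s θ v x + r x := carlemanOp_eq hθ hv
  have hrae : ∀ᵐ x ∂(volume.restrict (cylinder ω)),
      ‖r x‖ ^ 2 ≤ 200 * M ^ 2 * (∑ j, ‖pderiv j v x‖ ^ 2 + ρ ^ 2 * ‖v x‖ ^ 2) := by
    filter_upwards [hAae, hqae, ae_restrict_mem (isOpen_cylinder hω).measurableSet]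
      with x hAx hqx hx
    rw [add_comm (∑ j, _)]
    exact norm_sq_lowerOrder_le M.2 hρ (hslope x hx) hAx hqx (abs_cylPoint_le hθ) _
  have hrm : AEStronglyMeasurable r (volume.restrict (cylinder ω)) := by
    refine (aestronglyMeasurable_const.mul (Finset.aestronglyMeasurable_fun_sum _ fun j _ =>
      (Continuous.comp_aestronglyMeasurable (g := fun y : E3 => ((y j : ℝ) : ℂ)) (by fun_prop)
        hA.1).mul (Continuous.aestronglyMeasurable ?_))).add
        (hq.1.mul hv.continuous.aestronglyMeasurable)
    exact (((Complex.continuous_ofReal.comp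
      (contDiff_slope ε ρ s θ (n := 0)).continuous).mul continuous_const).mul hv.continuous).add
      (hD j).continuous
  have hi4 : IntegrableOn (fun x => ‖carlemanOp A q ε ρ s θ v x‖ ^ 2) (cylinder ω) := by
    simp only [heq]
    refine ((hi3.const_mul 2).add (hi12.const_mul (2 * (200 * M ^ 2)))).mono'
      (((((continuous_symmPart hv ε ρ s θ).add
        (continuous_antisymmPart hv ε ρ s θ)).aestronglyMeasurable.add hrm).norm).pow 2) ?_
    filter_upwards [hrae] with x hx
    rw [Real.norm_eq_abs, abs_of_nonneg (by positivity), Pi.add_apply]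
    have h1 := norm_add_le (symmPart ε ρ s θ v x + antisymmPart ε ρ s θ v x) (r x)
    have h2 := pow_le_pow_left₀ (norm_nonneg _) h1 2
    nlinarith [sq_nonneg (‖symmPart ε ρ s θ v x + antisymmPart ε ρ s θ v x‖ - ‖r x‖)]
  rw [← integral_const_mul (ρ ^ 2), ← integral_add hi1 (hi2.const_mul _), ← integral_const_mul,
    ← integral_const_mul, ← integral_add (hi4.const_mul _) (hi12.const_mul _)]
  refine integral_mono_ae hi3 ((hi4.const_mul _).add (hi12.const_mul _)) ?_
  filter_upwards [hrae] with x hx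
  have h1 : ‖symmPart ε ρ s θ v x + antisymmPart ε ρ s θ v x‖
      ≤ ‖carlemanOp A q ε ρ s θ v x‖ + ‖r x‖ := by
    rw [heq]; simpa using norm_sub_le
      (symmPart ε ρ s θ v x + antisymmPart ε ρ s θ v x + r x) (r x)
  have h2 := pow_le_pow_left₀ (norm_nonneg _) h1 2
  nlinarith [sq_nonneg (‖carlemanOp A q ε ρ s θ v x‖ - ‖r x‖)]

/-- The gradient is controlled by `v` and the symmetric part. -/
theorem mul_setIntegral_sum_pderiv_sq_le (hω : IsC2Open ω) {K : ℝ≥0} {μ : Measure E3}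
    (hμ : IsLateralBoundaryMeasure ω K μ) (hv : ContDiff ℝ 2 v) (hc : HasCompactSupport v)
    (h0 : ∀ x, transversal x ∈ frontier ω → v x = 0) {ε ρ s : ℝ} {θ : E2} (hs : 0 ≤ s)
    (hslope : ∀ x ∈ cylinder ω, |slope ε ρ s θ x| ≤ 3 * ρ / 2) :
    s * (∫ x in cylinder ω, ∑ j, ‖pderiv j v x‖ ^ 2)
      ≤ (9 / 4 * s * ρ ^ 2 + s ^ 2 / 2) * (∫ x in cylinder ω, ‖v x‖ ^ 2)
        + 1 / 2 * ∫ x in cylinder ω, ‖symmPart ε ρ s θ v x‖ ^ 2 := by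
  have hS := continuous_symmPart hv ε ρ s θ
  have hi1 : IntegrableOn (fun x => slope ε ρ s θ x ^ 2 * ‖v x‖ ^ 2
      - ⟪symmPart ε ρ s θ v x, v x⟫) (cylinder ω) :=
    (integrable_of_tsupport hc ((((contDiff_slope ε ρ s θ (n := 0)).continuous.pow 2).mul
      (hv.continuous.norm.pow 2)).sub (hS.inner hv.continuous)) fun x hx => by
      simp [image_eq_zero_of_notMem_tsupport hx]).integrableOn
  have hi2 : IntegrableOn (fun x => ‖v x‖ ^ 2) (cylinder ω) :=
    (integrable_of_tsupport hc (hv.continuous.norm.pow 2) fun x hx => by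
      simp [image_eq_zero_of_notMem_tsupport hx]).integrableOn
  have hi3 : IntegrableOn (fun x => ‖symmPart ε ρ s θ v x‖ ^ 2) (cylinder ω) :=
    (integrable_of_tsupport hc (hS.norm.pow 2) fun x hx => by
      simp [symmPart_eq_zero_of_notMem_tsupport hv hx]).integrableOn
  rw [setIntegral_sum_pderiv_sq hω hμ hv hc h0 ε ρ s θ, ← integral_const_mul,
    ← integral_const_mul, ← integral_const_mul, ← integral_add (hi2.const_mul _) (hi3.const_mul _)]
  refine setIntegral_mono_on (hi1.const_mul _) ((hi2.const_mul _).add (hi3.const_mul _))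
    (isOpen_cylinder hω.isOpen).measurableSet fun x hx => ?_
  have h1 : slope ε ρ s θ x ^ 2 ≤ (3 * ρ / 2) ^ 2 :=
    sq_le_sq.2 ((hslope x hx).trans (le_abs_self _))
  have h2 := neg_abs_le ⟪symmPart ε ρ s θ v x, v x⟫
  have h3 := abs_real_inner_le_norm (symmPart ε ρ s θ v x) (v x)
  have h4 : s * -⟪symmPart ε ρ s θ v x, v x⟫ ≤ s * (‖symmPart ε ρ s θ v x‖ * ‖v x‖) := by
    gcongr; linarith
  nlinarith [sq_nonneg (‖symmPart ε ρ s θ v x‖ - s * ‖v x‖),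
    mul_le_mul_of_nonneg_left (mul_le_mul_of_nonneg_right h1 (sq_nonneg ‖v x‖)) hs]

/-- The Laplacian is controlled by `v` and the symmetric part, as `Δ v = S v - a² v`. -/
theorem setIntegral_laplacian_sq_le (hω : IsOpen ω) (hv : ContDiff ℝ 2 v)
    (hc : HasCompactSupport v) {ε ρ s : ℝ} {θ : E2}
    (hslope : ∀ x ∈ cylinder ω, |slope ε ρ s θ x| ≤ 3 * ρ / 2) :
    ∫ x in cylinder ω, ‖Δ v x‖ ^ 2
      ≤ 2 * (∫ x in cylinder ω, ‖symmPart ε ρ s θ v x‖ ^ 2)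
        + 81 / 8 * ρ ^ 4 * ∫ x in cylinder ω, ‖v x‖ ^ 2 := by
  have hi1 : IntegrableOn (fun x => ‖Δ v x‖ ^ 2) (cylinder ω) :=
    (integrable_of_tsupport hc ((continuous_laplacian hv).norm.pow 2) fun x hx => by
      simp [laplacian_eq_zero_of_notMem_tsupport hv hx]).integrableOn
  have hi2 : IntegrableOn (fun x => ‖v x‖ ^ 2) (cylinder ω) :=
    (integrable_of_tsupport hc (hv.continuous.norm.pow 2) fun x hx => by
      simp [image_eq_zero_of_notMem_tsupport hx]).integrableOn
  have hi3 : IntegrableOn (fun x => ‖symmPart ε ρ s θ v x‖ ^ 2) (cylinder ω) :=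
    (integrable_of_tsupport hc ((continuous_symmPart hv ε ρ s θ).norm.pow 2) fun x hx => by
      simp [symmPart_eq_zero_of_notMem_tsupport hv hx]).integrableOn
  rw [← integral_const_mul, ← integral_const_mul,
    ← integral_add (hi3.const_mul _) (hi2.const_mul _)]
  refine setIntegral_mono_on hi1 ((hi3.const_mul _).add (hi2.const_mul _))
    (isOpen_cylinder hω).measurableSet fun x hx => ?_
  have h1 : slope ε ρ s θ x ^ 2 ≤ (3 * ρ / 2) ^ 2 :=
    sq_le_sq.2 ((hslope x hx).trans (le_abs_self _))
  have h2 : Δ v x = symmPart ε ρ s θ v x - ((slope ε ρ s θ x ^ 2 : ℝ) : ℂ) * v x := by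
    simp [symmPart]
  have h3 : ‖Δ v x‖ ≤ ‖symmPart ε ρ s θ v x‖ + (3 * ρ / 2) ^ 2 * ‖v x‖ := by
    rw [h2]
    refine (norm_sub_le _ _).trans (add_le_add_right ?_ _)
    rw [norm_mul, Complex.norm_real, Real.norm_eq_abs, abs_of_nonneg (sq_nonneg _)]
    gcongr
  have h4 := pow_le_pow_left₀ (norm_nonneg _) h3 2
  nlinarith [sq_nonneg (‖symmPart ε ρ s θ v x‖ - (3 * ρ / 2) ^ 2 * ‖v x‖)]

theorem mul_setIntegral_norm_sq_le (hω : IsOpen ω) (hv : ContDiff ℝ 2 v)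
    (hc : HasCompactSupport v) {ε ρ s : ℝ} {θ : E2} (hρ : 0 ≤ ρ)
    (hslope : ∀ x ∈ cylinder ω, ρ / 2 ≤ |slope ε ρ s θ x|) :
    ρ ^ 2 * (∫ x in cylinder ω, ‖v x‖ ^ 2)
      ≤ 4 * ∫ x in cylinder ω, slope ε ρ s θ x ^ 2 * ‖v x‖ ^ 2 := by
  have hi1 : IntegrableOn (fun x => slope ε ρ s θ x ^ 2 * ‖v x‖ ^ 2) (cylinder ω) :=
    (integrable_of_tsupport hc (((contDiff_slope ε ρ s θ (n := 0)).continuous.pow 2).mul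
      (hv.continuous.norm.pow 2)) fun x hx => by
      simp [image_eq_zero_of_notMem_tsupport hx]).integrableOn
  have hi2 : IntegrableOn (fun x => ‖v x‖ ^ 2) (cylinder ω) :=
    (integrable_of_tsupport hc (hv.continuous.norm.pow 2) fun x hx => by
      simp [image_eq_zero_of_notMem_tsupport hx]).integrableOn
  rw [← integral_const_mul, ← integral_const_mul]
  refine setIntegral_mono_on (hi2.const_mul _) (hi1.const_mul _)
    (isOpen_cylinder hω).measurableSet fun x hx => ?_
  have h1 : (ρ / 2) ^ 2 ≤ slope ε ρ s θ x ^ 2 :=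
    sq_le_sq.2 (by rw [abs_of_nonneg (by positivity)]; exact hslope x hx)
  nlinarith [mul_le_mul_of_nonneg_right h1 (sq_nonneg ‖v x‖)]

end LowerOrder

/-- The absorption of the lower-order terms for large `s`. Here `N`, `V`, `W`, `L`, `Q`, `P` are the
square norms of the symmetric part, of `v`, of its gradient, of its Laplacian, of the conjugated
Laplacian of `v` and of the full conjugated operator; `T` is a nonnegative boundary quantity. -/
theorem carleman_absorption {K M ρ s N V W L Q P T b b' : ℝ} (hK : 0 ≤ K) (hs : 1 ≤ s)
    (hsM : 3200 * M ^ 2 ≤ s) (hsρ : s ≤ ρ) (hN : 0 ≤ N) (hV : 0 ≤ V) (hP : 0 ≤ P)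
    (hT : 0 ≤ T) (hb' : 0 ≤ b')
    (hcarl : N + s * ρ ^ 2 * V + T ≤ Q + 3 * ρ * K * b') (hb : ρ * b ≤ K * T)
    (hQ : Q ≤ 2 * P + 400 * M ^ 2 * (W + ρ ^ 2 * V))
    (hW : s * W ≤ (9 / 4 * s * ρ ^ 2 + s ^ 2 / 2) * V + 1 / 2 * N)
    (hL : L ≤ 2 * N + 81 / 8 * ρ ^ 4 * V) :
    ρ * b + s * (ρ ^ 2)⁻¹ * L + s * W + s * ρ ^ 2 * V
      ≤ (3 * K ^ 2 + 92 * K + 60) * (P + ρ * b') := by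
  have hρ : 1 ≤ ρ := hs.trans hsρ
  have hρ2 : s ≤ ρ ^ 2 := by nlinarith
  set X := N + s * ρ ^ 2 * V with hX
  have hsV : s ^ 2 * V ≤ s * ρ ^ 2 * V := by
    rw [sq, mul_assoc, mul_assoc]
    exact mul_le_mul_of_nonneg_left (mul_le_mul_of_nonneg_right hρ2 hV) (by linarith)
  have hρV : 0 ≤ s * ρ ^ 2 * V := by positivity
  have hW3 : s * W ≤ 3 * X := by nlinarith
  have hQX : Q ≤ 2 * P + X / 2 := by
    have h1 : s * (W + ρ ^ 2 * V) ≤ 4 * X := by nlinarith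
    have h2 : 400 * M ^ 2 * (W + ρ ^ 2 * V) ≤ X / 2 := by
      have hX0 : 0 ≤ X := by positivity
      rcases le_total 0 (W + ρ ^ 2 * V) with h | h
      · nlinarith [mul_le_mul_of_nonneg_right hsM h]
      · nlinarith [mul_nonneg (sq_nonneg M) (neg_nonneg.2 h)]
    linarith
  have hL11 : s * (ρ ^ 2)⁻¹ * L ≤ 11 * X := by
    have hρ0 : (0 : ℝ) < ρ ^ 2 := by positivity
    have h1 : s * L ≤ 11 * X * ρ ^ 2 := by
      have h2 : s * N ≤ ρ ^ 2 * N := mul_le_mul_of_nonneg_right hρ2 hN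
      have h3 : s * L ≤ s * (2 * N + 81 / 8 * ρ ^ 4 * V) :=
        mul_le_mul_of_nonneg_left hL (by linarith)
      have h4 : 0 ≤ ρ ^ 2 * N := by positivity
      have h5 : 0 ≤ s * ρ ^ 4 * V := by positivity
      rw [hX]
      linarith
    calc s * (ρ ^ 2)⁻¹ * L = (s * L) / ρ ^ 2 := by field_simp
      _ ≤ 11 * X := by rwa [div_le_iff₀ hρ0]
  have hX0 : 0 ≤ X := by positivity
  have hρb : 0 ≤ ρ * b' := by positivity
  have hXP : X ≤ 4 * P + 6 * K * (ρ * b') := by nlinarith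
  have hTP : T ≤ 2 * P + 3 * K * (ρ * b') := by nlinarith
  have hKT := mul_le_mul_of_nonneg_left hTP hK
  have h1 : 0 ≤ K * P := by positivity
  have h2 : 0 ≤ K ^ 2 * P := by positivity
  have h3 : 0 ≤ K * (ρ * b') := by positivity
  linarith

end Waveguide

open Waveguide in
theorem proposition2p1
    (ω : Set E2) (hω : IsC2Open ω) (hωb : Bornology.IsBounded ω) (M : ℝ≥0) :
    ∃ C : ℝ, 0 < C ∧
      ∀ (A : E3 → E3) (q : E3 → ℂ),
        MemLp A ∞ (volume.restrict (cylinder ω)) →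
        MemLp q ∞ (volume.restrict (cylinder ω)) →
        eLpNorm q ∞ (volume.restrict (cylinder ω)) +
            eLpNorm A ∞ (volume.restrict (cylinder ω)) ≤ M →
        ∃ s₁ : ℝ, 1 < s₁ ∧ ∃ ρ₁ : ℝ → ℝ, (∀ s, s₁ < s → s < ρ₁ s) ∧
          ∀ (θ : E2) (ε : ℝ) (v : E3 → ℂ), ‖θ‖ = 1 → (ε = 1 ∨ ε = -1) →
            ContDiff ℝ 2 v → HasCompactSupport v → MemH10 (cylinder ω) v →
            ∀ s ρ : ℝ, s₁ < s → ρ₁ s ≤ ρ →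
              ρ * boundaryTerm ω ε θ v
                + s * (ρ ^ 2)⁻¹ * (∫ x in cylinder ω, ‖Δ v x‖ ^ 2)
                + s * (∫ x in cylinder ω, ∑ j : Fin 3, ‖pderiv j v x‖ ^ 2)
                + s * ρ ^ 2 * (∫ x in cylinder ω, ‖v x‖ ^ 2)
              ≤ C * ((∫ x in cylinder ω, ‖carlemanOp A q ε ρ s θ v x‖ ^ 2)
                + ρ * boundaryTerm ω (-ε) θ v) := by
  obtain ⟨K, μ, hμ⟩ := exists_isLateralBoundaryMeasure hω hωb
  obtain ⟨R, hR0, hR⟩ := hωb.closure.exists_pos_norm_le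
  refine ⟨3 * (K : ℝ) ^ 2 + 92 * K + 60, by positivity, fun A q hA hq hAq =>
    ⟨3200 * (M : ℝ) ^ 2 + 2, by nlinarith [sq_nonneg (M : ℝ)], fun s => 2 * s * R + 2 * s,
      fun s hs => ?_, ?_⟩⟩
  · have hs0 : 0 < s := by nlinarith [sq_nonneg (M : ℝ)]
    nlinarith [mul_pos hs0 hR0]
  intro θ ε v hθ hε hv hc hv0 s ρ hs hρ
  have hs2 : 2 < s := by nlinarith [sq_nonneg (M : ℝ)]
  have hs0 : 0 ≤ s := by linarith
  have hsR : 0 ≤ s * R := by positivity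
  have hsρ : s ≤ ρ := by linarith
  have h0 : ∀ x, transversal x ∈ frontier ω → v x = 0 := fun x hx =>
    hv0.eq_zero_of_mem_frontier hω hμ (hv.of_le (by norm_num)) hc hx
  -- The choice of `ρ₁` makes `ρ` the dominant term of the slope on the closed cylinder.
  have hslope : ∀ x, transversal x ∈ closure ω →
      ρ / 2 ≤ ε * slope ε ρ s θ x ∧ ε * slope ε ρ s θ x ≤ 3 * ρ / 2 := by
    intro x hx
    have h1 : |⟪θ, transversal x⟫| ≤ R := by
      refine (abs_real_inner_le_norm _ _).trans ?_
      rw [hθ, one_mul]; exact hR _ hx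
    obtain ⟨h2, h3⟩ := abs_le.1 h1
    simp only [Waveguide.slope]
    rcases hε with rfl | rfl <;> constructor <;>
      nlinarith [mul_le_mul_of_nonneg_left h2 hs0, mul_le_mul_of_nonneg_left h3 hs0]
  have habs : ∀ x ∈ cylinder ω, |slope ε ρ s θ x| = ε * slope ε ρ s θ x := by
    intro x hx
    have h1 := (hslope x (subset_closure hx)).1
    have h2 : |slope ε ρ s θ x| = |ε * slope ε ρ s θ x| := by rcases hε with rfl | rfl <;> simp
    rw [h2, abs_of_nonneg (by linarith)]
  have hup : ∀ x ∈ cylinder ω, |slope ε ρ s θ x| ≤ 3 * ρ / 2 := fun x hx => by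
    rw [habs x hx]; exact (hslope x (subset_closure hx)).2
  have hlow : ∀ x ∈ cylinder ω, ρ / 2 ≤ |slope ε ρ s θ x| := fun x hx => by
    rw [habs x hx]; exact (hslope x (subset_closure hx)).1
  obtain ⟨hT, hb⟩ := hμ.mul_boundaryTerm_le hω (hv.of_le (by norm_num)) hc hε
    (by linarith) fun x hx => hslope x (frontier_subset_closure hx)
  have hcarl := carleman_inequality hω hμ hv hc h0 ε ρ hs0 hθ
  have hV := mul_le_mul_of_nonneg_left
    (mul_setIntegral_norm_sq_le hω.isOpen hv hc (by linarith) hlow) hs0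
  exact carleman_absorption K.2 (by linarith) (by linarith) hsρ
    (integral_nonneg fun _ => by positivity) (integral_nonneg fun _ => by positivity)
    (integral_nonneg fun _ => by positivity) hT (boundaryTerm_nonneg _ _) (by linarith) hb
    (setIntegral_symmPart_add_antisymmPart_le hω.isOpen hA hq hAq hv hc hθ (by linarith) hup)
    (mul_setIntegral_sum_pderiv_sq_le hω hμ hv hc h0 hs0 hup)
    (setIntegral_laplacian_sq_le hω.isOpen hv hc hup)
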